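/- **Setting.** There are $M$ clients. Client $i\in[M]$ has training data $\mathcal D_i$ of size $n$: either a finite dataset with $n$ samples, or ($n=\infty$, streaming case) a probability distribution. A random batch of size $s$, written $\mathcal B\sim\mathcal D_i$, $|\mathcal B|=s$, consists of $s$ distinct data points chosen uniformly at random (finite case; for $s=n$ it is the whole dataset) or of $s$ i.i.d. samples (streaming case). Let $f_i(x,z)$ be the loss of client $i$ at $x\in\mathbb R^d$ on the sample $z$, differentiable in $x$, measurable and integrable in $z$; let $f_i(x,\mathcal B)$ be its average over $z\in\mathcal B$, let $F_i(x)=\mathbb E_{\mathcal B\sim\mathcal D_i}f_i(x,\mathcal B)$, assumed differentiable, $F=\frac1M\sum_{i=1}^M F_i$, and $F_*=\inf F>-\infty$. $\|\cdot\|$ is the Euclidean norm and gradients are with respect to the parameters. **Assumptions.** For constants $L>0$, $\sigma\ge0$, $L_\sigma\ge0$, $\mu>0$, for all $i$, all $v,w\in\mathbb R^d$ and all batch sizes $1\le|\mathcal B|\le n$: 1. ($L$-smoothness) $\|\nabla F_i(v)-\nabla F_i(w)\|\le L\|v-w\|$; 2. (bounded noise) $\mathbb E_{\mathcal B\sim\mathcal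 D_i}\|\nabla f_i(v,\mathcal B)-\nabla F_i(v)\|^2\le\sigma^2/|\mathcal B|$; 3. (average smoothness) $\mathbb E_{\mathcal B\sim\mathcal D_i}\|(\nabla f_i(v,\mathcal B)-\nabla f_i(w,\mathcal B))-(\nabla F_i(v)-\nabla F_i(w))\|^2\le\frac{L_\sigma^2}{|\mathcal B|}\|v-w\|^2$; 4. (PL condition) $\|\nabla F(v)\|^2\ge2\mu(F(v)-F_*)$. **FedAMD with constant probability $p\in(0,1)$.** Let $1\le A\le M$. Start from $x_0\in\mathbb R^d$ and $v_0^{(i)}=\nabla f_i(x_0,\mathcal B_i)$, where $\mathcal B_i\sim\mathcal D_i$ are independent with $|\mathcal B_i|=b$. In round $t=0,1,2,\dots$ let $g_t=\frac1M\sum_i v_t^{(i)}$ and choose $A$ of the $M$ clients uniformly at random without replacement. Each chosen client is independently an anchor with probability $p$ and a miner with probability $1-p$. An anchor $i$ draws a fresh batch $\mathcal B$ of size $b$ and sets $v_{t+1}^{(i)}=\nabla f_i(x_t,\mathcal B)$; for all other clients $v_{t+1}^{(i)}=v_t^{(i)}$. A miner $i$ sets $x^{(i)}_{-1}=x^{(i)}_0=x_t$,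 $g^{(i)}_0=g_t$ and, for $k=0,\dots,K-1$, draws a fresh batch $\mathcal B_k$ of size $b'$ and sets $$g^{(i)}_{k+1}=g^{(i)}_k-\nabla f_i(x^{(i)}_{k-1},\mathcal B_k)+\nabla f_i(x^{(i)}_k,\mathcal B_k),\qquad x^{(i)}_{k+1}=x^{(i)}_k-\eta_l\,g^{(i)}_{k+1}.$$ If there is at least one miner, $x_{t+1}=x_t-\eta_s\cdot$ (the average of $x_t-x_K^{(i)}$ over the miners $i$); otherwise $x_{t+1}=x_t$. **Theorem.** For every $L>0$ and $\Delta$ there is a constant $C>0$, depending only on $L$ and $\Delta$, with the following property. Let the setting and the assumptions above hold with $F(x_0)-F_*\le\Delta$, let $0<\epsilon\le\frac12$, and let $$K\ge\max\Bigl(1,\tfrac{2L_\sigma^2}{b'L^2}\Bigr),\quad b=\min\Bigl(\Bigl\lceil\tfrac{\sigma^2}{M\mu\epsilon}\Bigr\rceil,n\Bigr),\quad 1\le b'<b,\quad \eta_l=\tfrac1{2\sqrt6KL},\quad \eta_s=\min\Bigl(\tfrac{2\sqrt6LAp}{M\mu(1-p^A)},\tfrac{2\sqrt6}{1+\frac{16ML}{\mu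 Ap}}\Bigr).$$ Then, for every number of rounds $$T\ge C\cdot\frac1{\mu(1-p^A)}\Bigl(1+\frac M{\mu Ap}+\frac{M\mu(1-p^A)}{Ap}\Bigr)\log\frac1\epsilon,$$ $F(x_T)$ is integrable and $\mathbb E\,F(x_T)-F_*\le\epsilon$. That is, FedAMD finds an $\epsilon$-approximation within $T=O\bigl(\frac1{\mu(1-p^A)}(1+\frac M{\mu Ap}+\frac{M\mu(1-p^A)}{Ap})\log\frac1\epsilon\bigr)$ rounds (linear convergence), $F(x_0)-F_*$ and $L$ being treated as constants. -/

import Mathlib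

open MeasureTheory ProbabilityTheory
open scoped ENNReal

namespace FedAMD

/-- The parameter space `ℝ^d` with its Euclidean norm. -/
abbrev Vec (d : ℕ) := EuclideanSpace ℝ (Fin d)

/-- The training data of one client: either a finite dataset of `n` samples, or, in the
streaming (online) case, a distribution from which fresh samples are drawn. -/
inductive LocalData (Z : Type*) [MeasurableSpace Z]
  | dataset (n : ℕ) (z : Fin n → Z)
  | stream (D : ProbabilityMeasure Z)

namespace LocalData

variable {Z : Type*} [MeasurableSpace Z]

/-- The number of samples of a client (infinite in the streaming case). -/
def size : LocalData Z → ℕ∞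
  | dataset n _ => (n : ℕ∞)
  | stream _ => ⊤

/-- The law of one random sample. -/
noncomputable def sampleLaw : LocalData Z → Measure Z
  | dataset n z => (uniformOn (Set.univ : Set (Fin n))).map z
  | stream D => (D : Measure Z)

/-- The law of a random batch of `s` samples: `s` distinct data points chosen uniformly at random
from a finite dataset (so that `s = n` gives the whole dataset), and `s` independent samples in
the streaming case. -/
noncomputable def batchLaw : LocalData Z → (s : ℕ) → Measure (Fin s → Z)
  | dataset n z, s =>
      (uniformOn {g : Fin s → Fin n | Function.Injective g}).map (fun g j => z (g j))
  | stream D, s => Measure.pi (fun _ : Fin s => (D : Measure Z))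

end LocalData

section Objective

variable {Z : Type*} [MeasurableSpace Z] {d M : ℕ}

/-- The empirical loss `f(x, B)` of a batch `B`, where `f x z` is the loss of one sample. -/
noncomputable def batchLoss (f : Vec d → Z → ℝ) {s : ℕ} (B : Fin s → Z) (x : Vec d) : ℝ :=
  (s : ℝ)⁻¹ * ∑ j, f x (B j)

/-- The stochastic gradient `∇f(x, B)` with respect to `x`. -/
noncomputable def batchGrad (f : Vec d → Z → ℝ) {s : ℕ} (B : Fin s → Z) (x : Vec d) : Vec d :=
  gradient (batchLoss f B) x

/-- The local expected loss of a client. -/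
noncomputable def localLoss (f : Vec d → Z → ℝ) (D : LocalData Z) (x : Vec d) : ℝ :=
  ∫ z, f x z ∂D.sampleLaw

/-- The global objective: the average of the local expected losses. -/
noncomputable def globalLoss (f : Fin M → Vec d → Z → ℝ) (D : Fin M → LocalData Z)
    (x : Vec d) : ℝ :=
  (M : ℝ)⁻¹ * ∑ i, localLoss (f i) (D i) x

/-- Regularity that is needed to speak of expected losses and of stochastic gradients. -/
def RegularLoss (f : Fin M → Vec d → Z → ℝ) (D : Fin M → LocalData Z) : Prop :=
  (∀ i z, Differentiable ℝ (fun x => f i x z)) ∧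
  (∀ i x, Measurable (f i x)) ∧
  (∀ i x, Integrable (f i x) (D i).sampleLaw)

/-- The local objectives are `L`-smooth. -/
def LSmooth (f : Fin M → Vec d → Z → ℝ) (D : Fin M → LocalData Z) (L : ℝ) : Prop :=
  ∀ i, Differentiable ℝ (localLoss (f i) (D i)) ∧
    ∀ v w, ‖gradient (localLoss (f i) (D i)) v - gradient (localLoss (f i) (D i)) w‖
      ≤ L * ‖v - w‖

/-- Bounded noise: the variance of a batch gradient is at most `σ² / |B|`. -/
def BoundedNoise (f : Fin M → Vec d → Z → ℝ) (D : Fin M → LocalData Z) (σ : ℝ) : Prop :=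
  ∀ i (s : ℕ), 1 ≤ s → (s : ℕ∞) ≤ (D i).size → ∀ v,
    ∫⁻ B, ‖batchGrad (f i) B v - gradient (localLoss (f i) (D i)) v‖ₑ ^ 2 ∂(D i).batchLaw s
      ≤ ENNReal.ofReal (σ ^ 2 / s)

/-- Average smoothness of the batch gradients, with constant `Lσ² / |B|`. -/
def AverageSmooth (f : Fin M → Vec d → Z → ℝ) (D : Fin M → LocalData Z) (Lσ : ℝ) : Prop :=
  ∀ i (s : ℕ), 1 ≤ s → (s : ℕ∞) ≤ (D i).size → ∀ v w,
    ∫⁻ B, ‖(batchGrad (f i) B v - batchGrad (f i) B w)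
        - (gradient (localLoss (f i) (D i)) v - gradient (localLoss (f i) (D i)) w)‖ₑ ^ 2
        ∂(D i).batchLaw s
      ≤ ENNReal.ofReal (Lσ ^ 2 / s * ‖v - w‖ ^ 2)

/-- The Polyak-Lojasiewicz condition with parameter `μ`, for a function with infimum `Fmin`. -/
def PLCondition (F : Vec d → ℝ) (Fmin μ : ℝ) : Prop :=
  ∀ v, 2 * μ * (F v - Fmin) ≤ ‖gradient F v‖ ^ 2

end Objective

section Algorithm

variable {Z : Type*} {d M b K b' : ℕ}

/-- The random choices of one round: the set of participants, the coin of each client (`true`: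
anchor, `false`: miner), a large batch for each client, and `K` small batches for each client. The
choices of clients that do not need them in the round are never read. -/
abbrev RoundChoice (Z : Type*) (M b K b' : ℕ) :=
  Finset (Fin M) × (Fin M → Bool) × (Fin M → Fin b → Z) × (Fin M → Fin K → Fin b' → Z)

/-- The server state: the global model `x_t` and the caching gradients `v_t`. -/
abbrev State (d M : ℕ) := Vec d × (Fin M → Vec d)

/-- The global bullseye: the average of the caching gradients. -/
noncomputable def bullseye (v : Fin M → Vec d) : Vec d :=
  (M : ℝ)⁻¹ • ∑ i, v i

/-- The local run of a miner, started at `x` with direction `g`. The value at `k` is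
`(x_{k-1}, x_k, g_k)`, where `x_{-1} = x_0 = x`, `g_0 = g`,
`g_{k+1} = g_k - ∇f(x_{k-1}, B_k) + ∇f(x_k, B_k)` and `x_{k+1} = x_k - ηl g_{k+1}`. -/
noncomputable def minerIterate (f : Vec d → Z → ℝ) (ηl : ℝ) (B : Fin K → Fin b' → Z)
    (x g : Vec d) : ℕ → Vec d × Vec d × Vec d
  | 0 => (x, x, g)
  | k + 1 =>
    if h : k < K then
      let s := minerIterate f ηl B x g k
      let g' := s.2.2 - batchGrad f (B ⟨k, h⟩) s.1 + batchGrad f (B ⟨k, h⟩) s.2.1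
      (s.2.1, s.2.1 - ηl • g', g')
    else minerIterate f ηl B x g k

/-- The model change `x_t - x_K` that a miner sends to the server. -/
noncomputable def minerChange (f : Vec d → Z → ℝ) (ηl : ℝ) (B : Fin K → Fin b' → Z)
    (x g : Vec d) : Vec d :=
  x - (minerIterate f ηl B x g K).2.1

/-- The miners of a round. -/
def miners (r : RoundChoice Z M b K b') : Finset (Fin M) :=
  r.1.filter (fun i => r.2.1 i = false)

/-- One round: participants whose coin shows `true` refresh their caching gradient with a large
batch, and the model moves by `ηs` times the averaged change of the miners, if there are any. -/
noncomputable def round (f : Fin M → Vec d → Z → ℝ) (ηl ηs : ℝ) (st : State d M)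
    (r : RoundChoice Z M b K b') : State d M :=
  (if (miners r).Nonempty then
      st.1 - ηs • (((miners r).card : ℝ)⁻¹ •
        ∑ i ∈ miners r, minerChange (f i) ηl (r.2.2.2 i) st.1 (bullseye st.2))
    else st.1,
   fun i => if i ∈ r.1 ∧ r.2.1 i = true then batchGrad (f i) (r.2.2.1 i) st.1 else st.2 i)

/-- All random choices of a run: the large batches that initialize the caching gradients, and the
choices of the rounds `0, 1, 2, …`. -/
abbrev RunChoice (Z : Type*) (M b K b' : ℕ) :=
  (Fin M → Fin b → Z) × (ℕ → RoundChoice Z M b K b')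

/-- The state before round `t`, for a run that starts at the model `x₀`. -/
noncomputable def run (f : Fin M → Vec d → Z → ℝ) (ηl ηs : ℝ) (x₀ : Vec d)
    (ω : RunChoice Z M b K b') : ℕ → State d M
  | 0 => (x₀, fun i => batchGrad (f i) (ω.1 i) x₀)
  | t + 1 => round f ηl ηs (run f ηl ηs x₀ ω t) (ω.2 t)

/-- The global model `x_t`. -/
noncomputable def model (f : Fin M → Vec d → Z → ℝ) (ηl ηs : ℝ) (x₀ : Vec d)
    (ω : RunChoice Z M b K b') (t : ℕ) : Vec d :=
  (run f ηl ηs x₀ ω t).1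

variable [MeasurableSpace Z]

/-- The law of the choices of one round: `A` participants uniformly without replacement, a
Bernoulli coin with probability `p` of `true` for each client, and a large batch and `K` small
batches for each client, all independent. -/
noncomputable def roundLaw (D : Fin M → LocalData Z) (A b K b' : ℕ) (p : unitInterval) :
    Measure (RoundChoice Z M b K b') :=
  (uniformOn {S : Finset (Fin M) | S.card = A}).prod
    ((Measure.pi fun _ : Fin M => bernoulliMeasure true false p).prod
      ((Measure.pi fun i : Fin M => (D i).batchLaw b).prod
        (Measure.pi fun i : Fin M => Measure.pi fun _ : Fin K => (D i).batchLaw b')))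

/-- The law of all choices of a run: initial batches and rounds are independent, and the rounds
are identically distributed. -/
noncomputable def runLaw (D : Fin M → LocalData Z) (A b K b' : ℕ) (p : unitInterval) :
    Measure (RunChoice Z M b K b') :=
  (Measure.pi fun i : Fin M => (D i).batchLaw b).prod
    (Measure.infinitePi fun _ : ℕ => roundLaw D A b K b' p)

end Algorithm

end FedAMD

/-! Write `η = ηs * (ηl * K)` for the effective server step, `q = A / M * p` for the chance that a
given client refreshes its cache in a round, and `P = 1 - p ^ A` for the chance that a round has a
miner. The proof shows that `F - F_*` plus a multiple of the staleness of the cache contracts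
geometrically in expectation, up to a noise term of order `ε`.

A cached gradient was computed at some earlier model `y_i`. Recording `y_i` (`AugState`) splits the
error of the bullseye `g` into sampling noise `v_i - ∇F_i(y_i)` and a drift `∇F_i(y_i) - ∇F_i(x)`.
By smoothness the mean squared drift is at most `L²` times the staleness, the mean of `‖y_i - x‖²`,
so no bound on client heterogeneity is needed. The noise of different clients stays uncorrelated,
because a refresh uses a fresh, unbiased, independent batch and the selection ignores the past
(`lintegral_noise_augRun_le`). With the prescribed `b` the averaged noise therefore has second
moment at most `μ ε`; a full dataset has no noise at all. Unbiasedness is not assumed: it comes from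
differentiating under the integral sign (`RegularClient.integral_batchGrad`).

A local run corrects `g` by gradient differences along a path of small steps. Its average direction
has second moment at most `1.7 ‖g‖²` and mean squared distance at most `0.19 ‖g‖²` from `g`
(`RegularClient.lintegral_minerDirection_le`). The descent inequality supplies `-0.5 η ‖g‖²`, which
pays for both quantities and for the staleness created by the move.

Staleness shrinks by the factor `1 - q` through refreshing and grows with the squared displacement.
With weight `β = 6 P η L² / q` its decay absorbs the drift error of `g`, and the PL condition turns
`-‖∇F‖²` into contraction: `E V_{t+1} ≤ (1 - ρ) E V_t + 0.625 P η μ ε` with `ρ = 0.7 P η μ`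
(`lintegral_lyapunov_round_le`). The fixed point is below `0.893 ε`, the choice of `ηs` bounds `1 /
ρ` by the claimed rate, and the initial gap decays to `ε / 10`.

Expectations are mostly lower integrals of nonnegative functions, so integrability is a conclusion
and not a side condition. -/

namespace FedAMD

/-! ### Resampling of coordinates, centred sums and driven Markov chains. -/

section ProbabilityTools

/-- Replacing one coordinate by an independent copy preserves a product measure. -/
lemma measurePreserving_update_infinitePi {ι : Type*} [DecidableEq ι] {X : ι → Type*}
    [∀ i, MeasurableSpace (X i)] (ν : ∀ i, Measure (X i)) [∀ i, IsProbabilityMeasure (ν i)]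
    (k : ι) :
    MeasurePreserving (fun q : (∀ i, X i) × X k => Function.update q.1 k q.2)
      ((Measure.infinitePi ν).prod (ν k)) (Measure.infinitePi ν) := by
  have hm : Measurable (fun q : (∀ i, X i) × X k => Function.update q.1 k q.2) := by
    refine measurable_pi_lambda _ fun i => ?_
    by_cases h : i = k
    · subst h; simpa using measurable_snd
    · simp only [Function.update_of_ne h]; fun_prop
  refine ⟨hm, Measure.eq_infinitePi ν fun s t ht => ?_⟩
  rw [Measure.map_apply hm (MeasurableSet.pi s.countable_toSet fun i _ => ht i)]
  by_cases hk : k ∈ s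
  · have : (fun q : (∀ i, X i) × X k => Function.update q.1 k q.2) ⁻¹' (Set.pi s t)
        = (Set.pi (s.erase k : Finset ι) t) ×ˢ t k := by
      ext q
      simp only [Set.mem_preimage, Set.mem_pi, Set.mem_prod, Finset.mem_coe, Finset.mem_erase]
      constructor
      · intro h
        refine ⟨fun i hi => ?_, ?_⟩
        · simpa [Function.update_of_ne hi.1] using h i hi.2
        · simpa using h k hk
      · rintro ⟨h1, h2⟩ i hi
        by_cases hik : i = k
        · subst hik; simpa using h2
        · simpa [Function.update_of_ne hik] using h1 i ⟨hik, hi⟩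
    rw [this, Measure.prod_prod, Measure.infinitePi_pi _ (fun i _ => ht i),
      Finset.prod_erase_mul _ _ hk]
  · have : (fun q : (∀ i, X i) × X k => Function.update q.1 k q.2) ⁻¹' (Set.pi s t)
        = (Set.pi s t) ×ˢ Set.univ := by
      ext q
      simp only [Set.mem_preimage, Set.mem_pi, Set.mem_prod, Finset.mem_coe, Set.mem_univ,
        and_true]
      refine forall₂_congr fun i hi => ?_
      rw [Function.update_of_ne (ne_of_mem_of_not_mem hi hk)]
    rw [this, Measure.prod_prod, Measure.infinitePi_pi _ (fun i _ => ht i), measure_univ, mul_one]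

/-- If `u` does not read the coordinate `k`, then that coordinate may be replaced by an
independent copy. -/
lemma lintegral_infinitePi_resample {ι S : Type*} [DecidableEq ι] {X : ι → Type*}
    [∀ i, MeasurableSpace (X i)] [MeasurableSpace S] (ν : ∀ i, Measure (X i))
    [∀ i, IsProbabilityMeasure (ν i)] (k : ι) {u : (∀ i, X i) → S} (hu : Measurable u)
    (huk : ∀ ω r, u (Function.update ω k r) = u ω) {φ : S × X k → ℝ≥0∞} (hφ : Measurable φ) :
    ∫⁻ ω, φ (u ω, ω k) ∂Measure.infinitePi ν
      = ∫⁻ ω, ∫⁻ r, φ (u ω, r) ∂ν k ∂Measure.infinitePi ν := by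
  have h1 : Measurable fun ω => φ (u ω, ω k) := hφ.comp (hu.prodMk (measurable_pi_apply k))
  rw [← (measurePreserving_update_infinitePi ν k).lintegral_comp h1, lintegral_prod]
  · simp [huk]
  · exact (h1.comp (measurePreserving_update_infinitePi ν k).measurable).aemeasurable

lemma lintegral_pi_resample {ι S : Type*} [DecidableEq ι] [Fintype ι] {X : ι → Type*}
    [∀ i, MeasurableSpace (X i)] [MeasurableSpace S] (ν : ∀ i, Measure (X i))
    [∀ i, IsProbabilityMeasure (ν i)] (k : ι) {u : (∀ i, X i) → S} (hu : Measurable u)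
    (huk : ∀ ω r, u (Function.update ω k r) = u ω) {φ : S × X k → ℝ≥0∞} (hφ : Measurable φ) :
    ∫⁻ ω, φ (u ω, ω k) ∂Measure.pi ν = ∫⁻ ω, ∫⁻ r, φ (u ω, r) ∂ν k ∂Measure.pi ν := by
  rw [← Measure.infinitePi_eq_pi]
  exact lintegral_infinitePi_resample ν k hu huk hφ

variable {Ω E : Type*} [MeasurableSpace Ω] [NormedAddCommGroup E] [InnerProductSpace ℝ E]

lemma enorm_sq_eq_ofReal {E : Type*} [SeminormedAddCommGroup E] (x : E) :
    ‖x‖ₑ ^ 2 = ENNReal.ofReal (‖x‖ ^ 2) := by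
  rw [← ofReal_norm, ENNReal.ofReal_pow (norm_nonneg _)]

lemma memLp_two_of_lintegral_lt_top {E : Type*} [NormedAddCommGroup E] {P : Measure Ω} {N : Ω → E}
    (hN : AEStronglyMeasurable N P) (h : ∫⁻ ω, ‖N ω‖ₑ ^ 2 ∂P < ∞) : MemLp N 2 P := by
  refine ⟨hN, ?_⟩
  rw [eLpNorm_lt_top_iff_lintegral_rpow_enorm_lt_top (by norm_num) (by norm_num)]
  simpa using h

/-- The cross term `2⟪c, N⟫` has mean zero. -/
lemma lintegral_enorm_add_sq_le [CompleteSpace E] {P : Measure Ω} [IsProbabilityMeasure P]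
    {N : Ω → E} (hN : AEStronglyMeasurable N P) {V : ℝ≥0∞} (hV : V ≠ ∞)
    (h : ∫⁻ ω, ‖N ω‖ₑ ^ 2 ∂P ≤ V) (h0 : ∫ ω, N ω ∂P = 0) (c : E) :
    ∫⁻ ω, ‖c + N ω‖ₑ ^ 2 ∂P ≤ ‖c‖ₑ ^ 2 + V := by
  have hL : MemLp N 2 P := memLp_two_of_lintegral_lt_top hN (h.trans_lt hV.lt_top)
  have hi : Integrable N P := hL.integrable (by norm_num)
  have hi2 : Integrable (fun ω => ‖N ω‖ ^ 2) P := hL.integrable_norm_pow (by norm_num)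
  have hin : Integrable (fun ω => 2 * inner ℝ c (N ω)) P := (hi.const_inner c).const_mul 2
  have e1 : ∀ ω, ‖c + N ω‖ ^ 2 = ‖c‖ ^ 2 + 2 * inner ℝ c (N ω) + ‖N ω‖ ^ 2 :=
    fun ω => norm_add_sq_real _ _
  have hA : Integrable (fun ω => ‖c‖ ^ 2 + 2 * inner ℝ c (N ω)) P :=
    (integrable_const _).add hin
  have e2 : ∫ ω, ‖c + N ω‖ ^ 2 ∂P = ‖c‖ ^ 2 + ∫ ω, ‖N ω‖ ^ 2 ∂P := by
    simp_rw [e1]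
    rw [integral_add hA hi2, integral_add (integrable_const _) hin, integral_const_mul,
      integral_inner hi, h0]
    simp
  have hI : Integrable (fun ω => ‖c + N ω‖ ^ 2) P := by
    simp_rw [e1]; exact hA.add hi2
  simp_rw [enorm_sq_eq_ofReal] at h ⊢
  rw [← ofReal_integral_eq_lintegral_ofReal hI (.of_forall fun _ => by positivity), e2,
    ENNReal.ofReal_add (by positivity) (integral_nonneg fun _ => by positivity)]
  gcongr
  rwa [ofReal_integral_eq_lintegral_ofReal hi2 (.of_forall fun _ => by positivity)]

/-- A sum of independent centered vectors, with second moments at most `V`. -/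
lemma lintegral_pi_enorm_add_sum_sq_le [CompleteSpace E] [MeasurableSpace E]
    [BorelSpace E] [SecondCountableTopology E]
    {ι : Type*} [Fintype ι] [DecidableEq ι]
    {X : ι → Type*} [∀ i, MeasurableSpace (X i)] (ν : ∀ i, Measure (X i))
    [∀ i, IsProbabilityMeasure (ν i)] {N : ∀ i, X i → E} (hN : ∀ i, Measurable (N i))
    {V : ℝ≥0∞} (hV : V ≠ ∞) (h : ∀ i, ∫⁻ ω, ‖N i ω‖ₑ ^ 2 ∂ν i ≤ V)
    (h0 : ∀ i, ∫ ω, N i ω ∂ν i = 0) (c : E) (T : Finset ι) :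
    ∫⁻ ω, ‖c + ∑ i ∈ T, N i (ω i)‖ₑ ^ 2 ∂Measure.pi ν ≤ ‖c‖ₑ ^ 2 + T.card * V := by
  induction T using Finset.induction_on with
  | empty => simp
  | insert k T hk ih =>
    -- The partial sum over `T` does not read coordinate `k`, so it acts as a constant once that
    -- coordinate is resampled.
    have hu : Measurable fun ω : ∀ i, X i => c + ∑ i ∈ T, N i (ω i) := by
      refine measurable_const.add (Finset.measurable_sum _ fun i _ => ?_)
      exact (hN i).comp (measurable_pi_apply i)
    have hφ : Measurable fun q : E × X k => ‖q.1 + N k q.2‖ₑ ^ 2 := by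
      have := hN k
      fun_prop
    have huk : ∀ (ω : ∀ i, X i) r, c + ∑ i ∈ T, N i (Function.update ω k r i)
        = c + ∑ i ∈ T, N i (ω i) := by
      intro ω r
      congr 1
      refine Finset.sum_congr rfl fun i hi => ?_
      rw [Function.update_of_ne (ne_of_mem_of_not_mem hi hk)]
    calc ∫⁻ ω, ‖c + ∑ i ∈ insert k T, N i (ω i)‖ₑ ^ 2 ∂Measure.pi ν
        = ∫⁻ ω, ‖(c + ∑ i ∈ T, N i (ω i)) + N k (ω k)‖ₑ ^ 2 ∂Measure.pi ν := by
          refine lintegral_congr fun ω => ?_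
          rw [Finset.sum_insert hk, add_comm (N k (ω k)), ← add_assoc]
      _ = ∫⁻ ω, ∫⁻ r, ‖(c + ∑ i ∈ T, N i (ω i)) + N k r‖ₑ ^ 2 ∂ν k ∂Measure.pi ν :=
          lintegral_pi_resample ν k hu huk hφ
      _ ≤ ∫⁻ ω, (‖c + ∑ i ∈ T, N i (ω i)‖ₑ ^ 2 + V) ∂Measure.pi ν :=
          lintegral_mono fun ω => lintegral_enorm_add_sq_le
            (hN k).aestronglyMeasurable hV (h k) (h0 k) _
      _ = ∫⁻ ω, ‖c + ∑ i ∈ T, N i (ω i)‖ₑ ^ 2 ∂Measure.pi ν + V := by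
          rw [lintegral_add_right _ measurable_const]; simp
      _ ≤ _ := by
          rw [Finset.card_insert_of_notMem hk]
          push_cast
          rw [add_mul, one_mul, ← add_assoc]
          gcongr

lemma measurable_chain {Ω₀ R S : Type*} [MeasurableSpace Ω₀] [MeasurableSpace R]
    [MeasurableSpace S] {init : Ω₀ → S} {step : S → R → S} (hinit : Measurable init)
    (hstep : Measurable (Function.uncurry step)) {X : Ω₀ × (ℕ → R) → ℕ → S}
    (h0 : ∀ ω, X ω 0 = init ω.1) (hs : ∀ ω t, X ω (t + 1) = step (X ω t) (ω.2 t)) (t : ℕ) :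
    Measurable (fun ω => X ω t) := by
  induction t with
  | zero => simp only [h0]; exact hinit.comp measurable_fst
  | succ t ih =>
    simp only [hs]
    exact hstep.comp (ih.prodMk ((measurable_pi_apply t).comp measurable_snd))

/-- One step of a Markov chain that is driven by independent copies of a random choice. -/
lemma lintegral_chain_succ {Ω₀ R S : Type*} [MeasurableSpace Ω₀] [MeasurableSpace R]
    [MeasurableSpace S] (ν : Measure Ω₀) [SFinite ν] (ρ : Measure R) [IsProbabilityMeasure ρ]
    {init : Ω₀ → S} {step : S → R → S} (hinit : Measurable init)
    (hstep : Measurable (Function.uncurry step)) {X : Ω₀ × (ℕ → R) → ℕ → S}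
    (h0 : ∀ ω, X ω 0 = init ω.1) (hs : ∀ ω t, X ω (t + 1) = step (X ω t) (ω.2 t)) (t : ℕ) :
    ∀ {φ : S → ℝ≥0∞}, Measurable φ →
      ∫⁻ ω, φ (X ω (t + 1)) ∂ν.prod (Measure.infinitePi fun _ : ℕ => ρ)
        = ∫⁻ ω, ∫⁻ r, φ (step (X ω t) r) ∂ρ ∂ν.prod (Measure.infinitePi fun _ : ℕ => ρ) := by
  have hX := measurable_chain hinit hstep h0 hs
  -- The state at time `s` reads only the choices of rounds before `s`; hence round `t` may be
  -- resampled given the state at `t`.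
  have hupd : ∀ (a : Ω₀) (w : ℕ → R) (r : R) (k s : ℕ), s ≤ k →
      X (a, Function.update w k r) s = X (a, w) s := by
    intro a w r k s
    induction s with
    | zero => simp [h0]
    | succ s ih =>
      intro hsk
      rw [hs, hs, ih (by omega)]
      simp only [Function.update_of_ne (show s ≠ k by omega)]
  intro φ hφ
  have hψ : Measurable (Function.uncurry fun (s : S) (r : R) => φ (step s r)) := hφ.comp hstep
  have h1 : Measurable fun ω => φ (X ω (t + 1)) := hφ.comp (hX (t + 1))
  have h2 : Measurable fun ω => ∫⁻ r, φ (step (X ω t) r) ∂ρ :=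
    hψ.lintegral_prod_right.comp (hX t)
  rw [lintegral_prod _ h1.aemeasurable, lintegral_prod _ h2.aemeasurable]
  refine lintegral_congr fun a => ?_
  simp only [hs]
  exact lintegral_infinitePi_resample (fun _ : ℕ => ρ) t
    ((hX t).comp measurable_prodMk_left) (fun w r => hupd a w r t t le_rfl) hψ

end ProbabilityTools

/-! ### Joint measurability of stochastic gradients. -/

section Gradients

variable {Z : Type*} [MeasurableSpace Z] {d : ℕ}

lemma measurable_uncurry_loss {f : Vec d → Z → ℝ} (hd : ∀ z, Differentiable ℝ fun x => f x z)
    (hm : ∀ x, Measurable (f x)) : Measurable fun q : Vec d × Z => f q.1 q.2 :=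
  measurable_uncurry_of_continuous_of_measurable (u := f) (fun z => (hd z).continuous) hm

/-- The gradient of a loss is jointly measurable in the parameters and the sample. -/
lemma measurable_gradient_loss {f : Vec d → Z → ℝ} (hd : ∀ z, Differentiable ℝ fun x => f x z)
    (hm : ∀ x, Measurable (f x)) :
    Measurable fun q : Vec d × Z => gradient (fun x => f x q.2) q.1 := by
  have hf := measurable_uncurry_loss hd hm
  let e := EuclideanSpace.basisFun (Fin d) ℝ
  have h1 : ∀ q : Vec d × Z, gradient (fun x => f x q.2) q.1
      = ∑ j, (fderiv ℝ (fun x => f x q.2) q.1 (e j)) • e j := by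
    intro q
    rw [← e.sum_repr' (gradient (fun x => f x q.2) q.1)]
    refine Finset.sum_congr rfl fun j _ => ?_
    rw [gradient, real_inner_comm, InnerProductSpace.toDual_symm_apply]
  simp_rw [h1]
  refine Finset.measurable_sum _ fun j _ => Measurable.smul_const ?_ _
  -- Partial derivatives are limits of difference quotients with increment `1 / n`. Each quotient is
  -- jointly measurable because the loss is continuous in `x` and measurable in `z`.
  refine measurable_of_tendsto_metrizable (f := fun (n : ℕ) (q : Vec d × Z) =>
    (n : ℝ) • (f (q.1 + (n : ℝ)⁻¹ • e j) q.2 - f q.1 q.2)) (fun n => ?_) ?_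
  · have h2 : Measurable fun q : Vec d × Z => f (q.1 + (n : ℝ)⁻¹ • e j) q.2 :=
      hf.comp ((measurable_fst.add_const _).prodMk measurable_snd)
    exact (h2.sub hf).const_smul (n : ℝ)
  · rw [tendsto_pi_nhds]
    intro q
    exact ((hd q.2 q.1).hasFDerivAt.lim_real (e j)).comp tendsto_natCast_atTop_atTop

omit [MeasurableSpace Z] in
lemma batchGrad_eq {f : Vec d → Z → ℝ} (hd : ∀ z, Differentiable ℝ fun x => f x z)
    {s : ℕ} (B : Fin s → Z) (x : Vec d) :
    batchGrad f B x = (s : ℝ)⁻¹ • ∑ j, gradient (fun x => f x (B j)) x := by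
  unfold batchGrad gradient batchLoss
  rw [fderiv_const_mul (DifferentiableAt.fun_sum fun j _ => hd (B j) x),
    fderiv_fun_sum fun j _ => hd (B j) x]
  simp

lemma measurable_batchGrad {f : Vec d → Z → ℝ} (hd : ∀ z, Differentiable ℝ fun x => f x z)
    (hm : ∀ x, Measurable (f x)) (s : ℕ) :
    Measurable fun q : (Fin s → Z) × Vec d => batchGrad f q.1 q.2 := by
  simp_rw [batchGrad_eq hd]
  refine Measurable.const_smul (Finset.measurable_sum _ fun j _ => ?_) (s : ℝ)⁻¹
  exact (measurable_gradient_loss hd hm).comp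
    (measurable_snd.prodMk ((measurable_pi_apply j).comp measurable_fst))

end Gradients

/-! ### Batch laws and their one-sample marginals. -/

namespace LocalData

variable {Z : Type*} [MeasurableSpace Z]

lemma finite_nonempty_injections {n s : ℕ} (h : s ≤ n) :
    {g : Fin s → Fin n | Function.Injective g}.Nonempty :=
  ⟨Fin.castLE h, Fin.castLE_injective h⟩

lemma isProbabilityMeasure_batchLaw (D : LocalData Z) {s : ℕ} (h : (s : ℕ∞) ≤ D.size) :
    IsProbabilityMeasure (D.batchLaw s) := by
  cases D with
  | dataset n z =>
    have hsn : s ≤ n := by simpa [size] using h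
    have := isProbabilityMeasure_uniformOn (Set.toFinite _) (finite_nonempty_injections hsn)
    exact Measure.isProbabilityMeasure_map (Measurable.of_discrete).aemeasurable
  | stream D => simp only [batchLaw]; infer_instance

/-- Composing with the transposition of `k` and `k'` permutes the injections and exchanges the
events `g j = k` and `g j = k'`. So all atoms have equal mass. -/
lemma map_eval_uniformOn_injective {n s : ℕ} (h : s ≤ n) (j : Fin s) :
    (uniformOn {g : Fin s → Fin n | Function.Injective g}).map (fun g => g j)
      = uniformOn Set.univ := by
  classical
  have hp := isProbabilityMeasure_uniformOn (Set.toFinite _) (finite_nonempty_injections h)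
  have : Nonempty (Fin n) := ⟨Fin.castLE h j⟩
  set m := (uniformOn {g : Fin s → Fin n | Function.Injective g}).map (fun g => g j) with hm
  have hpm : IsProbabilityMeasure m :=
    Measure.isProbabilityMeasure_map (Measurable.of_discrete).aemeasurable
  have hle : ∀ k k' : Fin n, m {k} ≤ m {k'} := by
    intro k k'
    rw [hm, Measure.map_apply .of_discrete (.singleton _),
      Measure.map_apply .of_discrete (.singleton _)]
    have e1 : ∀ k : Fin n, (fun g : Fin s → Fin n => g j) ⁻¹' {k}
        = ((Finset.univ.filter fun g : Fin s → Fin n => g j = k : Finset _) : Set _) := by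
      intro k; ext; simp
    have e2 : {g : Fin s → Fin n | Function.Injective g}
        = ((Finset.univ.filter fun g : Fin s → Fin n => Function.Injective g : Finset _) :
            Set _) := by
      ext; simp
    rw [e1, e1, e2, uniformOn_apply_finset, uniformOn_apply_finset]
    refine ENNReal.div_le_div_right (Nat.cast_le.2 ?_) _
    refine Finset.card_le_card_of_injOn (fun (g : Fin s → Fin n) => Equiv.swap k k' ∘ g) ?_ ?_
    · intro g hg
      simp only [Finset.coe_inter, Finset.coe_filter, Finset.mem_univ, true_and,
        Set.mem_inter_iff, Set.mem_ofPred_eq] at hg ⊢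
      exact ⟨(Equiv.injective _).comp hg.1, by simp [hg.2]⟩
    · intro g _ g' _ hgg
      exact (Equiv.swap k k').injective.comp_left hgg
  refine Measure.ext_of_singleton fun k => ?_
  have hsum : (n : ℝ≥0∞) * m {k} = 1 := by
    have := sum_measure_singleton (μ := m) (s := (Finset.univ : Finset (Fin n)))
    rw [Finset.coe_univ, measure_univ,
      Finset.sum_congr rfl fun k' _ => le_antisymm (hle k' k) (hle k k')] at this
    simpa using this
  rw [uniformOn_univ, Measure.count_singleton, Fintype.card_fin,
    ENNReal.eq_div_iff (by simpa using (Fin.pos k).ne') (by simp), hsum]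

/-- Every sample of a batch has the law of one random sample. -/
lemma map_eval_batchLaw (D : LocalData Z) {s : ℕ} (h : (s : ℕ∞) ≤ D.size) (j : Fin s) :
    (D.batchLaw s).map (fun B => B j) = D.sampleLaw := by
  cases D with
  | dataset n z =>
    have hsn : s ≤ n := by simpa [size] using h
    simp only [batchLaw, sampleLaw]
    rw [Measure.map_map (measurable_pi_apply j) .of_discrete,
      ← map_eval_uniformOn_injective hsn j, Measure.map_map .of_discrete .of_discrete]
    rfl
  | stream D =>
    exact (measurePreserving_eval (fun _ : Fin s => (D : Measure Z)) j).map_eq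

lemma measurePreserving_eval_batchLaw (D : LocalData Z) {s : ℕ} (h : (s : ℕ∞) ≤ D.size)
    (j : Fin s) : MeasurePreserving (fun B : Fin s → Z => B j) (D.batchLaw s) D.sampleLaw :=
  ⟨measurable_pi_apply j, D.map_eval_batchLaw h j⟩

lemma isProbabilityMeasure_sampleLaw (D : LocalData Z) (h : 1 ≤ D.size) :
    IsProbabilityMeasure D.sampleLaw := by
  have h1 : ((1 : ℕ) : ℕ∞) ≤ D.size := by simpa using h
  have := D.isProbabilityMeasure_batchLaw h1
  rw [← D.map_eval_batchLaw h1 0]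
  exact Measure.isProbabilityMeasure_map (measurable_pi_apply 0).aemeasurable

end LocalData

/-! ### Unbiasedness of batch gradients. -/

section Unbiased

variable {Z : Type*} [MeasurableSpace Z] {d : ℕ}

/-- Differentiation under the integral sign, when the derivative is Lipschitz at `0` in `L¹`. -/
lemma hasDerivAt_integral_of_lipschitz_L1 {P : Measure Z} [SFinite P]
    {φ φ' : ℝ → Z → ℝ} (hφ : ∀ z t, HasDerivAt (fun t => φ t z) (φ' t z) t)
    (hm : Measurable (Function.uncurry φ')) (hi : ∀ t, Integrable (φ t) P)
    (hi' : Integrable (φ' 0) P) (C : NNReal)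
    (hC : ∀ t, ∫⁻ z, ‖φ' t z - φ' 0 z‖ₑ ∂P ≤ C * ‖t‖ₑ) :
    HasDerivAt (fun t => ∫ z, φ t z ∂P) (∫ z, φ' 0 z ∂P) 0 := by
  have hm0 : Measurable (φ' 0) := hm.comp measurable_prodMk_left
  have hbound : ∀ t, ‖(∫ z, φ t z ∂P) - (∫ z, φ 0 z ∂P) - t * ∫ z, φ' 0 z ∂P‖ₑ
      ≤ C * ‖t‖ₑ * ‖t‖ₑ := by
    intro t
    -- This is the fundamental theorem of calculus for each `z`. If the right side is infinite there
    -- is nothing to prove; otherwise its finiteness is the interval integrability that the theorem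
    -- needs. Tonelli then brings in the `L¹` bound `hC`, and the remainder is `O(t²)`.
    have hpt : ∀ z, ‖φ t z - φ 0 z - t * φ' 0 z‖ₑ
        ≤ ∫⁻ s in Set.uIoc 0 t, ‖φ' s z - φ' 0 z‖ₑ := by
      intro z
      by_cases hfin : ∫⁻ s in Set.uIoc 0 t, ‖φ' s z - φ' 0 z‖ₑ = ∞
      · rw [hfin]; exact le_top
      have hms : Measurable fun s => φ' s z := hm.comp measurable_prodMk_right
      have hint : IntervalIntegrable (fun s => φ' s z - φ' 0 z) volume 0 t := by
        rw [intervalIntegrable_iff]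
        exact ⟨(hms.sub_const _).aestronglyMeasurable, lt_top_iff_ne_top.2 hfin⟩
      have hd : ∀ s ∈ Set.uIcc 0 t,
          HasDerivAt (fun s => φ s z - s * φ' 0 z) (φ' s z - φ' 0 z) s := by
        intro s _
        have h1 : HasDerivAt (fun s => s * φ' 0 z) (φ' 0 z) s := by
          simpa using (hasDerivAt_id s).mul_const (φ' 0 z)
        exact (hφ z s).fun_sub h1
      have := intervalIntegral.integral_eq_sub_of_hasDerivAt hd hint
      have e : φ t z - φ 0 z - t * φ' 0 z = ∫ s in (0 : ℝ)..t, (φ' s z - φ' 0 z) := by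
        rw [this]; ring
      rw [e]
      rw [← enorm_norm, intervalIntegral.norm_intervalIntegral_eq, enorm_norm]
      exact enorm_integral_le_lintegral_enorm _
    have e : (∫ z, φ t z ∂P) - (∫ z, φ 0 z ∂P) - t * ∫ z, φ' 0 z ∂P
        = ∫ z, (φ t z - φ 0 z - t * φ' 0 z) ∂P := by
      have h1 : Integrable (fun z => φ t z - φ 0 z) P := (hi t).sub (hi 0)
      rw [integral_sub h1 (hi'.const_mul t), integral_sub (hi t) (hi 0), integral_const_mul]
    rw [e]
    have hmm : Measurable fun q : Z × ℝ => ‖φ' q.2 q.1 - φ' 0 q.1‖ₑ :=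
      ((hm.comp measurable_swap).sub (hm0.comp measurable_fst)).enorm
    calc ‖∫ z, (φ t z - φ 0 z - t * φ' 0 z) ∂P‖ₑ
        ≤ ∫⁻ z, ‖φ t z - φ 0 z - t * φ' 0 z‖ₑ ∂P := enorm_integral_le_lintegral_enorm _
      _ ≤ ∫⁻ z, (∫⁻ s in Set.uIoc 0 t, ‖φ' s z - φ' 0 z‖ₑ) ∂P := lintegral_mono hpt
      _ = ∫⁻ s in Set.uIoc 0 t, ∫⁻ z, ‖φ' s z - φ' 0 z‖ₑ ∂P :=
          lintegral_lintegral_swap hmm.aemeasurable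
      _ ≤ ∫⁻ s in Set.uIoc 0 t, C * ‖t‖ₑ := by
          refine setLIntegral_mono measurable_const fun s hs => (hC s).trans ?_
          gcongr
          rw [Real.enorm_eq_ofReal_abs, Real.enorm_eq_ofReal_abs]
          refine ENNReal.ofReal_le_ofReal ?_
          rcases Set.mem_uIoc.1 hs with h | h
          · rw [abs_of_pos h.1, abs_of_pos (h.1.trans_le h.2)]; exact h.2
          · rw [abs_of_nonpos h.2, abs_of_neg (h.1.trans_le h.2)]; linarith
      _ = C * ‖t‖ₑ * ‖t‖ₑ := by
          rw [setLIntegral_const, Set.uIoc, Real.volume_Ioc, max_sub_min_eq_abs, sub_zero,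
            Real.enorm_eq_ofReal_abs]
  rw [hasDerivAt_iff_isLittleO_nhds_zero]
  have hO : (fun t : ℝ => (∫ z, φ (0 + t) z ∂P) - (∫ z, φ 0 z ∂P) - t • ∫ z, φ' 0 z ∂P)
      =O[nhds 0] fun t : ℝ => t ^ 2 := by
    refine Asymptotics.IsBigO.of_bound C (Filter.Eventually.of_forall fun t => ?_)
    have := hbound t
    rw [← ofReal_norm, ← ofReal_norm, mul_assoc, ← ENNReal.ofReal_mul (norm_nonneg _),
      ← ENNReal.ofReal_coe_nnreal, ← ENNReal.ofReal_mul C.coe_nonneg,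
      ENNReal.ofReal_le_ofReal_iff (by positivity)] at this
    rw [zero_add, smul_eq_mul, norm_pow, sq]
    exact this
  exact hO.trans_isLittleO (by simpa using Asymptotics.isLittleO_pow_id (𝕜 := ℝ) one_lt_two)

end Unbiased

/-- The assumptions on a single client, which has at least one sample. -/
structure RegularClient {Z : Type*} [MeasurableSpace Z] {d : ℕ} (f : Vec d → Z → ℝ)
    (D : LocalData Z) (L σ Lσ : ℝ) : Prop where
  one_le_size : 1 ≤ D.size
  differentiable : ∀ z, Differentiable ℝ (fun x => f x z)
  measurable : ∀ x, Measurable (f x)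
  integrable : ∀ x, Integrable (f x) D.sampleLaw
  differentiable_localLoss : Differentiable ℝ (localLoss f D)
  gradient_lipschitz : ∀ v w, ‖gradient (localLoss f D) v - gradient (localLoss f D) w‖
      ≤ L * ‖v - w‖
  bounded_noise : ∀ s : ℕ, 1 ≤ s → (s : ℕ∞) ≤ D.size → ∀ v,
    ∫⁻ B, ‖batchGrad f B v - gradient (localLoss f D) v‖ₑ ^ 2 ∂D.batchLaw s
      ≤ ENNReal.ofReal (σ ^ 2 / s)
  average_smooth : ∀ s : ℕ, 1 ≤ s → (s : ℕ∞) ≤ D.size → ∀ v w,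
    ∫⁻ B, ‖(batchGrad f B v - batchGrad f B w)
        - (gradient (localLoss f D) v - gradient (localLoss f D) w)‖ₑ ^ 2 ∂D.batchLaw s
      ≤ ENNReal.ofReal (Lσ ^ 2 / s * ‖v - w‖ ^ 2)

namespace RegularClient

variable {Z : Type*} [MeasurableSpace Z] {d : ℕ} {f : Vec d → Z → ℝ} {D : LocalData Z}
  {L σ Lσ : ℝ} (h : RegularClient f D L σ Lσ)
include h

lemma measurable_batchGrad_const (s : ℕ) (v : Vec d) :
    Measurable fun B : Fin s → Z => batchGrad f B v := by
  have h2 : Measurable fun B : Fin s → Z => (B, v) := by fun_prop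
  simpa only [Function.comp_def] using
    (measurable_batchGrad h.differentiable h.measurable s).comp h2

lemma measurable_sampleGrad (v : Vec d) : Measurable fun z => gradient (fun x => f x z) v :=
  (measurable_gradient_loss h.differentiable h.measurable).comp measurable_prodMk_left

/-- Transfers the assumptions for batch size `1` to single samples: `c = 0` serves the noise bound,
`c = 1` the average smoothness. -/
lemma lintegral_batchLaw_one {G : Vec d → ℝ≥0∞} (hG : Measurable G) (v w : Vec d) (c : ℝ) :
    ∫⁻ B, G (batchGrad f B v - c • batchGrad f B w) ∂D.batchLaw 1
      = ∫⁻ z, G (gradient (fun x => f x z) v - c • gradient (fun x => f x z) w) ∂D.sampleLaw := by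
  have h1 : ((1 : ℕ) : ℕ∞) ≤ D.size := by simpa using h.one_le_size
  have hm : Measurable fun z =>
      G (gradient (fun x => f x z) v - c • gradient (fun x => f x z) w) := by
    have := h.measurable_sampleGrad
    exact hG.comp ((this v).sub ((this w).const_smul c))
  rw [← (D.measurePreserving_eval_batchLaw h1 0).lintegral_comp hm]
  refine lintegral_congr fun B => ?_
  rw [batchGrad_eq h.differentiable, batchGrad_eq h.differentiable]
  simp

lemma memLp_sampleGrad (v : Vec d) :
    MemLp (fun z => gradient (fun x => f x z) v) 2 D.sampleLaw := by
  have h1 : ((1 : ℕ) : ℕ∞) ≤ D.size := by simpa using h.one_le_size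
  have := D.isProbabilityMeasure_sampleLaw h.one_le_size
  have hn := h.bounded_noise 1 le_rfl h1 v
  have e := h.lintegral_batchLaw_one
    (G := fun y => ‖y - gradient (localLoss f D) v‖ₑ ^ 2) (by fun_prop) v v 0
  simp only [zero_smul, sub_zero] at e
  rw [e] at hn
  have hN := (memLp_two_of_lintegral_lt_top
    ((h.measurable_sampleGrad v).sub_const _).aestronglyMeasurable
    (hn.trans_lt ENNReal.ofReal_lt_top)).add (memLp_const (gradient (localLoss f D) v))
  exact hN.ae_eq (.of_forall fun z => by simp)

/-- The `L¹` norm of the fluctuation is at most its `L²` norm, controlled by average smoothness; the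
mean contributes `L`. This is the Lipschitz input for differentiating under the integral. -/
lemma lintegral_sampleGrad_sub_le (hLσ : 0 ≤ Lσ) (v w : Vec d) :
    ∫⁻ z, ‖gradient (fun x => f x z) v - gradient (fun x => f x z) w‖ₑ ∂D.sampleLaw
      ≤ ENNReal.ofReal ((L + Lσ) * ‖v - w‖) := by
  have h1 : ((1 : ℕ) : ℕ∞) ≤ D.size := by simpa using h.one_le_size
  have hP := D.isProbabilityMeasure_sampleLaw h.one_le_size
  set c := gradient (localLoss f D) v - gradient (localLoss f D) w with hc
  have hn := h.average_smooth 1 le_rfl h1 v w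
  have e := h.lintegral_batchLaw_one (G := fun y => ‖y - c‖ₑ ^ 2) (by fun_prop) v w 1
  simp only [one_smul] at e
  rw [e] at hn
  set X := fun z => gradient (fun x => f x z) v - gradient (fun x => f x z) w - c with hX
  have hXm : Measurable X :=
    ((h.measurable_sampleGrad v).sub (h.measurable_sampleGrad w)).sub_const c
  have h2 : ∫⁻ z, ‖X z‖ₑ ∂D.sampleLaw ≤ ENNReal.ofReal (Lσ * ‖v - w‖) := by
    have := eLpNorm_le_eLpNorm_of_exponent_le (μ := D.sampleLaw) (p := 1) (q := 2) (f := X)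
      (by norm_num) hXm.aestronglyMeasurable
    rw [eLpNorm_one_eq_lintegral_enorm, eLpNorm_eq_lintegral_rpow_enorm_toReal
      (by norm_num) (by norm_num)] at this
    refine this.trans ?_
    simp only [ENNReal.toReal_ofNat, ENNReal.rpow_ofNat]
    calc _ ≤ (ENNReal.ofReal ((Lσ * ‖v - w‖) ^ 2)) ^ (1 / (2 : ℝ)) := by
            gcongr
            refine hn.trans_eq ?_
            congr 1
            push_cast
            ring
      _ = _ := by
            rw [ENNReal.ofReal_pow (by positivity), ← ENNReal.rpow_natCast, ← ENNReal.rpow_mul]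
            norm_num
  calc ∫⁻ z, ‖gradient (fun x => f x z) v - gradient (fun x => f x z) w‖ₑ ∂D.sampleLaw
      ≤ ∫⁻ z, (‖X z‖ₑ + ‖c‖ₑ) ∂D.sampleLaw := by
        refine lintegral_mono fun z => ?_
        refine le_trans (le_of_eq ?_) (enorm_add_le (X z) c)
        simp [hX]
    _ = ∫⁻ z, ‖X z‖ₑ ∂D.sampleLaw + ‖c‖ₑ := by
        rw [lintegral_add_right _ measurable_const]; simp
    _ ≤ ENNReal.ofReal (Lσ * ‖v - w‖) + ENNReal.ofReal (L * ‖v - w‖) := by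
        gcongr
        rw [← ofReal_norm]
        exact ENNReal.ofReal_le_ofReal (h.gradient_lipschitz v w)
    _ = _ := by
        rw [← ENNReal.ofReal_add (by positivity)
          ((norm_nonneg _).trans (h.gradient_lipschitz v w))]
        congr 1; ring

/-- Along each line `v + t • e`, the derivative of the expected loss at `t = 0` is computed once
from its gradient and once under the integral sign; uniqueness of derivatives identifies the two. -/
lemma integral_sampleGrad (hL : 0 ≤ L) (hLσ : 0 ≤ Lσ) (v : Vec d) :
    ∫ z, gradient (fun x => f x z) v ∂D.sampleLaw = gradient (localLoss f D) v := by
  have hP := D.isProbabilityMeasure_sampleLaw h.one_le_size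
  have hint : Integrable (fun z => gradient (fun x => f x z) v) D.sampleLaw :=
    (h.memLp_sampleGrad v).integrable (by norm_num)
  refine ext_inner_left ℝ fun e => ?_
  rw [← integral_inner hint]
  have hline : ∀ t : ℝ, HasDerivAt (fun t : ℝ => v + t • e) e t := fun t => by
    simpa using ((hasDerivAt_id t).smul_const e).const_add v
  have hA : HasDerivAt (fun t : ℝ => localLoss f D (v + t • e))
      (inner ℝ e (gradient (localLoss f D) v)) 0 := by
    have h0 : HasGradientAt (localLoss f D) (gradient (localLoss f D) v) (v + (0 : ℝ) • e) := by
      simpa using (h.differentiable_localLoss v).hasGradientAt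
    have := h0.hasFDerivAt.comp_hasDerivAt (0 : ℝ) (hline 0)
    rwa [InnerProductSpace.toDual_apply_apply, real_inner_comm] at this
  have hB : HasDerivAt (fun t : ℝ => ∫ z, f (v + t • e) z ∂D.sampleLaw)
      (∫ z, inner ℝ e (gradient (fun x => f x z) (v + (0 : ℝ) • e)) ∂D.sampleLaw) 0 := by
    refine hasDerivAt_integral_of_lipschitz_L1 (φ := fun t z => f (v + t • e) z)
      (φ' := fun t z => inner ℝ e (gradient (fun x => f x z) (v + t • e)))
      (fun z t => ?_) ?_ (fun t => h.integrable _) ?_ ((L + Lσ) * ‖e‖ ^ 2).toNNReal fun t => ?_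
    · have := ((h.differentiable z) (v + t • e)).hasGradientAt.hasFDerivAt.comp_hasDerivAt t
        (hline t)
      rwa [InnerProductSpace.toDual_apply_apply, real_inner_comm] at this
    · have h2 : Measurable fun q : ℝ × Z => (v + q.1 • e, q.2) := by fun_prop
      have h3 : Measurable fun q : ℝ × Z => gradient (fun x => f x q.2) (v + q.1 • e) :=
        (measurable_gradient_loss h.differentiable h.measurable).comp h2
      exact h3.const_inner (𝕜 := ℝ)
    · simpa using hint.const_inner (𝕜 := ℝ) e
    · calc ∫⁻ z, ‖inner ℝ e (gradient (fun x => f x z) (v + t • e))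
            - inner ℝ e (gradient (fun x => f x z) (v + (0 : ℝ) • e))‖ₑ ∂D.sampleLaw
          ≤ ∫⁻ z, ‖e‖ₑ * ‖gradient (fun x => f x z) (v + t • e)
              - gradient (fun x => f x z) (v + (0 : ℝ) • e)‖ₑ ∂D.sampleLaw := by
            refine lintegral_mono fun z => ?_
            rw [← inner_sub_right, ← ofReal_norm, ← ofReal_norm, ← ofReal_norm,
              ← ENNReal.ofReal_mul (norm_nonneg _)]
            exact ENNReal.ofReal_le_ofReal (norm_inner_le_norm _ _)
        _ ≤ ‖e‖ₑ * ENNReal.ofReal ((L + Lσ) * ‖(v + t • e) - (v + (0 : ℝ) • e)‖) := by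
            rw [lintegral_const_mul']
            · gcongr
              exact h.lintegral_sampleGrad_sub_le hLσ _ _
            · exact enorm_ne_top
        _ = _ := by
            rw [← ENNReal.ofReal, ← ofReal_norm, ← ofReal_norm,
              ← ENNReal.ofReal_mul (norm_nonneg _), ← ENNReal.ofReal_mul (by positivity)]
            congr 1
            simp [norm_smul]
            ring
  simp only [zero_smul, add_zero] at hB
  exact hB.unique hA

/-- The stochastic gradient of a batch is unbiased. -/
lemma integral_batchGrad (hL : 0 ≤ L) (hLσ : 0 ≤ Lσ) {s : ℕ} (hs : 1 ≤ s)
    (hsD : (s : ℕ∞) ≤ D.size) (v : Vec d) :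
    ∫ B, batchGrad f B v ∂D.batchLaw s = gradient (localLoss f D) v := by
  have hP := D.isProbabilityMeasure_sampleLaw h.one_le_size
  have hint : Integrable (fun z => gradient (fun x => f x z) v) D.sampleLaw :=
    (h.memLp_sampleGrad v).integrable (by norm_num)
  simp_rw [batchGrad_eq h.differentiable]
  have hintj : ∀ j : Fin s, Integrable (fun B : Fin s → Z => gradient (fun x => f x (B j)) v)
      (D.batchLaw s) := fun j =>
    (D.measurePreserving_eval_batchLaw hsD j).integrable_comp_of_integrable hint
  rw [integral_smul, integral_finsetSum _ fun j _ => hintj j]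
  have : ∀ j : Fin s, ∫ B : Fin s → Z, gradient (fun x => f x (B j)) v ∂D.batchLaw s
      = gradient (localLoss f D) v := by
    intro j
    rw [← h.integral_sampleGrad hL hLσ v, ← D.map_eval_batchLaw hsD j,
      integral_map (measurable_pi_apply j).aemeasurable
        (h.measurable_sampleGrad v).aestronglyMeasurable]
  simp_rw [this]
  have hs0 : (s : ℝ) ≠ 0 := by positivity
  simp [← Nat.cast_smul_eq_nsmul ℝ, smul_smul, hs0]

lemma memLp_batchGrad {s : ℕ} (hs : 1 ≤ s) (hsD : (s : ℕ∞) ≤ D.size) (v : Vec d) :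
    MemLp (fun B => batchGrad f B v) 2 (D.batchLaw s) := by
  have := D.isProbabilityMeasure_batchLaw hsD
  have hN := (memLp_two_of_lintegral_lt_top
    ((h.measurable_batchGrad_const s v).sub_const _).aestronglyMeasurable
    ((h.bounded_noise s hs hsD v).trans_lt ENNReal.ofReal_lt_top)).add
      (memLp_const (gradient (localLoss f D) v))
  exact hN.ae_eq (.of_forall fun z => by simp)

lemma integrable_batchGrad {s : ℕ} (hs : 1 ≤ s) (hsD : (s : ℕ∞) ≤ D.size) (v : Vec d) :
    Integrable (fun B => batchGrad f B v) (D.batchLaw s) := by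
  have := D.isProbabilityMeasure_batchLaw hsD
  exact (h.memLp_batchGrad hs hsD v).integrable (by norm_num)

/-- The whole dataset has no sampling noise. -/
lemma lintegral_batchGrad_full {s : ℕ} (hs : (s : ℕ∞) = D.size) (v : Vec d) :
    ∫⁻ B, ‖batchGrad f B v - gradient (localLoss f D) v‖ₑ ^ 2 ∂D.batchLaw s = 0 := by
  have hm := h.measurable_batchGrad_const s v
  have hm' : Measurable fun B : Fin s → Z =>
      ‖batchGrad f B v - gradient (localLoss f D) v‖ₑ ^ 2 := by fun_prop
  have hone := h.one_le_size
  cases D with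
  | stream D => simp [LocalData.size] at hs
  | dataset n z =>
    obtain rfl : s = n := by simpa [LocalData.size] using hs
    have : NeZero s := ⟨by rintro rfl; simp [LocalData.size] at hone⟩
    rw [lintegral_eq_zero_iff hm']
    simp only [LocalData.batchLaw]
    refine (ae_map_iff Measurable.of_discrete.aemeasurable
      (measurableSet_eq_fun hm' measurable_const)).2 ?_
    have hae : ∀ᵐ g ∂uniformOn {g : Fin s → Fin s | Function.Injective g},
        Function.Injective g := by
      rw [uniformOn]
      exact ae_cond_mem (Set.toFinite _).measurableSet
    filter_upwards [hae] with g hg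
    -- An injection of `Fin s` into itself is a permutation, so the batch loss is the average over
    -- the whole dataset.
    have e : batchLoss f (fun j => z (g j)) = localLoss f (LocalData.dataset s z) := by
      funext x
      have hbij : Function.Bijective g := Finite.injective_iff_bijective.1 hg
      simp only [batchLoss, localLoss, LocalData.sampleLaw]
      rw [integral_map Measurable.of_discrete.aemeasurable
        (h.measurable x).aestronglyMeasurable, hbij.sum_comp (fun j => f x (z j)),
        integral_fintype .of_finite, Finset.mul_sum]
      refine Finset.sum_congr rfl fun j _ => ?_
      rw [measureReal_def, uniformOn_univ, Measure.count_singleton]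
      simp
    simp [batchGrad, e]

end RegularClient

/-! ### Convexity of the squared norm under averaging. -/

section Average

variable {ι E : Type*} [NormedAddCommGroup E] [NormedSpace ℝ E]

lemma norm_average_sq_le (s : Finset ι) (a : ι → E) :
    ‖(s.card : ℝ)⁻¹ • ∑ i ∈ s, a i‖ ^ 2 ≤ (s.card : ℝ)⁻¹ * ∑ i ∈ s, ‖a i‖ ^ 2 := by
  rcases s.eq_empty_or_nonempty with rfl | hs
  · simp
  have hc : (0 : ℝ) < s.card := by exact_mod_cast hs.card_pos
  have h1 : ‖∑ i ∈ s, a i‖ ^ 2 ≤ s.card * ∑ i ∈ s, ‖a i‖ ^ 2 :=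
    (pow_le_pow_left₀ (norm_nonneg _) (norm_sum_le s a) 2).trans sq_sum_le_card_mul_sum_sq
  rw [norm_smul, mul_pow, Real.norm_of_nonneg (by positivity)]
  calc ((s.card : ℝ)⁻¹) ^ 2 * ‖∑ i ∈ s, a i‖ ^ 2
      ≤ ((s.card : ℝ)⁻¹) ^ 2 * (s.card * ∑ i ∈ s, ‖a i‖ ^ 2) := by gcongr
    _ = _ := by field_simp

lemma lintegral_average_sq_le {Ω : Type*} [MeasurableSpace Ω] [MeasurableSpace E]
    [OpensMeasurableSpace E] {P : Measure Ω} (s : Finset ι)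
    {a : ι → Ω → E} (ha : ∀ i ∈ s, Measurable (a i)) {c : ι → ℝ} (hc : ∀ i ∈ s, 0 ≤ c i)
    (h : ∀ i ∈ s, ∫⁻ ω, ‖a i ω‖ₑ ^ 2 ∂P ≤ ENNReal.ofReal (c i)) :
    ∫⁻ ω, ‖(s.card : ℝ)⁻¹ • ∑ i ∈ s, a i ω‖ₑ ^ 2 ∂P
      ≤ ENNReal.ofReal ((s.card : ℝ)⁻¹ * ∑ i ∈ s, c i) := by
  calc ∫⁻ ω, ‖(s.card : ℝ)⁻¹ • ∑ i ∈ s, a i ω‖ₑ ^ 2 ∂P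
      ≤ ∫⁻ ω, ENNReal.ofReal (s.card : ℝ)⁻¹ * ∑ i ∈ s, ‖a i ω‖ₑ ^ 2 ∂P := by
        refine lintegral_mono fun ω => ?_
        simp_rw [enorm_sq_eq_ofReal]
        rw [← ENNReal.ofReal_sum_of_nonneg (fun _ _ => by positivity),
          ← ENNReal.ofReal_mul (by positivity)]
        exact ENNReal.ofReal_le_ofReal (norm_average_sq_le s _)
    _ = ENNReal.ofReal (s.card : ℝ)⁻¹ * ∑ i ∈ s, ∫⁻ ω, ‖a i ω‖ₑ ^ 2 ∂P := by
        rw [lintegral_const_mul' _ _ ENNReal.ofReal_ne_top, lintegral_finsetSum']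
        exact fun i hi => ((ha i hi).enorm.pow_const 2).aemeasurable
    _ ≤ ENNReal.ofReal (s.card : ℝ)⁻¹ * ∑ i ∈ s, ENNReal.ofReal (c i) := by
        gcongr with i hi
        exact h i hi
    _ = _ := by
        rw [← ENNReal.ofReal_sum_of_nonneg hc, ← ENNReal.ofReal_mul (by positivity)]

end Average

/-! ### Structure and measurability of a local run. -/

section MinerMeasurability

variable {Z : Type*} {d K b' : ℕ}

lemma minerIterate_succ (f : Vec d → Z → ℝ) (ηl : ℝ) (B : Fin K → Fin b' → Z) (x g : Vec d)
    {k : ℕ} (hk : k < K) :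
    minerIterate f ηl B x g (k + 1) =
      let s := minerIterate f ηl B x g k
      let g' := s.2.2 - batchGrad f (B ⟨k, hk⟩) s.1 + batchGrad f (B ⟨k, hk⟩) s.2.1
      (s.2.1, s.2.1 - ηl • g', g') := by
  simp [minerIterate, hk]

lemma norm_minerIterate_sub_le (f : Vec d → Z → ℝ) {ηl : ℝ} (hηl : 0 ≤ ηl)
    (B : Fin K → Fin b' → Z) (x g : Vec d) (k : ℕ) :
    ‖(minerIterate f ηl B x g k).2.1 - (minerIterate f ηl B x g k).1‖
      ≤ ηl * ‖(minerIterate f ηl B x g k).2.2‖ := by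
  induction k with
  | zero => simp only [minerIterate, sub_self, norm_zero]; positivity
  | succ k ih =>
    by_cases hk : k < K
    · rw [minerIterate_succ f ηl B x g hk]
      simp only [sub_sub_cancel_left]
      rw [norm_neg, norm_smul, Real.norm_of_nonneg hηl]
    · simpa [minerIterate, hk] using ih

/-- Iterate `k` uses only the batches with index below `k`; this is the independence behind the
resampling of batch `k`. -/
lemma minerIterate_update (f : Vec d → Z → ℝ) (ηl : ℝ) (B : Fin K → Fin b' → Z) (x g : Vec d)
    (j : Fin K) (r : Fin b' → Z) (k : ℕ) (hk : k ≤ j) :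
    minerIterate f ηl (Function.update B j r) x g k = minerIterate f ηl B x g k := by
  induction k with
  | zero => rfl
  | succ k ih =>
    have hkK : k < K := by omega
    have hne : (⟨k, hkK⟩ : Fin K) ≠ j := by
      intro h; rw [← h] at hk; simp at hk
    rw [minerIterate_succ _ _ _ _ _ hkK, minerIterate_succ _ _ _ _ _ hkK, ih (by omega),
      Function.update_of_ne hne]

/-- The average of the descent directions of a local run. -/
noncomputable def minerDirection (f : Vec d → Z → ℝ) (ηl : ℝ) (B : Fin K → Fin b' → Z)
    (x g : Vec d) : Vec d :=
  ((Finset.range K).card : ℝ)⁻¹ • ∑ k ∈ Finset.range K, (minerIterate f ηl B x g (k + 1)).2.2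

lemma minerChange_eq (f : Vec d → Z → ℝ) (ηl : ℝ) (B : Fin K → Fin b' → Z) (x g : Vec d) :
    minerChange f ηl B x g = (ηl * K) • minerDirection f ηl B x g := by
  have key : ∀ k ≤ K, x - (minerIterate f ηl B x g k).2.1
      = ηl • ∑ j ∈ Finset.range k, (minerIterate f ηl B x g (j + 1)).2.2 := by
    intro k
    induction k with
    | zero => simp [minerIterate]
    | succ k ih =>
      intro hk
      rw [Finset.sum_range_succ, smul_add, ← ih (by omega), minerIterate_succ f ηl B x g hk]
      simp only
      abel
  rcases Nat.eq_zero_or_pos K with rfl | hK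
  · simp [minerChange, minerIterate]
  have hK0 : (K : ℝ) ≠ 0 := by positivity
  rw [minerChange, key K le_rfl, minerDirection, Finset.card_range, smul_smul,
    mul_assoc, mul_inv_cancel₀ hK0, mul_one]

variable [MeasurableSpace Z]

lemma measurable_minerIterate {f : Vec d → Z → ℝ} (hd : ∀ z, Differentiable ℝ fun x => f x z)
    (hm : ∀ x, Measurable (f x)) (ηl : ℝ) (k : ℕ) :
    Measurable fun q : (Fin K → Fin b' → Z) × Vec d × Vec d =>
      minerIterate f ηl q.1 q.2.1 q.2.2 k := by
  induction k with
  | zero => simp only [minerIterate]; fun_prop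
  | succ k ih =>
    by_cases hk : k < K
    · simp only [minerIterate_succ _ _ _ _ _ hk]
      have hG := measurable_batchGrad hd hm b'
      have hB : Measurable fun q : (Fin K → Fin b' → Z) × Vec d × Vec d => q.1 ⟨k, hk⟩ :=
        (measurable_pi_apply _).comp measurable_fst
      have h1 := hG.comp (hB.prodMk ih.fst)
      have h2 := hG.comp (hB.prodMk ih.snd.fst)
      simp only [Function.comp_def] at h1 h2
      fun_prop
    · simpa [minerIterate, hk] using ih

lemma measurable_minerDirection {f : Vec d → Z → ℝ} (hd : ∀ z, Differentiable ℝ fun x => f x z)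
    (hm : ∀ x, Measurable (f x)) (ηl : ℝ) :
    Measurable fun q : (Fin K → Fin b' → Z) × Vec d × Vec d =>
      minerDirection f ηl q.1 q.2.1 q.2.2 := by
  unfold minerDirection
  have h1 : ∀ k, Measurable fun q : (Fin K → Fin b' → Z) × Vec d × Vec d =>
      (minerIterate f ηl q.1 q.2.1 q.2.2 (k + 1)).2.2 :=
    fun k => (measurable_minerIterate hd hm ηl (k + 1)).snd.snd
  fun_prop

end MinerMeasurability

/-! ### Second moments along a local run. -/

namespace RegularClient

variable {Z : Type*} [MeasurableSpace Z] {d : ℕ} {f : Vec d → Z → ℝ} {D : LocalData Z}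
  {L σ Lσ : ℝ} (h : RegularClient f D L σ Lσ)
include h

lemma integral_batchGrad_sub (hL : 0 ≤ L) (hLσ : 0 ≤ Lσ) {s : ℕ} (hs : 1 ≤ s)
    (hsD : (s : ℕ∞) ≤ D.size) (v : Vec d) :
    ∫ B, (batchGrad f B v - gradient (localLoss f D) v) ∂D.batchLaw s = 0 := by
  have := D.isProbabilityMeasure_batchLaw hsD
  rw [integral_sub (h.integrable_batchGrad hs hsD v) (integrable_const _),
    h.integral_batchGrad hL hLσ hs hsD]
  simp

/-- The second moment after one step of variance reduction. -/
lemma lintegral_variance_reduction_le (hL : 0 ≤ L) (hLσ : 0 ≤ Lσ) {s : ℕ} (hs : 1 ≤ s)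
    (hsD : (s : ℕ∞) ≤ D.size) (u y z : Vec d) :
    ∫⁻ B, ‖u - batchGrad f B y + batchGrad f B z‖ₑ ^ 2 ∂D.batchLaw s
      ≤ ENNReal.ofReal (‖u + (gradient (localLoss f D) z - gradient (localLoss f D) y)‖ ^ 2
          + Lσ ^ 2 / s * ‖z - y‖ ^ 2) := by
  have hP := D.isProbabilityMeasure_batchLaw hsD
  set δ := gradient (localLoss f D) z - gradient (localLoss f D) y with hδ
  -- The gradient difference is its mean `δ` plus a centred fluctuation, whose second moment is
  -- exactly what average smoothness bounds.
  have hN : Measurable fun B : Fin s → Z => batchGrad f B z - batchGrad f B y - δ :=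
    ((h.measurable_batchGrad_const s z).sub (h.measurable_batchGrad_const s y)).sub_const δ
  have hz := h.integrable_batchGrad hs hsD z
  have hy := h.integrable_batchGrad hs hsD y
  have hzy : Integrable (fun B => batchGrad f B z - batchGrad f B y) (D.batchLaw s) := hz.sub hy
  have h0 : ∫ B, (batchGrad f B z - batchGrad f B y - δ) ∂D.batchLaw s = 0 := by
    rw [integral_sub hzy (integrable_const δ), integral_sub hz hy,
      h.integral_batchGrad hL hLσ hs hsD, h.integral_batchGrad hL hLσ hs hsD]
    simp [hδ]
  have := lintegral_enorm_add_sq_le hN.aestronglyMeasurable ENNReal.ofReal_ne_top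
    (h.average_smooth s hs hsD z y) h0 (u + δ)
  rw [ENNReal.ofReal_add (by positivity) (by positivity), ← enorm_sq_eq_ofReal]
  refine le_trans (le_of_eq (lintegral_congr fun B => ?_)) this
  congr 2
  abel

variable {K b' : ℕ} {ηl a : ℝ}

-- Young's inequality with weight `0.35` on the cross term `2 (a / K) v w`. Here `v` is the current
-- distance to the reference direction and `w` the length of the current direction; the sampling
-- term `1 / (48 K)` is carried along, and `1/24 + 1/48 = 1/16`.
omit h in
lemma young_drift {a K u v w : ℝ} (ha : 0 ≤ a) (haa : a ^ 2 = 1 / 24) (hK : 1 ≤ K)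
    (huv : u ≤ v + a / K * w) (hu : 0 ≤ u) :
    u ^ 2 + 1 / (48 * K) * w ^ 2
      ≤ (1 + a / 0.35 / K) * v ^ 2 + (0.35 * a + 1 / 16) / K * w ^ 2 := by
  have hK0 : 0 < K := by linarith
  have h1 : u ^ 2 ≤ (v + a / K * w) ^ 2 := pow_le_pow_left₀ hu huv 2
  have h2 : 0 ≤ a / K * (1 / 0.35) * (v - 0.35 * w) ^ 2 := by positivity
  have h3 : (a / K) ^ 2 ≤ 1 / 24 / K := by
    rw [div_pow, haa, div_le_div_iff₀ (by positivity) hK0]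
    nlinarith
  have h4 : (a / K) ^ 2 * w ^ 2 ≤ 1 / 24 / K * w ^ 2 := by gcongr
  have e1 : a / 0.35 / K = a / K * (1 / 0.35) := by ring
  have e2 : (0.35 * a + 1 / 16) / K * w ^ 2
      = 0.35 * (a / K) * w ^ 2 + 1 / 24 / K * w ^ 2 + 1 / (48 * K) * w ^ 2 := by
    field_simp; ring
  rw [e1, e2]
  nlinarith

/-- One step of a local run, for the distance of the direction to a fixed vector `w`. -/
lemma lintegral_miner_step (hL : 0 < L) (hLσ : 0 ≤ Lσ) (hb : 1 ≤ b')
    (hbD : (b' : ℕ∞) ≤ D.size) (hK : 1 ≤ K) (haa : a ^ 2 = 1 / 24)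
    (hη : ηl * (K * L) = a) (hηl : 0 ≤ ηl) (hLK : Lσ ^ 2 / b' ≤ K * L ^ 2 / 2)
    (x g : Vec d) {k : ℕ} (hk : k < K) (w : Vec d) {Ψ : Vec d → ℝ≥0∞}
    (hstep : ∀ (u : Vec d) (t : ℝ), 0 ≤ t → t ≤ ‖u - w‖ + a / K * ‖u‖ →
      ENNReal.ofReal (t ^ 2 + 1 / (48 * K) * ‖u‖ ^ 2) ≤ Ψ u) :
    ∫⁻ B, ‖(minerIterate f ηl B x g (k + 1)).2.2 - w‖ₑ ^ 2
        ∂(Measure.pi fun _ : Fin K => D.batchLaw b')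
      ≤ ∫⁻ B, Ψ (minerIterate f ηl B x g k).2.2
        ∂(Measure.pi fun _ : Fin K => D.batchLaw b') := by
  have hP := D.isProbabilityMeasure_batchLaw hbD
  have hit : Measurable fun B : Fin K → Fin b' → Z => minerIterate f ηl B x g k := by
    have h2 : Measurable fun B : Fin K → Fin b' → Z => (B, x, g) := by fun_prop
    simpa only [Function.comp_def] using
      (measurable_minerIterate h.differentiable h.measurable ηl k).comp h2
  have hφ : Measurable fun q : (Vec d × Vec d × Vec d) × (Fin b' → Z) =>
      ‖q.1.2.2 - batchGrad f q.2 q.1.1 + batchGrad f q.2 q.1.2.1 - w‖ₑ ^ 2 := by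
    have hG := measurable_batchGrad h.differentiable h.measurable b'
    have h1 : Measurable fun q : (Vec d × Vec d × Vec d) × (Fin b' → Z) =>
        batchGrad f q.2 q.1.1 := by
      simpa only [Function.comp_def] using hG.comp (measurable_snd.prodMk measurable_fst.fst)
    have h2 : Measurable fun q : (Vec d × Vec d × Vec d) × (Fin b' → Z) =>
        batchGrad f q.2 q.1.2.1 := by
      simpa only [Function.comp_def] using hG.comp (measurable_snd.prodMk measurable_fst.snd.fst)
    fun_prop
  have hK0 : (0 : ℝ) < K := by exact_mod_cast hK
  -- Batch `k` is averaged first, with the state at `k` frozen. The bound `Ψ` is left abstract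
  -- because the step is used both with `w = 0` and with `w = g`.
  have hres := lintegral_pi_resample (fun _ : Fin K => D.batchLaw b') ⟨k, hk⟩ hit
    (fun B r => minerIterate_update f ηl B x g ⟨k, hk⟩ r k le_rfl) hφ
  calc _ = ∫⁻ B : Fin K → Fin b' → Z, ‖(minerIterate f ηl B x g k).2.2
          - batchGrad f (B ⟨k, hk⟩) (minerIterate f ηl B x g k).1
          + batchGrad f (B ⟨k, hk⟩) (minerIterate f ηl B x g k).2.1 - w‖ₑ ^ 2
          ∂(Measure.pi fun _ : Fin K => D.batchLaw b') := by
        refine lintegral_congr fun B => ?_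
        rw [minerIterate_succ f ηl B x g hk]
    _ = _ := hres
    _ ≤ _ := by
        refine lintegral_mono fun B => ?_
        simp only
        have hinc := norm_minerIterate_sub_le f hηl B x g k
        generalize minerIterate f ηl B x g k = s at hinc ⊢
        obtain ⟨y, z, u⟩ := s
        simp only at hinc ⊢
        have hdrift := h.gradient_lipschitz z y
        have e : ∀ r : Fin b' → Z, u - batchGrad f r y + batchGrad f r z - w
            = (u - w) - batchGrad f r y + batchGrad f r z := fun r => by abel
        simp_rw [e]
        refine (h.lintegral_variance_reduction_le hL.le hLσ hb hbD (u - w) y z).trans ?_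
        refine le_trans (ENNReal.ofReal_le_ofReal ?_) (hstep u
          ‖u - w + (gradient (localLoss f D) z - gradient (localLoss f D) y)‖
          (norm_nonneg _) ?_)
        · refine add_le_add le_rfl ?_
          have hLη : L * ηl = a / K := by rw [← hη]; field_simp
          -- The lower bound on `K` replaces the sampling constant by `K L² / 2`; since `L ηl = a /
          -- K` and `a² = 1/24`, the cost per step is only `1 / (48 K)`.
          calc Lσ ^ 2 / b' * ‖z - y‖ ^ 2 ≤ (K * L ^ 2 / 2) * (ηl * ‖u‖) ^ 2 := by gcongr
            _ = K / 2 * (L * ηl) ^ 2 * ‖u‖ ^ 2 := by ring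
            _ = _ := by rw [hLη, div_pow, haa]; field_simp; ring
        · refine (norm_add_le _ _).trans ?_
          gcongr
          calc _ ≤ L * ‖z - y‖ := hdrift
            _ ≤ L * (ηl * ‖u‖) := by gcongr
            _ = _ := by rw [← hη]; field_simp

/-- Each step multiplies the second moment by at most `1 + κ / K`: gradient drift costs `2a / K + a²
/ K²`, sampling `1 / (48 K)`. The induction replaces the product by `1 + t + t²` with `t = κ k / K ≤
0.4709`, which is below `1.7`. -/
lemma lintegral_minerIterate_sq_le (hL : 0 < L) (hLσ : 0 ≤ Lσ) (hb : 1 ≤ b')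
    (hbD : (b' : ℕ∞) ≤ D.size) (hK : 1 ≤ K) (ha : 0 ≤ a) (haa : a ^ 2 = 1 / 24)
    (hη : ηl * (K * L) = a) (hηl : 0 ≤ ηl) (hLK : Lσ ^ 2 / b' ≤ K * L ^ 2 / 2)
    (x g : Vec d) {k : ℕ} (hk : k ≤ K) :
    ∫⁻ B, ‖(minerIterate f ηl B x g k).2.2‖ₑ ^ 2 ∂(Measure.pi fun _ : Fin K => D.batchLaw b')
      ≤ ENNReal.ofReal (1.7 * ‖g‖ ^ 2) := by
  have hP := D.isProbabilityMeasure_batchLaw hbD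
  have hK1 : (1 : ℝ) ≤ K := by exact_mod_cast hK
  have hK0 : (0 : ℝ) < K := by linarith
  have ha2 : a ≤ 0.2042 := by nlinarith
  set κ := 2 * a + 1 / 16 with hκ
  have hκ0 : 0 ≤ κ := by positivity
  have hκ1 : κ ≤ 0.4709 := by rw [hκ]; linarith
  have key : ∀ k ≤ K, ∫⁻ B, ‖(minerIterate f ηl B x g k).2.2‖ₑ ^ 2
      ∂(Measure.pi fun _ : Fin K => D.batchLaw b')
      ≤ ENNReal.ofReal ((1 + κ * (k / K) + (κ * (k / K)) ^ 2) * ‖g‖ ^ 2) := by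
    intro k
    induction k with
    | zero =>
      intro _
      simp only [minerIterate]
      rw [lintegral_const, measure_univ, mul_one, enorm_sq_eq_ofReal]
      exact ENNReal.ofReal_le_ofReal (by simp)
    | succ k ih =>
      intro hk
      have := h.lintegral_miner_step hL hLσ hb hbD hK haa hη hηl hLK x g
        (show k < K by omega) 0
        (Ψ := fun u => ENNReal.ofReal (1 + κ / K) * ‖u‖ₑ ^ 2) ?_
      · simp only [sub_zero] at this
        refine this.trans ?_
        rw [lintegral_const_mul' _ _ ENNReal.ofReal_ne_top]
        refine (mul_le_mul_right (ih (by omega)) _).trans ?_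
        rw [← ENNReal.ofReal_mul (by positivity), ← mul_assoc]
        refine ENNReal.ofReal_le_ofReal (mul_le_mul_of_nonneg_right ?_ (by positivity))
        have hkK : (k : ℝ) / K ≤ 1 := by
          rw [div_le_one hK0]; exact_mod_cast (by omega : k ≤ K)
        set t := κ * (k / K) with ht
        have ht0 : 0 ≤ t := by positivity
        have ht1 : t ≤ 1 := by rw [ht]; nlinarith
        have e : κ * (((k + 1 : ℕ) : ℝ) / K) = t + κ / K := by
          rw [ht]; push_cast; field_simp
        rw [e]
        have : 0 ≤ κ / K := by positivity
        nlinarith [mul_nonneg this ht0, mul_nonneg (mul_nonneg this ht0) (sub_nonneg.2 ht1)]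
      · intro u t ht0 ht
        rw [enorm_sq_eq_ofReal, ← ENNReal.ofReal_mul (by positivity)]
        refine ENNReal.ofReal_le_ofReal ?_
        rw [sub_zero] at ht
        have h1 : t ^ 2 ≤ (‖u‖ + a / K * ‖u‖) ^ 2 := pow_le_pow_left₀ ht0 ht 2
        have h3 : (a / K) ^ 2 ≤ 1 / 24 / K := by
          rw [div_pow, haa, div_le_div_iff₀ (by positivity) hK0]
          nlinarith
        have h4 : (a / K) ^ 2 * ‖u‖ ^ 2 ≤ 1 / 24 / K * ‖u‖ ^ 2 := by gcongr
        have e : (1 + κ / K) * ‖u‖ ^ 2 = ‖u‖ ^ 2 + 2 * (a / K) * ‖u‖ ^ 2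
            + 1 / 24 / K * ‖u‖ ^ 2 + 1 / (48 * K) * ‖u‖ ^ 2 := by
          rw [hκ]; field_simp; ring
        rw [e]
        nlinarith
  refine (key k hk).trans (ENNReal.ofReal_le_ofReal ?_)
  refine mul_le_mul_of_nonneg_right ?_ (by positivity)
  have hkK : (k : ℝ) / K ≤ 1 := by rw [div_le_one hK0]; exact_mod_cast hk
  have h1 : κ * (k / K) ≤ 0.4709 := by
    have : (0 : ℝ) ≤ k / K := by positivity
    nlinarith
  have h2 : 0 ≤ κ * (k / K) := by positivity
  nlinarith

/-- The first direction equals `g`, because `x_{-1} = x_0`, so the deviation starts at zero. Each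
step then amplifies it by `1 + α / K` and adds `γ / K * ‖g‖²`, hence growth essentially linear in
`k`. -/
lemma lintegral_minerIterate_sub_sq_le (hL : 0 < L) (hLσ : 0 ≤ Lσ) (hb : 1 ≤ b')
    (hbD : (b' : ℕ∞) ≤ D.size) (hK : 1 ≤ K) (ha : 0 ≤ a) (haa : a ^ 2 = 1 / 24)
    (hη : ηl * (K * L) = a) (hηl : 0 ≤ ηl) (hLK : Lσ ^ 2 / b' ≤ K * L ^ 2 / 2)
    (x g : Vec d) {k : ℕ} (hk : k < K) :
    ∫⁻ B, ‖(minerIterate f ηl B x g (k + 1)).2.2 - g‖ₑ ^ 2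
        ∂(Measure.pi fun _ : Fin K => D.batchLaw b')
      ≤ ENNReal.ofReal (0.38 * (k / K) * ‖g‖ ^ 2) := by
  have hP := D.isProbabilityMeasure_batchLaw hbD
  have hK1 : (1 : ℝ) ≤ K := by exact_mod_cast hK
  have hK0 : (0 : ℝ) < K := by linarith
  have ha2 : a ≤ 0.2042 := by nlinarith
  set α := a / 0.35 with hα
  have hα0 : 0 ≤ α := by positivity
  have hα1 : α ≤ 0.5835 := by rw [hα, div_le_iff₀ (by norm_num)]; linarith
  set γ := 1.7 * (0.35 * a + 1 / 16) with hγ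
  have hγ0 : 0 ≤ γ := by positivity
  have hγ1 : γ ≤ 0.2278 := by rw [hγ]; linarith
  have key : ∀ k < K, ∫⁻ B, ‖(minerIterate f ηl B x g (k + 1)).2.2 - g‖ₑ ^ 2
      ∂(Measure.pi fun _ : Fin K => D.batchLaw b')
      ≤ ENNReal.ofReal (γ * (k / K + α * (k / K) ^ 2) * ‖g‖ ^ 2) := by
    intro k
    induction k with
    | zero =>
      intro hk
      simp only [minerIterate_succ _ _ _ _ _ hk]
      simp [minerIterate]
    | succ k ih =>
      intro hk
      have := h.lintegral_miner_step hL hLσ hb hbD hK haa hη hηl hLK x g hk g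
        (Ψ := fun u => ENNReal.ofReal (1 + α / K) * ‖u - g‖ₑ ^ 2
          + ENNReal.ofReal ((0.35 * a + 1 / 16) / K) * ‖u‖ₑ ^ 2) ?_
      · refine this.trans ?_
        have hm : Measurable fun B : Fin K → Fin b' → Z =>
            (minerIterate f ηl B x g (k + 1)).2.2 := by
          have h2 : Measurable fun B : Fin K → Fin b' → Z => (B, x, g) := by fun_prop
          simpa only [Function.comp_def] using
            ((measurable_minerIterate h.differentiable h.measurable ηl (k + 1)).comp h2).snd.snd
        rw [lintegral_add_right _ (by fun_prop), lintegral_const_mul' _ _ ENNReal.ofReal_ne_top,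
          lintegral_const_mul' _ _ ENNReal.ofReal_ne_top]
        refine (add_le_add (mul_le_mul_right (ih (by omega)) _) (mul_le_mul_right
          (h.lintegral_minerIterate_sq_le hL hLσ hb hbD hK ha haa hη hηl hLK x g hk.le) _)).trans ?_
        rw [← ENNReal.ofReal_mul (by positivity), ← ENNReal.ofReal_mul (by positivity),
          ← ENNReal.ofReal_add (by positivity) (by positivity)]
        refine ENNReal.ofReal_le_ofReal ?_
        have hkK : (k : ℝ) / K ≤ 1 := by
          rw [div_le_one hK0]; exact_mod_cast (by omega : k ≤ K)
        set t := (k : ℝ) / K with ht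
        have ht0 : 0 ≤ t := by positivity
        have e : (((k + 1 : ℕ) : ℝ) / K) = t + 1 / K := by
          rw [ht]; push_cast; field_simp
        have e2 : (0.35 * a + 1 / 16) / K * (1.7 * ‖g‖ ^ 2) = γ * (1 / K) * ‖g‖ ^ 2 := by
          rw [hγ]; ring
        rw [e, e2, ← mul_assoc, ← add_mul]
        refine mul_le_mul_of_nonneg_right ?_ (by positivity)
        have hi : 0 ≤ 1 / (K : ℝ) := by positivity
        have e3 : α / K = α * (1 / K) := by ring
        rw [e3]
        set i := 1 / (K : ℝ)
        have : (1 + α * i) * (t + α * t ^ 2) + i ≤ t + i + α * (t + i) ^ 2 := by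
          have hαt : α * t ≤ 1 := by nlinarith
          nlinarith [mul_nonneg (mul_nonneg (mul_nonneg hα0 hi) ht0) (sub_nonneg.2 hαt),
            mul_nonneg hα0 (sq_nonneg i)]
        nlinarith
      · intro u t ht0 ht
        rw [enorm_sq_eq_ofReal, enorm_sq_eq_ofReal, ← ENNReal.ofReal_mul (by positivity),
          ← ENNReal.ofReal_mul (by positivity),
          ← ENNReal.ofReal_add (by positivity) (by positivity)]
        exact ENNReal.ofReal_le_ofReal
          (young_drift ha haa hK1 ht ht0)
  refine (key k hk).trans (ENNReal.ofReal_le_ofReal ?_)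
  refine mul_le_mul_of_nonneg_right ?_ (by positivity)
  have hkK : (k : ℝ) / K ≤ 1 := by rw [div_le_one hK0]; exact_mod_cast hk.le
  set t := (k : ℝ) / K with ht
  have ht0 : 0 ≤ t := by positivity
  have h1 : t + α * t ^ 2 ≤ 1.5835 * t := by nlinarith
  nlinarith

/-- The second moment of the average direction of a local run, and its distance to the initial
direction. -/
lemma lintegral_minerDirection_le (hL : 0 < L) (hLσ : 0 ≤ Lσ) (hb : 1 ≤ b')
    (hbD : (b' : ℕ∞) ≤ D.size) (hK : 1 ≤ K) (ha : 0 ≤ a) (haa : a ^ 2 = 1 / 24)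
    (hη : ηl * (K * L) = a) (hηl : 0 ≤ ηl) (hLK : Lσ ^ 2 / b' ≤ K * L ^ 2 / 2) (x g : Vec d) :
    ∫⁻ B, ‖minerDirection f ηl B x g‖ₑ ^ 2 ∂(Measure.pi fun _ : Fin K => D.batchLaw b')
        ≤ ENNReal.ofReal (1.7 * ‖g‖ ^ 2) ∧
      ∫⁻ B, ‖minerDirection f ηl B x g - g‖ₑ ^ 2 ∂(Measure.pi fun _ : Fin K => D.batchLaw b')
        ≤ ENNReal.ofReal (0.19 * ‖g‖ ^ 2) := by
  have hK1 : (1 : ℝ) ≤ K := by exact_mod_cast hK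
  have hK0 : (0 : ℝ) < K := by linarith
  have hm : ∀ k, Measurable fun B : Fin K → Fin b' → Z =>
      (minerIterate f ηl B x g (k + 1)).2.2 := by
    intro k
    have h2 : Measurable fun B : Fin K → Fin b' → Z => (B, x, g) := by fun_prop
    simpa only [Function.comp_def] using
      ((measurable_minerIterate h.differentiable h.measurable ηl (k + 1)).comp h2).snd.snd
  constructor
  · refine (lintegral_average_sq_le (Finset.range K) (fun k _ => hm k)
      (c := fun _ => 1.7 * ‖g‖ ^ 2) (fun _ _ => by positivity) fun k hk =>
        h.lintegral_minerIterate_sq_le hL hLσ hb hbD hK ha haa hη hηl hLK x g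
          (Finset.mem_range.1 hk)).trans (ENNReal.ofReal_le_ofReal (le_of_eq ?_))
    simp only [Finset.sum_const, Finset.card_range, nsmul_eq_mul]
    field_simp
  · have e : ∀ B : Fin K → Fin b' → Z, minerDirection f ηl B x g - g
        = ((Finset.range K).card : ℝ)⁻¹ • ∑ k ∈ Finset.range K,
          ((minerIterate f ηl B x g (k + 1)).2.2 - g) := by
      intro B
      rw [Finset.sum_sub_distrib, smul_sub, minerDirection, Finset.sum_const,
        ← Nat.cast_smul_eq_nsmul ℝ, smul_smul, Finset.card_range, inv_mul_cancel₀ hK0.ne',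
        one_smul]
    simp_rw [e]
    refine (lintegral_average_sq_le (Finset.range K) (fun k _ => (hm k).sub_const g)
      (c := fun k => 0.38 * (k / K) * ‖g‖ ^ 2) (fun _ _ => by positivity) fun k hk =>
        h.lintegral_minerIterate_sub_sq_le hL hLσ hb hbD hK ha haa hη hηl hLK x g
          (Finset.mem_range.1 hk)).trans (ENNReal.ofReal_le_ofReal ?_)
    -- The average of `k / K` over `k < K` is below `1/2`, which halves `0.38` to `0.19`.
    have hs : ∑ k ∈ Finset.range K, (k : ℝ) = K * (K - 1) / 2 := by
      have := Finset.sum_range_id_mul_two K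
      have h2 : ((∑ k ∈ Finset.range K, k : ℕ) : ℝ) * 2 = K * (K - 1) := by
        rw [← Nat.cast_pred (by omega : 0 < K)]
        exact_mod_cast this
      push_cast at h2
      linarith
    rw [← Finset.sum_mul, ← Finset.mul_sum, ← Finset.sum_div, hs, Finset.card_range, ← mul_assoc]
    refine mul_le_mul_of_nonneg_right ?_ (by positivity)
    have : (K : ℝ)⁻¹ * (0.38 * (K * (K - 1) / 2 / K)) = 0.19 * (1 - 1 / K) := by
      field_simp; ring
    rw [this]
    have : 0 ≤ 1 / (K : ℝ) := by positivity
    linarith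

end RegularClient

/-! ### Descent inequality for smooth functions. -/

section Smooth

variable {E : Type*} [NormedAddCommGroup E] [InnerProductSpace ℝ E] [CompleteSpace E]
  {F : E → ℝ} {L : ℝ}

/-- The quadratic upper bound of a function with Lipschitz gradient. -/
lemma le_quadratic_of_gradient_lipschitz (hF : Differentiable ℝ F)
    (hL : ∀ v w, ‖gradient F v - gradient F w‖ ≤ L * ‖v - w‖) (x h : E) :
    F (x + h) ≤ F x + inner ℝ (gradient F x) h + L / 2 * ‖h‖ ^ 2 := by
  have hline : ∀ t : ℝ, HasDerivAt (fun t : ℝ => x + t • h) h t := fun t => by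
    simpa using ((hasDerivAt_id t).smul_const h).const_add x
  have hd : ∀ t : ℝ, HasDerivAt
      (fun t : ℝ => F (x + t • h) - t * inner ℝ (gradient F x) h - L / 2 * ‖h‖ ^ 2 * t ^ 2)
      (inner ℝ (gradient F (x + t • h)) h - inner ℝ (gradient F x) h
        - L / 2 * ‖h‖ ^ 2 * (2 * t)) t := by
    intro t
    have h1 := (hF (x + t • h)).hasGradientAt.hasFDerivAt.comp_hasDerivAt t (hline t)
    rw [InnerProductSpace.toDual_apply_apply] at h1
    have h2 : HasDerivAt (fun t : ℝ => t * inner ℝ (gradient F x) h)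
        (inner ℝ (gradient F x) h) t := by
      simpa using (hasDerivAt_id t).mul_const (inner ℝ (gradient F x) h)
    have h3 : HasDerivAt (fun t : ℝ => L / 2 * ‖h‖ ^ 2 * t ^ 2) (L / 2 * ‖h‖ ^ 2 * (2 * t)) t := by
      simpa using (hasDerivAt_pow 2 t).const_mul (L / 2 * ‖h‖ ^ 2)
    exact (h1.fun_sub h2).fun_sub h3
  have hanti := antitoneOn_of_deriv_nonpos (convex_Icc (0 : ℝ) 1)
    (fun t _ => (hd t).continuousAt.continuousWithinAt)
    (fun t _ => (hd t).differentiableAt.differentiableWithinAt) (fun t ht => by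
      rw [interior_Icc] at ht
      rw [(hd t).deriv, ← inner_sub_left]
      have h1 := hL (x + t • h) x
      rw [add_sub_cancel_left, norm_smul, Real.norm_of_nonneg ht.1.le] at h1
      have h2 := real_inner_le_norm (gradient F (x + t • h) - gradient F x) h
      have h3 := mul_le_mul_of_nonneg_right h1 (norm_nonneg h)
      nlinarith)
  have := hanti (Set.left_mem_Icc.2 zero_le_one) (Set.right_mem_Icc.2 zero_le_one) zero_le_one
  simp only [one_smul, one_mul, zero_smul, zero_mul, add_zero, one_pow, mul_one, ne_eq,
    OfNat.ofNat_ne_zero, not_false_eq_true, zero_pow, mul_zero, sub_zero] at this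
  linarith

/-- A gradient step of length `1 / L` decreases `F` by at least `‖∇F‖² / (2L)`, but not below its
lower bound. This is a reverse PL inequality: it forces `μ ≤ L` and limits how much a step can
decrease `F`. -/
lemma norm_gradient_sq_le (hF : Differentiable ℝ F) (hL0 : 0 < L)
    (hL : ∀ v w, ‖gradient F v - gradient F w‖ ≤ L * ‖v - w‖) {Fmin : ℝ}
    (hmin : ∀ x, Fmin ≤ F x) (x : E) : ‖gradient F x‖ ^ 2 ≤ 2 * L * (F x - Fmin) := by
  have h1 := le_quadratic_of_gradient_lipschitz hF hL x (-(L⁻¹ • gradient F x))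
  have h2 := hmin (x + -(L⁻¹ • gradient F x))
  rw [inner_neg_right, inner_smul_right, real_inner_self_eq_norm_sq, norm_neg, norm_smul,
    Real.norm_of_nonneg (by positivity), mul_pow] at h1
  have e : F x + -(L⁻¹ * ‖gradient F x‖ ^ 2) + L / 2 * (L⁻¹ ^ 2 * ‖gradient F x‖ ^ 2)
      = F x - ‖gradient F x‖ ^ 2 / (2 * L) := by field_simp; ring
  rw [e] at h1
  have h3 : ‖gradient F x‖ ^ 2 / (2 * L) ≤ F x - Fmin := by linarith
  rw [div_le_iff₀ (by positivity)] at h3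
  linarith

end Smooth

/-! ### The global loss inherits smoothness. -/

section GlobalLoss

variable {Z : Type*} [MeasurableSpace Z] {d M : ℕ} {f : Fin M → Vec d → Z → ℝ}
  {D : Fin M → LocalData Z} {L : ℝ}

lemma LSmooth.differentiable_globalLoss (h : LSmooth f D L) :
    Differentiable ℝ (globalLoss f D) := by
  unfold globalLoss
  exact (Differentiable.fun_sum fun i _ => (h i).1).const_mul _

lemma LSmooth.gradient_globalLoss (h : LSmooth f D L) (x : Vec d) :
    gradient (globalLoss f D) x = (M : ℝ)⁻¹ • ∑ i, gradient (localLoss (f i) (D i)) x := by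
  unfold gradient globalLoss
  rw [fderiv_const_mul (DifferentiableAt.fun_sum fun i _ => (h i).1 x),
    fderiv_fun_sum fun i _ => (h i).1 x]
  simp

lemma LSmooth.gradient_globalLoss_lipschitz (h : LSmooth f D L) (hM : 1 ≤ M) (v w : Vec d) :
    ‖gradient (globalLoss f D) v - gradient (globalLoss f D) w‖ ≤ L * ‖v - w‖ := by
  have hM0 : (0 : ℝ) < M := by exact_mod_cast hM
  rw [h.gradient_globalLoss, h.gradient_globalLoss, ← smul_sub, ← Finset.sum_sub_distrib,
    norm_smul, Real.norm_of_nonneg (by positivity)]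
  calc _ ≤ (M : ℝ)⁻¹ * ∑ i : Fin M, L * ‖v - w‖ := by
        gcongr
        exact norm_sum_le_of_le _ fun i _ => (h i).2 v w
    _ = _ := by simp; field_simp

lemma LSmooth.continuous_gradient (h : LSmooth f D L) (i : Fin M) :
    Continuous (gradient (localLoss (f i) (D i))) := by
  have : LipschitzWith L.toNNReal (gradient (localLoss (f i) (D i))) :=
    LipschitzWith.of_dist_le_mul fun v w => by
      rw [dist_eq_norm, dist_eq_norm]
      refine ((h i).2 v w).trans ?_
      gcongr
      exact Real.le_coe_toNNReal L
  exact this.continuous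

end GlobalLoss

/-! ### Probabilities of refreshing and of having no miner. -/

section Selection

variable {M A : ℕ} {p : unitInterval}

/-- The law of the participants and the coins of one round. -/
noncomputable def selectionLaw (M A : ℕ) (p : unitInterval) :
    Measure (Finset (Fin M) × (Fin M → Bool)) :=
  (uniformOn {S : Finset (Fin M) | S.card = A}).prod
    (Measure.pi fun _ : Fin M => bernoulliMeasure true false p)

lemma setOf_card_eq (M A : ℕ) : {S : Finset (Fin M) | S.card = A}
    = ((Finset.univ : Finset (Fin M)).powersetCard A : Set (Finset (Fin M))) := by
  ext; simp

lemma isProbabilityMeasure_uniformOn_card (hA : A ≤ M) :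
    IsProbabilityMeasure (uniformOn {S : Finset (Fin M) | S.card = A}) := by
  refine isProbabilityMeasure_uniformOn (Set.toFinite _) ?_
  obtain ⟨S, -, hS⟩ := Finset.exists_subset_card_eq (s := (Finset.univ : Finset (Fin M)))
    (n := A) (by simpa using hA)
  exact ⟨S, hS⟩

lemma isProbabilityMeasure_selectionLaw (hA : A ≤ M) :
    IsProbabilityMeasure (selectionLaw M A p) := by
  have := isProbabilityMeasure_uniformOn_card hA
  unfold selectionLaw
  infer_instance

lemma uniformOn_card_mem (hA1 : 1 ≤ A) (hA : A ≤ M) (i : Fin M) :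
    (uniformOn {S : Finset (Fin M) | S.card = A}).real {S | i ∈ S} = A / M := by
  classical
  have e : {S : Finset (Fin M) | i ∈ S}
      = ((Finset.univ.filter fun S : Finset (Fin M) => i ∈ S : Finset _) : Set _) := by
    ext; simp
  have hc : ((Finset.univ : Finset (Fin M)).powersetCard A
      ∩ Finset.univ.filter fun S : Finset (Fin M) => i ∈ S).card = (M - 1).choose (A - 1) := by
    have := Finset.card_filter_powersetCard_subset {i} (Finset.univ : Finset (Fin M)) A
      (by simp) (by simpa using hA1)
    simp only [Finset.card_univ, Fintype.card_fin, Finset.card_singleton,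
      Finset.singleton_subset_iff] at this
    rw [← this]
    congr 1
    ext; simp
  rw [measureReal_def, setOf_card_eq, e, uniformOn_apply_finset, hc, Finset.card_powersetCard,
    Finset.card_univ, Fintype.card_fin]
  have hpos : 0 < M.choose A := Nat.choose_pos hA
  obtain ⟨m, rfl⟩ : ∃ m, M = m + 1 := ⟨M - 1, by omega⟩
  obtain ⟨a, rfl⟩ : ∃ a, A = a + 1 := ⟨A - 1, by omega⟩
  -- A given client lies in `(M-1).choose (A-1)` of the `M.choose A` sets; the absorption identity
  -- makes the ratio `A / M`.
  have h1 := Nat.add_one_mul_choose_eq m a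
  rw [ENNReal.toReal_div]
  simp only [ENNReal.toReal_natCast, Nat.add_sub_cancel]
  rw [div_eq_div_iff (by positivity) (by positivity)]
  have h2 : ((m + 1 : ℕ) : ℝ) * (m.choose a) = (m + 1).choose (a + 1) * ((a + 1 : ℕ) : ℝ) := by
    exact_mod_cast h1
  linarith

lemma selectionLaw_anchor (hA1 : 1 ≤ A) (hA : A ≤ M) (i : Fin M) :
    (selectionLaw M A p).real {c | i ∈ c.1 ∧ c.2 i = true} = A / M * p := by
  have hP := isProbabilityMeasure_uniformOn_card hA
  have e : {c : Finset (Fin M) × (Fin M → Bool) | i ∈ c.1 ∧ c.2 i = true}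
      = {S | i ∈ S} ×ˢ ((fun c : Fin M → Bool => c i) ⁻¹' {true}) := by
    ext; simp
  rw [e, selectionLaw, measureReal_prod_prod, uniformOn_card_mem hA1 hA]
  congr 1
  rw [measureReal_def, (measurePreserving_eval
    (fun _ : Fin M => bernoulliMeasure true false p) i).measure_preimage
      (MeasurableSet.singleton _).nullMeasurableSet, ← measureReal_def,
    bernoulliMeasure_real_apply p (MeasurableSet.singleton _)]
  simp

lemma selectionLaw_no_miner (hA : A ≤ M) :
    (selectionLaw M A p).real {c | ∀ i ∈ c.1, c.2 i = true} = (p : ℝ) ^ A := by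
  classical
  have hP := isProbabilityMeasure_uniformOn_card hA
  have hm : MeasurableSet {c : Finset (Fin M) × (Fin M → Bool) | ∀ i ∈ c.1, c.2 i = true} :=
    (Set.toFinite _).measurableSet
  -- Given the participants, the probability that all coins show anchor depends only on their
  -- number, which is almost surely `A`.
  have hbox : ∀ S : Finset (Fin M), (Measure.pi fun _ : Fin M => bernoulliMeasure true false p)
      (Prod.mk S ⁻¹' {c : Finset (Fin M) × (Fin M → Bool) | ∀ i ∈ c.1, c.2 i = true})
      = ENNReal.ofReal p ^ S.card := by
    intro S
    have e : Prod.mk S ⁻¹' {c : Finset (Fin M) × (Fin M → Bool) | ∀ i ∈ c.1, c.2 i = true}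
        = Set.pi S fun _ => {true} := by
      ext; simp [Set.mem_pi]
    have hb : bernoulliMeasure true false p {true} = ENNReal.ofReal p := by
      rw [bernoulliMeasure_apply p (MeasurableSet.singleton _)]
      simp only [Set.mem_singleton_iff, if_true, Bool.false_eq_true, if_false]
      rw [← ENNReal.ofReal_coe_nnreal]
      rfl
    rw [e, ← Measure.infinitePi_eq_pi,
      Measure.infinitePi_pi _ (fun _ _ => MeasurableSet.singleton _)]
    simp [hb]
  rw [measureReal_def, selectionLaw, Measure.prod_apply hm]
  simp_rw [hbox]
  have hae : ∀ᵐ S ∂uniformOn {S : Finset (Fin M) | S.card = A},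
      ENNReal.ofReal p ^ S.card = ENNReal.ofReal p ^ A := by
    have : ∀ᵐ S ∂uniformOn {S : Finset (Fin M) | S.card = A}, S.card = A := by
      rw [uniformOn]
      exact ae_cond_mem (Set.toFinite _).measurableSet
    filter_upwards [this] with S hS
    rw [hS]
  rw [lintegral_congr_ae hae, lintegral_const, measure_univ, mul_one, ENNReal.toReal_pow,
    ENNReal.toReal_ofReal p.2.1]

end Selection

/-! ### The run with the reference models of the cached gradients. -/

section AugmentedRun

variable {Z : Type*} {d M b K b' : ℕ}

/-- The server state together with the model at which each caching gradient was computed. -/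
abbrev AugState (d M : ℕ) := State d M × (Fin M → Vec d)

/-- The participants of a round that refresh their caching gradients. -/
def anchors (c : Finset (Fin M) × (Fin M → Bool)) : Finset (Fin M) :=
  c.1.filter (fun i => c.2 i = true)

lemma mem_anchors {c : Finset (Fin M) × (Fin M → Bool)} {i : Fin M} :
    i ∈ anchors c ↔ i ∈ c.1 ∧ c.2 i = true := by
  simp [anchors]

/-- The added component is pure bookkeeping: the algorithm never reads it (`augRun_fst`), but the
noise and the staleness are defined through it. -/
noncomputable def augRound (f : Fin M → Vec d → Z → ℝ) (ηl ηs : ℝ) (st : AugState d M)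
    (r : RoundChoice Z M b K b') : AugState d M :=
  (round f ηl ηs st.1 r, fun i => if i ∈ anchors (r.1, r.2.1) then st.1.1 else st.2 i)

noncomputable def augInit (f : Fin M → Vec d → Z → ℝ) (x₀ : Vec d) (B : Fin M → Fin b → Z) :
    AugState d M :=
  ((x₀, fun i => batchGrad (f i) (B i) x₀), fun _ => x₀)

noncomputable def augRun (f : Fin M → Vec d → Z → ℝ) (ηl ηs : ℝ) (x₀ : Vec d)
    (ω : RunChoice Z M b K b') : ℕ → AugState d M
  | 0 => augInit f x₀ ω.1
  | t + 1 => augRound f ηl ηs (augRun f ηl ηs x₀ ω t) (ω.2 t)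

lemma augRun_fst (f : Fin M → Vec d → Z → ℝ) (ηl ηs : ℝ) (x₀ : Vec d)
    (ω : RunChoice Z M b K b') (t : ℕ) :
    (augRun f ηl ηs x₀ ω t).1 = run f ηl ηs x₀ ω t := by
  induction t with
  | zero => rfl
  | succ t ih => simp only [augRun, augRound, ih, run]

/-- The averaged direction of the miners of a round, which is `0` if there are none. -/
noncomputable def meanDirection (f : Fin M → Vec d → Z → ℝ) (ηl : ℝ) (m : Finset (Fin M))
    (B : Fin M → Fin K → Fin b' → Z) (x g : Vec d) : Vec d :=
  (m.card : ℝ)⁻¹ • ∑ i ∈ m, minerDirection (f i) ηl (B i) x g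

/-- Without miners the empty average is `0`, so the two branches of the round merge into one formula
with effective step `ηs * (ηl * K)`. -/
lemma round_fst (f : Fin M → Vec d → Z → ℝ) (ηl ηs : ℝ) (st : State d M)
    (r : RoundChoice Z M b K b') :
    (round f ηl ηs st r).1
      = st.1 - (ηs * (ηl * K)) • meanDirection f ηl (miners r) r.2.2.2 st.1 (bullseye st.2) := by
  unfold round meanDirection
  by_cases h : (miners r).Nonempty
  · simp only [h, if_true, minerChange_eq]
    rw [← Finset.smul_sum, smul_comm _ (ηl * K), smul_smul]
  · rw [Finset.not_nonempty_iff_eq_empty] at h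
    simp [h]

variable [MeasurableSpace Z]

/-- The sampling noise of a caching gradient. -/
noncomputable def noise (f : Fin M → Vec d → Z → ℝ) (D : Fin M → LocalData Z)
    (st : AugState d M) (i : Fin M) : Vec d :=
  st.1.2 i - gradient (localLoss (f i) (D i)) (st.2 i)

/-- The mean squared distance between the model and the models of the caching gradients. -/
noncomputable def staleness (st : AugState d M) : ℝ :=
  (M : ℝ)⁻¹ * ∑ i, ‖st.2 i - st.1.1‖ ^ 2

lemma noise_augRound (f : Fin M → Vec d → Z → ℝ) (D : Fin M → LocalData Z) (ηl ηs : ℝ)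
    (st : AugState d M) (r : RoundChoice Z M b K b') (i : Fin M) :
    noise f D (augRound f ηl ηs st r) i = if i ∈ anchors (r.1, r.2.1) then
      batchGrad (f i) (r.2.2.1 i) st.1.1 - gradient (localLoss (f i) (D i)) st.1.1
      else noise f D st i := by
  by_cases h : i ∈ anchors (r.1, r.2.1)
  · have h' := mem_anchors.1 h
    simp only at h'
    simp [noise, augRound, round, h, h']
  · have h' := fun h' => h (mem_anchors.2 h')
    simp only [noise, augRound, round, h, if_false]
    rw [if_neg h']

lemma measurable_augRound {f : Fin M → Vec d → Z → ℝ}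
    (hd : ∀ i z, Differentiable ℝ fun x => f i x z) (hm : ∀ i x, Measurable (f i x))
    (ηl ηs : ℝ) :
    Measurable (Function.uncurry (augRound (b := b) (K := K) (b' := b') f ηl ηs)) := by
  -- Selections range over a finite discrete space, so it suffices to fix one; the branches on
  -- anchors and miners are then constant.
  have key : ∀ c : Finset (Fin M) × (Fin M → Bool), Measurable fun q :
      AugState d M × (Fin M → Fin b → Z) × (Fin M → Fin K → Fin b' → Z) =>
      augRound f ηl ηs q.1 (c.1, c.2, q.2.1, q.2.2) := by
    intro c
    have hg : Measurable fun q :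
        AugState d M × (Fin M → Fin b → Z) × (Fin M → Fin K → Fin b' → Z) =>
        bullseye q.1.1.2 := by
      unfold bullseye; fun_prop
    have hx : Measurable fun q :
        AugState d M × (Fin M → Fin b → Z) × (Fin M → Fin K → Fin b' → Z) =>
        (round f ηl ηs q.1.1 (c.1, c.2, q.2.1, q.2.2)).1 := by
      simp only [round_fst, meanDirection]
      have h1 : ∀ i, Measurable fun q :
          AugState d M × (Fin M → Fin b → Z) × (Fin M → Fin K → Fin b' → Z) =>
          minerDirection (f i) ηl (q.2.2 i) q.1.1.1 (bullseye q.1.1.2) := by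
        intro i
        have h2 : Measurable fun q :
            AugState d M × (Fin M → Fin b → Z) × (Fin M → Fin K → Fin b' → Z) =>
            (q.2.2 i, q.1.1.1, bullseye q.1.1.2) := by fun_prop
        simpa only [Function.comp_def] using
          (measurable_minerDirection (hd i) (hm i) ηl).comp h2
      simp only [miners]
      fun_prop
    refine Measurable.prodMk (Measurable.prodMk hx (measurable_pi_lambda _ fun i => ?_))
      (measurable_pi_lambda _ fun i => ?_)
    · simp only
      split_ifs
      · have h2 : Measurable fun q :
            AugState d M × (Fin M → Fin b → Z) × (Fin M → Fin K → Fin b' → Z) =>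
            (q.2.1 i, q.1.1.1) := by fun_prop
        simpa only [Function.comp_def] using (measurable_batchGrad (hd i) (hm i) b).comp h2
      · fun_prop
    · simp only
      split_ifs <;> fun_prop
  have h1 := measurable_from_prod_countable_right
    (f := fun q : (Finset (Fin M) × (Fin M → Bool)) × AugState d M ×
      (Fin M → Fin b → Z) × (Fin M → Fin K → Fin b' → Z) =>
      augRound f ηl ηs q.2.1 (q.1.1, q.1.2, q.2.2.1, q.2.2.2)) key
  have h2 : Measurable fun q : AugState d M × RoundChoice Z M b K b' =>
      ((q.2.1, q.2.2.1), q.1, q.2.2.2.1, q.2.2.2.2) := by fun_prop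
  exact h1.comp h2

lemma measurable_augInit {f : Fin M → Vec d → Z → ℝ}
    (hd : ∀ i z, Differentiable ℝ fun x => f i x z) (hm : ∀ i x, Measurable (f i x))
    (x₀ : Vec d) : Measurable (augInit (b := b) f x₀) := by
  refine Measurable.prodMk (measurable_const.prodMk (measurable_pi_lambda _ fun i => ?_))
    measurable_const
  have h2 : Measurable fun B : Fin M → Fin b → Z => (B i, x₀) := by fun_prop
  simpa only [Function.comp_def] using (measurable_batchGrad (hd i) (hm i) b).comp h2

lemma measurable_augRun {f : Fin M → Vec d → Z → ℝ}
    (hd : ∀ i z, Differentiable ℝ fun x => f i x z) (hm : ∀ i x, Measurable (f i x))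
    (ηl ηs : ℝ) (x₀ : Vec d) (t : ℕ) :
    Measurable fun ω : RunChoice Z M b K b' => augRun f ηl ηs x₀ ω t :=
  measurable_chain (measurable_augInit hd hm x₀) (measurable_augRound hd hm ηl ηs)
    (X := augRun f ηl ηs x₀) (fun _ => rfl) (fun _ _ => rfl) t

lemma LSmooth.measurable_noise {f : Fin M → Vec d → Z → ℝ} {D : Fin M → LocalData Z} {L : ℝ}
    (hS : LSmooth f D L) (i : Fin M) : Measurable fun st : AugState d M => noise f D st i := by
  have h1 := (hS.continuous_gradient i).measurable
  have h2 : Measurable fun st : AugState d M => gradient (localLoss (f i) (D i)) (st.2 i) :=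
    h1.comp (by fun_prop)
  unfold noise
  fun_prop

lemma measurable_staleness : Measurable (staleness : AugState d M → ℝ) := by
  unfold staleness
  fun_prop

end AugmentedRun

/-! ### Separating selection from batches in one round. -/

section RoundLaw

variable {Z : Type*} [MeasurableSpace Z] {d M A b K b' : ℕ} {p : unitInterval}
  {D : Fin M → LocalData Z}

/-- The law of all batches of one round. -/
noncomputable def batchesLaw (D : Fin M → LocalData Z) (b K b' : ℕ) :
    Measure ((Fin M → Fin b → Z) × (Fin M → Fin K → Fin b' → Z)) :=
  (Measure.pi fun i : Fin M => (D i).batchLaw b).prod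
    (Measure.pi fun i : Fin M => Measure.pi fun _ : Fin K => (D i).batchLaw b')

lemma lintegral_roundLaw (hA : A ≤ M) (hb : ∀ i, (b : ℕ∞) ≤ (D i).size)
    (hb' : ∀ i, (b' : ℕ∞) ≤ (D i).size) {φ : RoundChoice Z M b K b' → ℝ≥0∞}
    (hφ : Measurable φ) :
    ∫⁻ r, φ r ∂roundLaw D A b K b' p
      = ∫⁻ c, ∫⁻ B, φ (c.1, c.2, B.1, B.2) ∂batchesLaw D b K b' ∂selectionLaw M A p := by
  have := isProbabilityMeasure_uniformOn_card hA
  have := fun i => (D i).isProbabilityMeasure_batchLaw (hb i)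
  have := fun i => (D i).isProbabilityMeasure_batchLaw (hb' i)
  have h2 : Measurable fun q : (Finset (Fin M) × (Fin M → Bool)) ×
      (Fin M → Fin b → Z) × (Fin M → Fin K → Fin b' → Z) =>
      φ (q.1.1, q.1.2, q.2.1, q.2.2) := hφ.comp (by fun_prop)
  unfold roundLaw selectionLaw batchesLaw
  rw [lintegral_prod _ hφ.aemeasurable, lintegral_prod _ h2.lintegral_prod_right'.aemeasurable]
  refine lintegral_congr fun S => ?_
  exact lintegral_prod _ (hφ.comp measurable_prodMk_left).aemeasurable

lemma isProbabilityMeasure_roundLaw (hA : A ≤ M) (hb : ∀ i, (b : ℕ∞) ≤ (D i).size)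
    (hb' : ∀ i, (b' : ℕ∞) ≤ (D i).size) : IsProbabilityMeasure (roundLaw D A b K b' p) := by
  have := isProbabilityMeasure_uniformOn_card hA
  have := fun i => (D i).isProbabilityMeasure_batchLaw (hb i)
  have := fun i => (D i).isProbabilityMeasure_batchLaw (hb' i)
  unfold roundLaw
  infer_instance

lemma isProbabilityMeasure_runLaw (hA : A ≤ M) (hb : ∀ i, (b : ℕ∞) ≤ (D i).size)
    (hb' : ∀ i, (b' : ℕ∞) ≤ (D i).size) : IsProbabilityMeasure (runLaw D A b K b' p) := by
  have := isProbabilityMeasure_roundLaw (K := K) (p := p) hA hb hb'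
  have := fun i => (D i).isProbabilityMeasure_batchLaw (hb i)
  unfold runLaw
  infer_instance

end RoundLaw

/-! ### Uncorrelated noise in the cached gradients. -/

section Noise

variable {Z : Type*} [MeasurableSpace Z] {d M A b K b' : ℕ} {p : unitInterval}
  {f : Fin M → Vec d → Z → ℝ} {D : Fin M → LocalData Z} {L σ Lσ ν₀ ηl ηs : ℝ}

lemma lintegral_noise_pi_le (h : ∀ i, RegularClient (f i) (D i) L σ Lσ) (hL : 0 ≤ L)
    (hLσ : 0 ≤ Lσ) (hb1 : 1 ≤ b) (hb : ∀ i, (b : ℕ∞) ≤ (D i).size)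
    (hν : ∀ i v, ∫⁻ B, ‖batchGrad (f i) B v - gradient (localLoss (f i) (D i)) v‖ₑ ^ 2
      ∂(D i).batchLaw b ≤ ENNReal.ofReal ν₀) (x c : Vec d) (T : Finset (Fin M)) :
    ∫⁻ B, ‖c + ∑ i ∈ T, (batchGrad (f i) (B i) x - gradient (localLoss (f i) (D i)) x)‖ₑ ^ 2
      ∂(Measure.pi fun i : Fin M => (D i).batchLaw b)
      ≤ ‖c‖ₑ ^ 2 + T.card * ENNReal.ofReal ν₀ := by
  have := fun i => (D i).isProbabilityMeasure_batchLaw (hb i)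
  exact lintegral_pi_enorm_add_sum_sq_le (fun i => (D i).batchLaw b)
    (N := fun i B => batchGrad (f i) B x - gradient (localLoss (f i) (D i)) x)
    (fun i => ((h i).measurable_batchGrad_const b x).sub_const _) ENNReal.ofReal_ne_top
    (fun i => hν i x) (fun i => (h i).integral_batchGrad_sub hL hLσ hb1 (hb i) x) c T

/-- Given the selection, clients of `Q` that do not refresh keep their old noise as one fixed
vector, and the refreshed ones add independent centred terms. The reference model is the current
`x`, which is fixed before the fresh batches are drawn. -/
lemma lintegral_noise_round_le (h : ∀ i, RegularClient (f i) (D i) L σ Lσ)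
    (hS : LSmooth f D L) (hL : 0 ≤ L)
    (hLσ : 0 ≤ Lσ) (hA : A ≤ M) (hb1 : 1 ≤ b) (hb : ∀ i, (b : ℕ∞) ≤ (D i).size)
    (hb' : ∀ i, (b' : ℕ∞) ≤ (D i).size)
    (hν : ∀ i v, ∫⁻ B, ‖batchGrad (f i) B v - gradient (localLoss (f i) (D i)) v‖ₑ ^ 2
      ∂(D i).batchLaw b ≤ ENNReal.ofReal ν₀) (st : AugState d M) (Q : Finset (Fin M)) :
    ∫⁻ r, ‖∑ i ∈ Q, noise f D (augRound f ηl ηs st r) i‖ₑ ^ 2 ∂roundLaw D A b K b' p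
      ≤ ∫⁻ c, (‖∑ i ∈ Q \ anchors c, noise f D st i‖ₑ ^ 2
          + (Q ∩ anchors c).card * ENNReal.ofReal ν₀) ∂selectionLaw M A p := by
  have hP := fun i => (D i).isProbabilityMeasure_batchLaw (hb i)
  have hP' := fun i => (D i).isProbabilityMeasure_batchLaw (hb' i)
  have hr : Measurable fun r : RoundChoice Z M b K b' => augRound f ηl ηs st r :=
    (measurable_augRound (fun i => (h i).differentiable) (fun i => (h i).measurable) ηl ηs).comp
      measurable_prodMk_left
  have hm : Measurable fun r : RoundChoice Z M b K b' =>
      ‖∑ i ∈ Q, noise f D (augRound f ηl ηs st r) i‖ₑ ^ 2 := by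
    have := fun i => (hS.measurable_noise i).comp hr
    simp only [Function.comp_def] at this
    fun_prop
  rw [lintegral_roundLaw hA hb hb' hm]
  refine lintegral_mono fun c => ?_
  have e : ∀ B : (Fin M → Fin b → Z) × (Fin M → Fin K → Fin b' → Z),
      ∑ i ∈ Q, noise f D (augRound f ηl ηs st (c.1, c.2, B.1, B.2)) i
      = ∑ i ∈ Q \ anchors c, noise f D st i + ∑ i ∈ Q ∩ anchors c,
        (batchGrad (f i) (B.1 i) st.1.1 - gradient (localLoss (f i) (D i)) st.1.1) := by
    intro B
    rw [← Finset.sum_sdiff (Finset.inter_subset_left (s₁ := Q) (s₂ := anchors c)),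
      Finset.sdiff_inter_self_left]
    congr 1
    · refine Finset.sum_congr rfl fun i hi => ?_
      rw [noise_augRound, if_neg (Finset.mem_sdiff.1 hi).2]
    · refine Finset.sum_congr rfl fun i hi => ?_
      rw [noise_augRound, if_pos (Finset.mem_inter.1 hi).2]
  simp_rw [e]
  have hm2 : Measurable fun B : Fin M → Fin b → Z => ‖∑ i ∈ Q \ anchors c, noise f D st i
      + ∑ i ∈ Q ∩ anchors c, (batchGrad (f i) (B i) st.1.1
        - gradient (localLoss (f i) (D i)) st.1.1)‖ₑ ^ 2 := by
    have : ∀ i, Measurable fun B : Fin M → Fin b → Z => batchGrad (f i) (B i) st.1.1 := fun i =>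
      ((h i).measurable_batchGrad_const b st.1.1).comp (measurable_pi_apply i)
    fun_prop
  have := measurePreserving_fst (μ := Measure.pi fun i : Fin M => (D i).batchLaw b)
    (ν := Measure.pi fun i : Fin M => Measure.pi fun _ : Fin K => (D i).batchLaw b')
  exact (this.lintegral_comp hm2).trans_le
    (lintegral_noise_pi_le h hL hLσ hb1 hb hν _ _ _)

/-- Sums of the noise of different clients are uncorrelated along the run. -/
lemma lintegral_noise_augRun_le (h : ∀ i, RegularClient (f i) (D i) L σ Lσ)
    (hS : LSmooth f D L) (hL : 0 ≤ L)
    (hLσ : 0 ≤ Lσ) (hA : A ≤ M) (hb1 : 1 ≤ b) (hb : ∀ i, (b : ℕ∞) ≤ (D i).size)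
    (hb' : ∀ i, (b' : ℕ∞) ≤ (D i).size)
    (hν : ∀ i v, ∫⁻ B, ‖batchGrad (f i) B v - gradient (localLoss (f i) (D i)) v‖ₑ ^ 2
      ∂(D i).batchLaw b ≤ ENNReal.ofReal ν₀) (x₀ : Vec d) (t : ℕ) (Q : Finset (Fin M)) :
    ∫⁻ ω, ‖∑ i ∈ Q, noise f D (augRun f ηl ηs x₀ ω t) i‖ₑ ^ 2 ∂runLaw D A b K b' p
      ≤ Q.card * ENNReal.ofReal ν₀ := by
  have hP := fun i => (D i).isProbabilityMeasure_batchLaw (hb i)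
  have hR := isProbabilityMeasure_roundLaw (K := K) (p := p) hA hb hb'
  have hrun := isProbabilityMeasure_runLaw (K := K) (p := p) hA hb hb'
  have hsel := isProbabilityMeasure_selectionLaw (p := p) hA
  have hchain := fun (t : ℕ) (φ : AugState d M → ℝ≥0∞) (hφ : Measurable φ) =>
    lintegral_chain_succ (Measure.pi fun i : Fin M => (D i).batchLaw b)
    (roundLaw D A b K b' p)
    (measurable_augInit (fun i => (h i).differentiable) (fun i => (h i).measurable) x₀)
    (measurable_augRound (fun i => (h i).differentiable) (fun i => (h i).measurable) ηl ηs)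
    (X := augRun f ηl ηs x₀) (fun _ => rfl) (fun _ _ => rfl) t hφ
  have hnm : ∀ Q : Finset (Fin M), Measurable fun st : AugState d M =>
      ‖∑ i ∈ Q, noise f D st i‖ₑ ^ 2 := by
    intro Q
    have := hS.measurable_noise
    fun_prop
  -- The claim is needed for all `Q` at once, because a round reduces `Q` to `Q \ anchors c`.
  induction t generalizing Q with
  | zero =>
    have hm2 : Measurable fun B : Fin M → Fin b → Z => ‖(0 : Vec d)
        + ∑ i ∈ Q, (batchGrad (f i) (B i) x₀ - gradient (localLoss (f i) (D i)) x₀)‖ₑ ^ 2 := by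
      have : ∀ i, Measurable fun B : Fin M → Fin b → Z => batchGrad (f i) (B i) x₀ := fun i =>
        ((h i).measurable_batchGrad_const b x₀).comp (measurable_pi_apply i)
      fun_prop
    have := measurePreserving_fst (μ := Measure.pi fun i : Fin M => (D i).batchLaw b)
      (ν := Measure.infinitePi fun _ : ℕ => roundLaw D A b K b' p)
    have h1 := (this.lintegral_comp hm2).trans_le
      (lintegral_noise_pi_le h hL hLσ hb1 hb hν x₀ 0 Q)
    simpa [augRun, augInit, noise, runLaw] using h1
  | succ t ih =>
    unfold runLaw at ih ⊢
    rw [hchain t _ (hnm Q)]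
    calc _ ≤ ∫⁻ ω, ∫⁻ c, (‖∑ i ∈ Q \ anchors c, noise f D (augRun f ηl ηs x₀ ω t) i‖ₑ ^ 2
            + (Q ∩ anchors c).card * ENNReal.ofReal ν₀) ∂selectionLaw M A p
            ∂(Measure.pi fun i : Fin M => (D i).batchLaw b).prod
              (Measure.infinitePi fun _ : ℕ => roundLaw D A b K b' p) :=
          lintegral_mono fun ω =>
            lintegral_noise_round_le h hS hL hLσ hA hb1 hb hb' hν _ Q
      -- The selection is independent of the past. After the exchange `c` is fixed, and the
      -- induction hypothesis applies to a deterministic set; the cardinalities of the kept and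
      -- refreshed parts add up to that of `Q`.
      _ = ∫⁻ c, ∫⁻ ω, (‖∑ i ∈ Q \ anchors c, noise f D (augRun f ηl ηs x₀ ω t) i‖ₑ ^ 2
            + (Q ∩ anchors c).card * ENNReal.ofReal ν₀)
            ∂(Measure.pi fun i : Fin M => (D i).batchLaw b).prod
              (Measure.infinitePi fun _ : ℕ => roundLaw D A b K b' p) ∂selectionLaw M A p := by
          refine lintegral_lintegral_swap ?_
          refine Measurable.aemeasurable ?_
          refine measurable_from_prod_countable_left fun c => ?_
          have := ((hnm (Q \ anchors c)).comp (measurable_augRun (b := b) (K := K) (b' := b') (fun i => (h i).differentiable)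
            (fun i => (h i).measurable) ηl ηs x₀ t)).add_const
            ((Q ∩ anchors c).card * ENNReal.ofReal ν₀)
          simpa only [Function.comp_def, Function.uncurry_def] using this
      _ ≤ ∫⁻ c, Q.card * ENNReal.ofReal ν₀ ∂selectionLaw M A p := by
          refine lintegral_mono fun c => ?_
          rw [lintegral_add_right _ measurable_const, lintegral_const, measure_univ, mul_one]
          refine (add_le_add_left (ih (Q \ anchors c)) _).trans (le_of_eq ?_)
          rw [← add_mul, ← Nat.cast_add, Finset.card_sdiff_add_card_inter]
      _ = _ := by rw [lintegral_const, measure_univ, mul_one]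

end Noise

/-! ### Passing between real and extended expectations. -/

section Expectations

/-- The constant `c₀` may be negative, so the bound cannot be split inside the lower integral; it
passes through the Bochner integral instead. -/
lemma lintegral_ofReal_affine_le {Ω E : Type*} [MeasurableSpace Ω] [NormedAddCommGroup E]
    [MeasurableSpace E] [OpensMeasurableSpace E] {P : Measure Ω} [IsProbabilityMeasure P]
    {φ : Ω → ℝ} {a₁ a₂ : Ω → E} (h₁ : Measurable a₁) (h₂ : Measurable a₂)
    {c₀ c₁ c₂ u₁ u₂ : ℝ} (hc₁ : 0 ≤ c₁) (hc₂ : 0 ≤ c₂) (hu₁ : 0 ≤ u₁) (hu₂ : 0 ≤ u₂)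
    (hI₁ : ∫⁻ ω, ‖a₁ ω‖ₑ ^ 2 ∂P ≤ ENNReal.ofReal u₁)
    (hI₂ : ∫⁻ ω, ‖a₂ ω‖ₑ ^ 2 ∂P ≤ ENNReal.ofReal u₂)
    (hφ0 : ∀ ω, 0 ≤ φ ω) (hφ : ∀ ω, φ ω ≤ c₀ + c₁ * ‖a₁ ω‖ ^ 2 + c₂ * ‖a₂ ω‖ ^ 2) :
    ∫⁻ ω, ENNReal.ofReal (φ ω) ∂P ≤ ENNReal.ofReal (c₀ + c₁ * u₁ + c₂ * u₂) := by
  have key : ∀ {a : Ω → E} {u : ℝ}, Measurable a → 0 ≤ u →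
      ∫⁻ ω, ‖a ω‖ₑ ^ 2 ∂P ≤ ENNReal.ofReal u →
      Integrable (fun ω => ‖a ω‖ ^ 2) P ∧ ∫ ω, ‖a ω‖ ^ 2 ∂P ≤ u := by
    intro a u ha hu hI
    have hm : AEStronglyMeasurable (fun ω => ‖a ω‖ ^ 2) P :=
      (ha.norm.pow_const 2).aestronglyMeasurable
    have hn : 0 ≤ᵐ[P] fun ω => ‖a ω‖ ^ 2 := .of_forall fun _ => by positivity
    simp_rw [enorm_sq_eq_ofReal] at hI
    have hi : Integrable (fun ω => ‖a ω‖ ^ 2) P :=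
      (lintegral_ofReal_ne_top_iff_integrable hm hn).1 (hI.trans_lt ENNReal.ofReal_lt_top).ne
    refine ⟨hi, ?_⟩
    rwa [← ofReal_integral_eq_lintegral_ofReal hi hn, ENNReal.ofReal_le_ofReal_iff hu] at hI
  obtain ⟨i₁, b₁⟩ := key h₁ hu₁ hI₁
  obtain ⟨i₂, b₂⟩ := key h₂ hu₂ hI₂
  have i₁' : Integrable (fun ω => c₀ + c₁ * ‖a₁ ω‖ ^ 2) P :=
    (integrable_const c₀).add (i₁.const_mul c₁)
  have i : Integrable (fun ω => c₀ + c₁ * ‖a₁ ω‖ ^ 2 + c₂ * ‖a₂ ω‖ ^ 2) P :=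
    i₁'.add (i₂.const_mul c₂)
  calc ∫⁻ ω, ENNReal.ofReal (φ ω) ∂P
      ≤ ∫⁻ ω, ENNReal.ofReal (c₀ + c₁ * ‖a₁ ω‖ ^ 2 + c₂ * ‖a₂ ω‖ ^ 2) ∂P :=
        lintegral_mono fun ω => ENNReal.ofReal_le_ofReal (hφ ω)
    _ = ENNReal.ofReal (c₀ + c₁ * ∫ ω, ‖a₁ ω‖ ^ 2 ∂P + c₂ * ∫ ω, ‖a₂ ω‖ ^ 2 ∂P) := by
        rw [← ofReal_integral_eq_lintegral_ofReal i (.of_forall fun ω => (hφ0 ω).trans (hφ ω)),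
          integral_add i₁' (i₂.const_mul c₂), integral_add (integrable_const _) (i₁.const_mul c₁),
          integral_const_mul, integral_const_mul]
        simp
    _ ≤ _ := ENNReal.ofReal_le_ofReal (by gcongr)

lemma integral_ite_zero_const {Ω : Type*} [MeasurableSpace Ω] {P : Measure Ω}
    [IsProbabilityMeasure P] {s : Set Ω} [DecidablePred (· ∈ s)] (hs : MeasurableSet s) (c : ℝ) :
    ∫ ω, (if ω ∈ s then 0 else c) ∂P = (1 - P.real s) * c := by
  have e : ∀ ω, (if ω ∈ s then 0 else c) = c - s.indicator (fun _ => c) ω := by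
    intro ω
    by_cases h : ω ∈ s <;> simp [h]
  simp_rw [e]
  rw [integral_sub (integrable_const _) ((integrable_const _).indicator hs),
    integral_indicator_const c hs]
  simp
  ring

end Expectations

/-! ### Pointwise estimates for one round. -/

section OneRound

variable {Z : Type*} [MeasurableSpace Z] {d M A b K b' : ℕ} {p : unitInterval}
  {f : Fin M → Vec d → Z → ℝ} {D : Fin M → LocalData Z} {L σ Lσ ηl ηs a η q β Fmin : ℝ}

/-- The mean square of the averaged sampling noise. -/
noncomputable def noiseEnergy (f : Fin M → Vec d → Z → ℝ) (D : Fin M → LocalData Z)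
    (st : AugState d M) : ℝ :=
  ‖(M : ℝ)⁻¹ • ∑ i, noise f D st i‖ ^ 2

/-- The optimality gap plus a multiple of the staleness of the caching gradients. -/
noncomputable def lyapunov (f : Fin M → Vec d → Z → ℝ) (D : Fin M → LocalData Z) (Fmin β : ℝ)
    (st : AugState d M) : ℝ :=
  globalLoss f D st.1.1 - Fmin + β * staleness st

lemma staleness_nonneg (st : AugState d M) : 0 ≤ staleness st := by
  unfold staleness; positivity

lemma lyapunov_nonneg (hmin : ∀ x, Fmin ≤ globalLoss f D x) (hβ : 0 ≤ β) (st : AugState d M) :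
    0 ≤ lyapunov f D Fmin β st := by
  have := hmin st.1.1
  have := mul_nonneg hβ (staleness_nonneg st)
  unfold lyapunov
  linarith

lemma LSmooth.measurable_globalLoss (hS : LSmooth f D L) : Measurable (globalLoss f D) :=
  hS.differentiable_globalLoss.continuous.measurable

lemma LSmooth.measurable_lyapunov (hS : LSmooth f D L) :
    Measurable fun st : AugState d M => lyapunov f D Fmin β st := by
  have h1 := hS.measurable_globalLoss
  have h2 : Measurable (staleness : AugState d M → ℝ) := measurable_staleness
  unfold lyapunov
  fun_prop

/-- The bullseye approximates the gradient up to the noise and the staleness. -/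
lemma norm_bullseye_sub_gradient_sq_le (hS : LSmooth f D L) (st : AugState d M) :
    ‖bullseye st.1.2 - gradient (globalLoss f D) st.1.1‖ ^ 2
      ≤ 1.25 * noiseEnergy f D st + 5 * L ^ 2 * staleness st := by
  set u := (M : ℝ)⁻¹ • ∑ i, noise f D st i with hu
  set w := (M : ℝ)⁻¹ • ∑ i, (gradient (localLoss (f i) (D i)) (st.2 i)
    - gradient (localLoss (f i) (D i)) st.1.1) with hw
  have e : bullseye st.1.2 - gradient (globalLoss f D) st.1.1 = u + w := by
    rw [hS.gradient_globalLoss, hu, hw, bullseye, ← smul_sub, ← smul_add,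
      ← Finset.sum_sub_distrib, ← Finset.sum_add_distrib]
    congr 1
    refine Finset.sum_congr rfl fun i _ => ?_
    rw [noise]
    abel
  have hw2 : ‖w‖ ^ 2 ≤ L ^ 2 * staleness st := by
    have h1 := norm_average_sq_le (Finset.univ : Finset (Fin M)) fun i =>
      gradient (localLoss (f i) (D i)) (st.2 i) - gradient (localLoss (f i) (D i)) st.1.1
    rw [Finset.card_univ, Fintype.card_fin] at h1
    refine h1.trans ?_
    rw [staleness, mul_left_comm, Finset.mul_sum (a := L ^ 2)]
    gcongr with i
    rw [← mul_pow]
    exact pow_le_pow_left₀ (norm_nonneg _) ((hS i).2 _ _) 2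
  have h3 : ‖u + w‖ ^ 2 ≤ (‖u‖ + ‖w‖) ^ 2 := pow_le_pow_left₀ (norm_nonneg _) (norm_add_le _ _) 2
  have h4 : noiseEnergy f D st = ‖u‖ ^ 2 := rfl
  rw [e, h4]
  -- Young's inequality weighted so that the noise, whose bound is tied to `ε`, gets a factor near
  -- one: `1 + 1/4` against `1 + 4`.
  nlinarith [sq_nonneg (‖u‖ - 4 * ‖w‖)]

/-- Polarization turns `-⟪G, g⟫` into half squares. The remaining `-⟪G, v - g⟫` is at most `0.15
‖G‖² + ‖v - g‖² / 0.6`, which leaves `-0.35 ‖G‖²`. The full `-0.5 ‖g‖²` is kept to pay for the error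
of the miners. -/
lemma globalLoss_step_le (hS : LSmooth f D L) (hM : 1 ≤ M) (hη : 0 ≤ η) (x g v : Vec d) :
    globalLoss f D (x - η • v) ≤ globalLoss f D x
      + η * (-0.35 * ‖gradient (globalLoss f D) x‖ ^ 2 - 0.5 * ‖g‖ ^ 2
        + 0.5 * ‖g - gradient (globalLoss f D) x‖ ^ 2)
      + η / 0.6 * ‖v - g‖ ^ 2 + L / 2 * η ^ 2 * ‖v‖ ^ 2 := by
  have h1 := le_quadratic_of_gradient_lipschitz hS.differentiable_globalLoss
    (hS.gradient_globalLoss_lipschitz hM) x (-(η • v))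
  rw [← sub_eq_add_neg, inner_neg_right, inner_smul_right, norm_neg, norm_smul,
    Real.norm_of_nonneg hη, mul_pow] at h1
  set G := gradient (globalLoss f D) x
  have h2 : inner ℝ G v = inner ℝ G g + inner ℝ G (v - g) := by
    rw [← inner_add_right]; congr 1; abel
  have h3 : ‖g - G‖ ^ 2 = ‖g‖ ^ 2 - 2 * inner ℝ G g + ‖G‖ ^ 2 := by
    rw [norm_sub_sq_real, real_inner_comm]
  have h4 : -(‖G‖ * ‖v - g‖) ≤ inner ℝ G (v - g) :=
    (abs_le.1 (abs_real_inner_le_norm G (v - g))).1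
  have h5 : -(inner ℝ G v) ≤ -0.35 * ‖G‖ ^ 2 - 0.5 * ‖g‖ ^ 2 + 0.5 * ‖g - G‖ ^ 2
      + 1 / 0.6 * ‖v - g‖ ^ 2 := by
    rw [h2, h3]
    nlinarith [sq_nonneg (0.3 * ‖G‖ - ‖v - g‖)]
  have h6 := mul_le_mul_of_nonneg_left h5 hη
  have e : η * (-0.35 * ‖G‖ ^ 2 - 0.5 * ‖g‖ ^ 2 + 0.5 * ‖g - G‖ ^ 2 + 1 / 0.6 * ‖v - g‖ ^ 2)
      = η * (-0.35 * ‖G‖ ^ 2 - 0.5 * ‖g‖ ^ 2 + 0.5 * ‖g - G‖ ^ 2) + η / 0.6 * ‖v - g‖ ^ 2 := by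
    ring
  rw [e] at h6
  nlinarith

/-- The staleness of the clients that do not refresh their caching gradients. -/
noncomputable def keptStaleness (st : AugState d M)
    (c : Finset (Fin M) × (Fin M → Bool)) : ℝ :=
  (M : ℝ)⁻¹ * ∑ i, if i ∈ anchors c then 0 else ‖st.2 i - st.1.1‖ ^ 2

omit [MeasurableSpace Z] in
-- A refreshed client is at distance `‖w‖` from the new model. For the others, Young with weight `q
-- / 2` gives the factor `1 + 2 / q` on `‖w‖²`, at most `3 / q` since `q ≤ 1`.
lemma staleness_augRound_le (hM : 1 ≤ M) (hq : 0 < q) (hq1 : q ≤ 1) (st : AugState d M)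
    (r : RoundChoice Z M b K b') {w : Vec d} (hw : (round f ηl ηs st.1 r).1 = st.1.1 - w) :
    staleness (augRound f ηl ηs st r)
      ≤ (1 + q / 2) * keptStaleness st (r.1, r.2.1) + 3 / q * ‖w‖ ^ 2 := by
  have hM0 : (0 : ℝ) < M := by exact_mod_cast hM
  have h1 : ∀ i, ‖(augRound f ηl ηs st r).2 i - (augRound f ηl ηs st r).1.1‖ ^ 2
      ≤ (1 + q / 2) * (if i ∈ anchors (r.1, r.2.1) then 0 else ‖st.2 i - st.1.1‖ ^ 2)
        + 3 / q * ‖w‖ ^ 2 := by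
    intro i
    have h3 : 1 ≤ 1 / q := by rw [le_div_iff₀ hq]; linarith
    have e3 : 3 / q = 3 * (1 / q) := by ring
    have hw2 := sq_nonneg ‖w‖
    simp only [augRound, hw]
    split_ifs with hi
    · rw [sub_sub_cancel, e3]
      nlinarith
    · have e : st.2 i - (st.1.1 - w) = (st.2 i - st.1.1) + w := by abel
      rw [e]
      have h4 : ‖(st.2 i - st.1.1) + w‖ ^ 2 ≤ (‖st.2 i - st.1.1‖ + ‖w‖) ^ 2 :=
        pow_le_pow_left₀ (norm_nonneg _) (norm_add_le _ _) 2
      set y := ‖st.2 i - st.1.1‖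
      have h5 : 0 ≤ 1 / (2 * q) * (q * y - 2 * ‖w‖) ^ 2 := by positivity
      have e5 : 1 / (2 * q) * (q * y - 2 * ‖w‖) ^ 2
          = q / 2 * y ^ 2 - 2 * y * ‖w‖ + 2 * (1 / q) * ‖w‖ ^ 2 := by field_simp; ring
      rw [e3]
      nlinarith
  unfold staleness keptStaleness
  calc _ ≤ (M : ℝ)⁻¹ * ∑ i, ((1 + q / 2) * (if i ∈ anchors (r.1, r.2.1) then 0
        else ‖st.2 i - st.1.1‖ ^ 2) + 3 / q * ‖w‖ ^ 2) := by
        gcongr with i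
        exact h1 i
    _ = _ := by
        rw [Finset.sum_add_distrib, ← Finset.mul_sum]
        simp
        field_simp

/-- Convexity carries the bounds of a single miner over to the average over miners; no independence
between clients is used. -/
lemma lintegral_meanDirection_le (h : ∀ i, RegularClient (f i) (D i) L σ Lσ)
    (hL : 0 < L) (hLσ : 0 ≤ Lσ) (hb : 1 ≤ b')
    (hbD : ∀ i, (b' : ℕ∞) ≤ (D i).size) (hK : 1 ≤ K) (ha : 0 ≤ a) (haa : a ^ 2 = 1 / 24)
    (hη : ηl * (K * L) = a) (hηl : 0 ≤ ηl) (hLK : Lσ ^ 2 / b' ≤ K * L ^ 2 / 2) (x g : Vec d)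
    {m : Finset (Fin M)} (hm : m.Nonempty) :
    ∫⁻ B, ‖meanDirection f ηl m B x g‖ₑ ^ 2
        ∂(Measure.pi fun i : Fin M => Measure.pi fun _ : Fin K => (D i).batchLaw b')
        ≤ ENNReal.ofReal (1.7 * ‖g‖ ^ 2) ∧
      ∫⁻ B, ‖meanDirection f ηl m B x g - g‖ₑ ^ 2
        ∂(Measure.pi fun i : Fin M => Measure.pi fun _ : Fin K => (D i).batchLaw b')
        ≤ ENNReal.ofReal (0.19 * ‖g‖ ^ 2) := by
  have hP := fun i => (D i).isProbabilityMeasure_batchLaw (hbD i)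
  have hm0 : (0 : ℝ) < m.card := by exact_mod_cast hm.card_pos
  have hdir : ∀ i, Measurable fun B : Fin K → Fin b' → Z => minerDirection (f i) ηl B x g := by
    intro i
    have h2 : Measurable fun B : Fin K → Fin b' → Z => (B, x, g) := by fun_prop
    simpa only [Function.comp_def] using
      (measurable_minerDirection (h i).differentiable (h i).measurable ηl).comp h2
  have hdirM : ∀ i, Measurable fun B : Fin M → Fin K → Fin b' → Z =>
      minerDirection (f i) ηl (B i) x g := fun i => (hdir i).comp (measurable_pi_apply i)
  have hbound := fun i => (h i).lintegral_minerDirection_le hL hLσ hb (hbD i) hK ha haa hη hηl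
    hLK x g
  have hev := fun i => measurePreserving_eval
    (fun i : Fin M => Measure.pi fun _ : Fin K => (D i).batchLaw b') i
  have hcard : ∀ c : ℝ, (m.card : ℝ)⁻¹ * ∑ _i ∈ m, c = c := by
    intro c
    rw [Finset.sum_const, nsmul_eq_mul]
    field_simp
  constructor
  · have := lintegral_average_sq_le m (fun i _ => hdirM i) (c := fun _ => 1.7 * ‖g‖ ^ 2)
      (fun _ _ => by positivity) (P := Measure.pi fun i : Fin M => Measure.pi fun _ : Fin K =>
        (D i).batchLaw b') fun i _ => by
          refine Eq.trans_le ?_ (hbound i).1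
          exact (hev i).lintegral_comp ((hdir i).enorm.pow_const 2)
    rwa [hcard] at this
  · have e : ∀ B : Fin M → Fin K → Fin b' → Z, meanDirection f ηl m B x g - g
        = (m.card : ℝ)⁻¹ • ∑ i ∈ m, (minerDirection (f i) ηl (B i) x g - g) := by
      intro B
      rw [Finset.sum_sub_distrib, smul_sub, meanDirection, Finset.sum_const,
        ← Nat.cast_smul_eq_nsmul ℝ, smul_smul, inv_mul_cancel₀ hm0.ne', one_smul]
    simp_rw [e]
    have := lintegral_average_sq_le m (fun i _ => (hdirM i).sub_const g)
      (c := fun _ => 0.19 * ‖g‖ ^ 2)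
      (fun _ _ => by positivity) (P := Measure.pi fun i : Fin M => Measure.pi fun _ : Fin K =>
        (D i).batchLaw b') fun i _ => by
          refine Eq.trans_le ?_ (hbound i).2
          exact (hev i).lintegral_comp (((hdir i).sub_const g).enorm.pow_const 2)
    rwa [hcard] at this

end OneRound

/-! ### Contraction of the Lyapunov function. -/

section Contraction

variable {Z : Type*} [MeasurableSpace Z] {d M A b K b' : ℕ} {p : unitInterval}
  {f : Fin M → Vec d → Z → ℝ} {D : Fin M → LocalData Z}
  {L σ Lσ ηl ηs a η q β μ Fmin ε ν₀ : ℝ}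

/-- The choices of a round in which every participant is an anchor. -/
def noMiner (M : ℕ) : Set (Finset (Fin M) × (Fin M → Bool)) :=
  {c | ∀ i ∈ c.1, c.2 i = true}

-- Once the selection is fixed, all terms in `‖g‖²` cancel when there is a miner. The deviation
-- costs `0.19 / 0.6 ≤ 0.32`, and the smoothness and staleness terms cost `1.7 (1/32 + 18/256) ≤
-- 0.18`; together they use up the available `0.5`.
open Classical in
lemma lintegral_lyapunov_batches_le (h : ∀ i, RegularClient (f i) (D i) L σ Lσ)
    (hS : LSmooth f D L) (hM : 1 ≤ M) (hL : 0 < L) (hLσ : 0 ≤ Lσ)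
    (hb : ∀ i, (b : ℕ∞) ≤ (D i).size) (hb1 : 1 ≤ b') (hbD : ∀ i, (b' : ℕ∞) ≤ (D i).size)
    (hK : 1 ≤ K) (ha : 0 ≤ a) (haa : a ^ 2 = 1 / 24)
    (hηl : ηl * (K * L) = a) (hηl0 : 0 ≤ ηl) (hLK : Lσ ^ 2 / b' ≤ K * L ^ 2 / 2)
    (hη : η = ηs * (ηl * K)) (hη0 : 0 ≤ η) (hq : 0 < q) (hq1 : q ≤ 1) (hβ0 : 0 ≤ β)
    (hLη : L * η ≤ 1 / 16) (hβ : β * (3 / q) * η ≤ 18 / 256)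
    (hmin : ∀ x, Fmin ≤ globalLoss f D x) (st : AugState d M)
    (c : Finset (Fin M) × (Fin M → Bool)) :
    ∫⁻ B, ENNReal.ofReal (lyapunov f D Fmin β (augRound f ηl ηs st (c.1, c.2, B.1, B.2)))
        ∂batchesLaw D b K b'
      ≤ ENNReal.ofReal (globalLoss f D st.1.1 - Fmin
        + (if c ∈ noMiner M then 0 else
            η * (-0.35 * ‖gradient (globalLoss f D) st.1.1‖ ^ 2
              + 0.5 * ‖bullseye st.1.2 - gradient (globalLoss f D) st.1.1‖ ^ 2))
        + β * (1 + q / 2) * keptStaleness st c) := by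
  have hP := fun i => (D i).isProbabilityMeasure_batchLaw (hb i)
  have hP' := fun i => (D i).isProbabilityMeasure_batchLaw (hbD i)
  have hPb : IsProbabilityMeasure (batchesLaw D b K b') := by unfold batchesLaw; infer_instance
  set x := st.1.1 with hx
  set g := bullseye st.1.2 with hg
  set m := c.1.filter (fun i => c.2 i = false) with hm
  have hround : ∀ B : (Fin M → Fin b → Z) × (Fin M → Fin K → Fin b' → Z),
      (round f ηl ηs st.1 (c.1, c.2, B.1, B.2)).1
        = x - η • meanDirection f ηl m B.2 x g := by
    intro B
    rw [round_fst, ← hη]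
    rfl
  have hstale : ∀ B : (Fin M → Fin b → Z) × (Fin M → Fin K → Fin b' → Z),
      staleness (augRound f ηl ηs st (c.1, c.2, B.1, B.2))
        ≤ (1 + q / 2) * keptStaleness st c
          + 3 / q * η ^ 2 * ‖meanDirection f ηl m B.2 x g‖ ^ 2 := by
    intro B
    refine (staleness_augRound_le hM hq hq1 st _ (hround B)).trans_eq ?_
    rw [norm_smul, Real.norm_of_nonneg hη0]
    ring
  have hloss : ∀ B : (Fin M → Fin b → Z) × (Fin M → Fin K → Fin b' → Z),
      globalLoss f D (augRound f ηl ηs st (c.1, c.2, B.1, B.2)).1.1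
        = globalLoss f D (x - η • meanDirection f ηl m B.2 x g) := by
    intro B
    rw [← hround B]
    rfl
  by_cases hc : c ∈ noMiner M
  · rw [if_pos hc, add_zero]
    have hm0 : m = ∅ := by
      rw [hm, Finset.filter_eq_empty_iff]
      intro i hi
      simp [hc i hi]
    have h0 : ∀ B : Fin M → Fin K → Fin b' → Z, meanDirection f ηl m B x g = 0 := by
      intro B
      simp [hm0, meanDirection]
    calc _ ≤ ∫⁻ _, ENNReal.ofReal (globalLoss f D x - Fmin
          + β * (1 + q / 2) * keptStaleness st c) ∂batchesLaw D b K b' := by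
          refine lintegral_mono fun B => ENNReal.ofReal_le_ofReal ?_
          have h1 := mul_le_mul_of_nonneg_left (hstale B) hβ0
          unfold lyapunov
          rw [hloss B]
          rw [h0] at h1 ⊢
          simp only [smul_zero, sub_zero, norm_zero] at h1 ⊢
          nlinarith
      _ = _ := by rw [lintegral_const, measure_univ, mul_one]
  · rw [if_neg hc]
    have hmne : m.Nonempty := by
      rw [Finset.nonempty_iff_ne_empty]
      intro hm0
      refine hc fun i hi => ?_
      rw [hm, Finset.filter_eq_empty_iff] at hm0
      simpa using hm0 hi
    obtain ⟨hI₂, hI₁⟩ := lintegral_meanDirection_le h hL hLσ hb1 hbD hK ha haa hηl hηl0 hLK x g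
      hmne
    have hdir : Measurable fun B : Fin M → Fin K → Fin b' → Z => meanDirection f ηl m B x g := by
      have h1 : ∀ i, Measurable fun B : Fin M → Fin K → Fin b' → Z =>
          minerDirection (f i) ηl (B i) x g := by
        intro i
        have h2 : Measurable fun B : Fin M → Fin K → Fin b' → Z => (B i, x, g) := by fun_prop
        simpa only [Function.comp_def] using
          (measurable_minerDirection (h i).differentiable (h i).measurable ηl).comp h2
      unfold meanDirection
      fun_prop
    have hsnd := measurePreserving_snd (μ := Measure.pi fun i : Fin M => (D i).batchLaw b)
      (ν := Measure.pi fun i : Fin M => Measure.pi fun _ : Fin K => (D i).batchLaw b')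
    have hI₁' := (hsnd.lintegral_comp ((hdir.sub_const g).enorm.pow_const 2)).trans_le hI₁
    have hI₂' := (hsnd.lintegral_comp (hdir.enorm.pow_const 2)).trans_le hI₂
    set N := ‖gradient (globalLoss f D) x‖ ^ 2 with hN
    set e := ‖g - gradient (globalLoss f D) x‖ ^ 2 with he
    set k := keptStaleness st c with hk
    refine (lintegral_ofReal_affine_le ((hdir.sub_const g).comp measurable_snd)
      (hdir.comp measurable_snd)
      (c₀ := globalLoss f D x - Fmin + η * (-0.35 * N - 0.5 * ‖g‖ ^ 2 + 0.5 * e)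
        + β * (1 + q / 2) * k)
      (c₁ := η / 0.6) (c₂ := L / 2 * η ^ 2 + β * (3 / q) * η ^ 2)
      (by positivity) (by positivity) (by positivity) (by positivity) hI₁' hI₂'
      (fun B => lyapunov_nonneg hmin hβ0 _) fun B => ?_).trans
        (ENNReal.ofReal_le_ofReal ?_)
    · have h1 := mul_le_mul_of_nonneg_left (hstale B) hβ0
      have h2 := globalLoss_step_le hS hM hη0 x g (meanDirection f ηl m B.2 x g)
      unfold lyapunov
      rw [hloss B]
      simp only [Function.comp_apply]
      nlinarith
    · have h1 : (L / 2 * η ^ 2 + β * (3 / q) * η ^ 2) * (1.7 * ‖g‖ ^ 2)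
          ≤ η * (0.18 * ‖g‖ ^ 2) := by
        have : (L / 2 * η ^ 2 + β * (3 / q) * η ^ 2) * (1.7 * ‖g‖ ^ 2)
            = η * ((1.7 * ((L * η) / 2 + β * (3 / q) * η)) * ‖g‖ ^ 2) := by ring
        rw [this]
        gcongr
        linarith
      have h2 : η / 0.6 * (0.19 * ‖g‖ ^ 2) ≤ η * (0.32 * ‖g‖ ^ 2) := by
        have : η / 0.6 * (0.19 * ‖g‖ ^ 2) = η * (0.19 / 0.6 * ‖g‖ ^ 2) := by ring
        rw [this]
        gcongr
        norm_num
      linarith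

-- Having a miner and refreshing a cache are dependent events, but the bound is additive in them, so
-- only their marginal probabilities enter.
open Classical in
lemma integral_selection_bound (hA1 : 1 ≤ A) (hA : A ≤ M) (X Y c : ℝ)
    (st : AugState d M) :
    ∫ s, (X + (if s ∈ noMiner M then 0 else Y) + c * keptStaleness st s) ∂selectionLaw M A p
      = X + (1 - (p : ℝ) ^ A) * Y + c * ((1 - A / M * p) * staleness st) := by
  have hP := isProbabilityMeasure_selectionLaw (p := p) hA
  have hkept : ∫ s, keptStaleness st s ∂selectionLaw M A p
      = (1 - A / M * p) * staleness st := by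
    unfold keptStaleness staleness
    have h1 : ∀ i, ∫ s, (if i ∈ anchors s then 0 else ‖st.2 i - st.1.1‖ ^ 2)
        ∂selectionLaw M A p = (1 - A / M * p) * ‖st.2 i - st.1.1‖ ^ 2 := by
      intro i
      have h1 := integral_ite_zero_const (P := selectionLaw M A p)
        (s := {c | i ∈ c.1 ∧ c.2 i = true}) (Set.toFinite _).measurableSet
        (‖st.2 i - st.1.1‖ ^ 2)
      rw [selectionLaw_anchor hA1 hA] at h1
      rw [← h1]
      refine integral_congr_ae (.of_forall fun s => ?_)
      simp [mem_anchors]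
    rw [integral_const_mul, integral_finsetSum Finset.univ (fun i _ => Integrable.of_finite)]
    simp_rw [h1]
    rw [← Finset.mul_sum]
    ring
  have h2 := integral_ite_zero_const (P := selectionLaw M A p) (s := noMiner M)
    (Set.toFinite _).measurableSet Y
  have h3 : (selectionLaw M A p).real (noMiner M) = (p : ℝ) ^ A := selectionLaw_no_miner hA
  rw [h3] at h2
  rw [integral_add .of_finite .of_finite, integral_add .of_finite .of_finite, h2,
    integral_const_mul, hkept]
  simp

lemma keptStaleness_nonneg (st : AugState d M) (c : Finset (Fin M) × (Fin M → Bool)) :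
    0 ≤ keptStaleness st c := by
  unfold keptStaleness
  refine mul_nonneg (by positivity) (Finset.sum_nonneg fun i _ => ?_)
  split_ifs <;> positivity

/-- Keeps the upper bound nonnegative, so that its expectation can be computed as an ordinary
integral. -/
lemma descent_nonneg {X N e : ℝ} (hη0 : 0 ≤ η) (hLη : L * η ≤ 1 / 16) (hX0 : 0 ≤ X)
    (he0 : 0 ≤ e) (hNX : N ≤ 2 * L * X) : 0 ≤ X + η * (-0.35 * N + 0.5 * e) := by
  have h1 : η * N ≤ η * (2 * L * X) := by gcongr
  have h2 : L * η * X ≤ 1 / 16 * X := by gcongr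
  have h3 : 0 ≤ η * e := by positivity
  nlinarith

/-- The staleness balance in units of `β q s`: refreshing gains `1/2`, the error of the bullseye
takes `2.5/6`, and the required contraction takes at most `0.7/16`, less than the remaining `1/12`.
The gap contracts through the PL condition, and `0.625` is half of `1.25`. -/
lemma lyapunov_contraction {P X N e W s : ℝ} (hP0 : 0 ≤ P) (hP1 : P ≤ 1) (hη0 : 0 ≤ η)
    (hq : 0 < q) (hLη : L * η ≤ q / 16) (hμ : 0 < μ) (hμL : μ ≤ L) (hs0 : 0 ≤ s)
    (hXN : 2 * μ * X ≤ N) (hE : e ≤ 1.25 * W + 5 * L ^ 2 * s)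
    (hβ : β = 6 * P * η * L ^ 2 / q) :
    X + P * (η * (-0.35 * N + 0.5 * e)) + β * (1 + q / 2) * ((1 - q) * s)
      ≤ (1 - 0.7 * P * η * μ) * (X + β * s) + 0.625 * P * η * W := by
  have hβ0 : 0 ≤ β := by rw [hβ]; positivity
  have h1 : P * (η * (-0.35 * N + 0.5 * e))
      ≤ P * (η * (-0.7 * μ * X + 0.625 * W + 2.5 * L ^ 2 * s)) := by
    exact mul_le_mul_of_nonneg_left (mul_le_mul_of_nonneg_left (by linarith) hη0) hP0
  have h2 : P * η * L ^ 2 = β * q / 6 := by rw [hβ]; field_simp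
  have h3 : (1 + q / 2) * (1 - q) ≤ 1 - q / 2 := by nlinarith
  have h4 : β * (1 + q / 2) * ((1 - q) * s) ≤ β * s * (1 - q / 2) := by
    have := mul_le_mul_of_nonneg_left h3 (mul_nonneg hβ0 hs0)
    linarith
  have h5 : 0.7 * P * η * μ ≤ 0.7 * q / 16 := by
    have h6 : η * μ ≤ q / 16 := by
      calc η * μ ≤ η * L := by gcongr
        _ ≤ _ := by linarith
    have h7 : P * (η * μ) ≤ 1 * (q / 16) := by gcongr
    linarith
  have h6 : β * s * (0.7 * P * η * μ) ≤ β * s * (0.7 * q / 16) := by gcongr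
  have h8 : P * (η * (2.5 * L ^ 2 * s)) = 2.5 / 6 * (β * s * q) := by
    linear_combination 2.5 * s * h2
  have h9 : 0 ≤ β * s * q := by positivity
  linarith

set_option maxHeartbeats 600000 in
/-- The expected decrease of the Lyapunov function in one round. -/
lemma lintegral_lyapunov_round_le (h : ∀ i, RegularClient (f i) (D i) L σ Lσ)
    (hS : LSmooth f D L) (hA1 : 1 ≤ A) (hA : A ≤ M) (hL : 0 < L) (hLσ : 0 ≤ Lσ)
    (hb : ∀ i, (b : ℕ∞) ≤ (D i).size) (hb1 : 1 ≤ b') (hbD : ∀ i, (b' : ℕ∞) ≤ (D i).size)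
    (hK : 1 ≤ K) (ha : 0 ≤ a) (haa : a ^ 2 = 1 / 24)
    (hηl : ηl * (K * L) = a) (hηl0 : 0 ≤ ηl) (hLK : Lσ ^ 2 / b' ≤ K * L ^ 2 / 2)
    (hη : η = ηs * (ηl * K)) (hη0 : 0 < η) (hp0 : 0 < (p : ℝ)) (hp1 : (p : ℝ) < 1)
    (hqdef : q = A / M * p) (hLη : L * η ≤ q / 16) (hμ : 0 < μ) (hμL : μ ≤ L)
    (hPL : PLCondition (globalLoss f D) Fmin μ)
    (hβ : β = 6 * (1 - (p : ℝ) ^ A) * η * L ^ 2 / q)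
    (hmin : ∀ x, Fmin ≤ globalLoss f D x) (st : AugState d M) :
    ∫⁻ r, ENNReal.ofReal (lyapunov f D Fmin β (augRound f ηl ηs st r)) ∂roundLaw D A b K b' p
      ≤ ENNReal.ofReal ((1 - 0.7 * (1 - (p : ℝ) ^ A) * η * μ) * lyapunov f D Fmin β st
          + 0.625 * (1 - (p : ℝ) ^ A) * η * noiseEnergy f D st) := by
  classical
  have hM : 1 ≤ M := hA1.trans hA
  have hM0 : (0 : ℝ) < M := by exact_mod_cast hM
  have hA0 : (0 : ℝ) < A := by exact_mod_cast hA1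
  have hP := isProbabilityMeasure_selectionLaw (p := p) hA
  have hAM : (A : ℝ) / M ≤ 1 := by rw [div_le_one hM0]; exact_mod_cast hA
  have hq : 0 < q := by rw [hqdef]; positivity
  have hq1 : q ≤ 1 := by
    rw [hqdef]; exact mul_le_one₀ hAM hp0.le hp1.le
  have hpA0 : 0 ≤ (p : ℝ) ^ A := by positivity
  have hpA1 : (p : ℝ) ^ A < 1 := pow_lt_one₀ hp0.le hp1 (by omega)
  set P := 1 - (p : ℝ) ^ A with hPdef
  have hP0 : 0 < P := by rw [hPdef]; linarith
  have hP1 : P ≤ 1 := by rw [hPdef]; linarith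
  have hβ0 : 0 ≤ β := by rw [hβ]; positivity
  have hβη : β * (3 / q) * η ≤ 18 / 256 := by
    -- With `L η ≤ q / 16`, the staleness created by the move is charged at most `18 / 16²`,
    -- independently of `q`.
    have e : β * (3 / q) * η = 18 * P * (L * η / q) ^ 2 := by rw [hβ]; field_simp; ring
    have h1 : L * η / q ≤ 1 / 16 := by rw [div_le_iff₀ hq]; linarith
    have h2 : (L * η / q) ^ 2 ≤ (1 / 16) ^ 2 := pow_le_pow_left₀ (by positivity) h1 2
    rw [e]
    calc 18 * P * (L * η / q) ^ 2 ≤ 18 * 1 * (1 / 16) ^ 2 := by gcongr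
      _ = _ := by norm_num
  have hLη1 : L * η ≤ 1 / 16 := by linarith
  have hmeas : Measurable fun r : RoundChoice Z M b K b' =>
      ENNReal.ofReal (lyapunov f D Fmin β (augRound f ηl ηs st r)) := by
    have hr : Measurable fun r : RoundChoice Z M b K b' => augRound f ηl ηs st r :=
      (measurable_augRound (fun i => (h i).differentiable) (fun i => (h i).measurable) ηl ηs).comp
        measurable_prodMk_left
    exact (hS.measurable_lyapunov.comp hr).ennreal_ofReal
  rw [lintegral_roundLaw hA hb hbD hmeas]
  refine (lintegral_mono fun c => lintegral_lyapunov_batches_le h hS hM hL hLσ hb hb1 hbD hK ha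
    haa hηl hηl0 hLK hη hη0.le hq hq1 hβ0 hLη1 hβη hmin st c).trans ?_
  set X := globalLoss f D st.1.1 - Fmin with hX
  set N := ‖gradient (globalLoss f D) st.1.1‖ ^ 2 with hN
  set e := ‖bullseye st.1.2 - gradient (globalLoss f D) st.1.1‖ ^ 2 with he
  have hX0 : 0 ≤ X := sub_nonneg.2 (hmin _)
  have hN0 : 0 ≤ N := by positivity
  have he0 : 0 ≤ e := by positivity
  have hstep : 0 ≤ X + η * (-0.35 * N + 0.5 * e) :=
    descent_nonneg hη0.le hLη1 hX0 he0 (norm_gradient_sq_le hS.differentiable_globalLoss hL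
      (hS.gradient_globalLoss_lipschitz hM) hmin _)
  rw [← ofReal_integral_eq_lintegral_ofReal .of_finite (.of_forall fun c => ?_)]
  · refine ENNReal.ofReal_le_ofReal ?_
    rw [integral_selection_bound hA1 hA, ← hqdef, ← hPdef]
    have hE := norm_bullseye_sub_gradient_sq_le hS st
    rw [← he] at hE
    exact lyapunov_contraction hP0.le hP1 hη0.le hq hLη hμ hμL (staleness_nonneg st) (hPL _) hE hβ
  · have : 0 ≤ β * (1 + q / 2) * keptStaleness st c :=
      mul_nonneg (by positivity) (keptStaleness_nonneg st c)
    simp only [Pi.zero_apply]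
    split_ifs <;> linarith

/-- Iterates the contraction of one round. The constant `0.893` exceeds `0.625 / 0.7`, so the noise
level `0.893 ε` is preserved; initially every cached gradient is fresh and the staleness vanishes.
-/
lemma lintegral_lyapunov_run_le (h : ∀ i, RegularClient (f i) (D i) L σ Lσ)
    (hS : LSmooth f D L) (hA1 : 1 ≤ A) (hA : A ≤ M) (hL : 0 < L) (hLσ : 0 ≤ Lσ)
    (hbpos : 1 ≤ b)
    (hb : ∀ i, (b : ℕ∞) ≤ (D i).size) (hb1 : 1 ≤ b') (hbD : ∀ i, (b' : ℕ∞) ≤ (D i).size)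
    (hK : 1 ≤ K) (ha : 0 ≤ a) (haa : a ^ 2 = 1 / 24)
    (hηl : ηl * (K * L) = a) (hηl0 : 0 ≤ ηl) (hLK : Lσ ^ 2 / b' ≤ K * L ^ 2 / 2)
    (hη : η = ηs * (ηl * K)) (hη0 : 0 < η) (hp0 : 0 < (p : ℝ)) (hp1 : (p : ℝ) < 1)
    (hLη : L * η ≤ A / M * p / 16) (hμ : 0 < μ) (hμL : μ ≤ L)
    (hPL : PLCondition (globalLoss f D) Fmin μ)
    (hβ : β = 6 * (1 - (p : ℝ) ^ A) * η * L ^ 2 / (A / M * p))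
    (hmin : ∀ x, Fmin ≤ globalLoss f D x) (hε : 0 ≤ ε)
    (hν : ∀ i v, ∫⁻ B, ‖batchGrad (f i) B v - gradient (localLoss (f i) (D i)) v‖ₑ ^ 2
      ∂(D i).batchLaw b ≤ ENNReal.ofReal (M * μ * ε)) (x₀ : Vec d) (t : ℕ) :
    ∫⁻ ω, ENNReal.ofReal (lyapunov f D Fmin β (augRun f ηl ηs x₀ ω t)) ∂runLaw D A b K b' p
      ≤ ENNReal.ofReal ((1 - 0.7 * (1 - (p : ℝ) ^ A) * η * μ) ^ t
          * (globalLoss f D x₀ - Fmin) + 0.893 * ε) := by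
  have hM0 : (0 : ℝ) < M := by exact_mod_cast hA1.trans hA
  have hP := fun i => (D i).isProbabilityMeasure_batchLaw (hb i)
  have hR := isProbabilityMeasure_roundLaw (K := K) (p := p) hA hb hbD
  have hrun := isProbabilityMeasure_runLaw (K := K) (p := p) hA hb hbD
  have hchain := fun (t : ℕ) (φ : AugState d M → ℝ≥0∞) (hφ : Measurable φ) =>
    lintegral_chain_succ (Measure.pi fun i : Fin M => (D i).batchLaw b)
    (roundLaw D A b K b' p)
    (measurable_augInit (fun i => (h i).differentiable) (fun i => (h i).measurable) x₀)
    (measurable_augRound (fun i => (h i).differentiable) (fun i => (h i).measurable) ηl ηs)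
    (X := augRun f ηl ηs x₀) (fun _ => rfl) (fun _ _ => rfl) t hφ
  have hX0 : 0 ≤ globalLoss f D x₀ - Fmin := sub_nonneg.2 (hmin _)
  have hpA0 : 0 ≤ (p : ℝ) ^ A := by positivity
  have hpA1 : (p : ℝ) ^ A < 1 := pow_lt_one₀ hp0.le hp1 (by omega)
  have hP0 : 0 < 1 - (p : ℝ) ^ A := by linarith
  have hβ0 : 0 ≤ β := by rw [hβ]; positivity
  have hρ1 : 0.7 * (1 - (p : ℝ) ^ A) * η * μ ≤ 1 := by
    have h1 : (A : ℝ) / M * p ≤ 1 := by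
      refine mul_le_one₀ ?_ hp0.le hp1.le
      rw [div_le_one hM0]; exact_mod_cast hA
    have h2 : η * μ ≤ 1 / 16 := by
      calc η * μ ≤ η * L := by gcongr
        _ ≤ _ := by linarith
    have h3 : (1 - (p : ℝ) ^ A) * (η * μ) ≤ 1 * (1 / 16) := by gcongr; linarith
    linarith
  set P := 1 - (p : ℝ) ^ A with hPdef
  set ρ := 0.7 * P * η * μ with hρ
  have hW : ∀ t, ∫⁻ ω, ENNReal.ofReal (noiseEnergy f D (augRun f ηl ηs x₀ ω t))
      ∂runLaw D A b K b' p ≤ ENNReal.ofReal (μ * ε) := by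
    intro t
    have h1 := lintegral_noise_augRun_le (ηl := ηl) (ηs := ηs) (K := K) (p := p) h hS hL.le hLσ hA
      hbpos hb hbD hν x₀ t Finset.univ
    have e : ∀ st : AugState d M, ENNReal.ofReal (noiseEnergy f D st)
        = ENNReal.ofReal ((M : ℝ)⁻¹ ^ 2) * ‖∑ i, noise f D st i‖ₑ ^ 2 := by
      intro st
      rw [enorm_sq_eq_ofReal, ← ENNReal.ofReal_mul (by positivity), noiseEnergy, norm_smul,
        mul_pow, Real.norm_of_nonneg (by positivity)]
    simp_rw [e]
    rw [lintegral_const_mul' _ _ ENNReal.ofReal_ne_top]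
    -- Averaging uncorrelated noise gives `M⁻² * M * (M μ ε) = μ ε`.
    refine (mul_le_mul_right h1 _).trans (le_of_eq ?_)
    rw [Finset.card_univ, Fintype.card_fin, ← ENNReal.ofReal_natCast,
      ← ENNReal.ofReal_mul (by positivity), ← ENNReal.ofReal_mul (by positivity)]
    congr 1
    field_simp
  induction t with
  | zero =>
    have e : ∀ ω : RunChoice Z M b K b', lyapunov f D Fmin β (augRun f ηl ηs x₀ ω 0)
        = globalLoss f D x₀ - Fmin := by
      intro ω
      simp [lyapunov, augRun, augInit, staleness]
    simp_rw [e]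
    rw [lintegral_const, measure_univ, mul_one]
    refine ENNReal.ofReal_le_ofReal ?_
    rw [pow_zero, one_mul]
    linarith
  | succ t ih =>
    have hlm : Measurable fun st : AugState d M =>
        ENNReal.ofReal (lyapunov f D Fmin β st) := hS.measurable_lyapunov.ennreal_ofReal
    unfold runLaw at ih hW ⊢
    rw [hchain t _ hlm]
    have hW0 : ∀ st : AugState d M, 0 ≤ noiseEnergy f D st := fun st => by
      unfold noiseEnergy; positivity
    calc _ ≤ ∫⁻ ω, (ENNReal.ofReal (1 - ρ)
            * ENNReal.ofReal (lyapunov f D Fmin β (augRun f ηl ηs x₀ ω t))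
            + ENNReal.ofReal (0.625 * P * η)
              * ENNReal.ofReal (noiseEnergy f D (augRun f ηl ηs x₀ ω t)))
            ∂(Measure.pi fun i : Fin M => (D i).batchLaw b).prod
              (Measure.infinitePi fun _ : ℕ => roundLaw D A b K b' p) := by
          refine lintegral_mono fun ω => ?_
          refine (lintegral_lyapunov_round_le h hS hA1 hA hL hLσ hb hb1 hbD hK ha haa hηl hηl0 hLK
            hη hη0 hp0 hp1 rfl hLη hμ hμL hPL hβ hmin _).trans (le_of_eq ?_)
          rw [← ENNReal.ofReal_mul (by linarith), ← ENNReal.ofReal_mul (by positivity),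
            ← ENNReal.ofReal_add]
          · exact mul_nonneg (by linarith) (lyapunov_nonneg hmin hβ0 _)
          · exact mul_nonneg (by positivity) (hW0 _)
      _ ≤ ENNReal.ofReal (1 - ρ) * ENNReal.ofReal ((1 - ρ) ^ t
            * (globalLoss f D x₀ - Fmin) + 0.893 * ε)
          + ENNReal.ofReal (0.625 * P * η) * ENNReal.ofReal (μ * ε) := by
          rw [lintegral_add_left, lintegral_const_mul' _ _ ENNReal.ofReal_ne_top,
            lintegral_const_mul' _ _ ENNReal.ofReal_ne_top]
          · gcongr
            exact hW t
          · exact (hlm.comp (measurable_augRun (b := b) (K := K) (b' := b') (fun i => (h i).differentiable)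
              (fun i => (h i).measurable) ηl ηs x₀ t)).const_mul _
      _ ≤ _ := by
          have h1 : 0 ≤ (1 - ρ) ^ t * (globalLoss f D x₀ - Fmin) :=
            mul_nonneg (pow_nonneg (by linarith) t) hX0
          rw [← ENNReal.ofReal_mul (by linarith), ← ENNReal.ofReal_mul (by positivity),
            ← ENNReal.ofReal_add (mul_nonneg (by linarith) (by positivity)) (by positivity)]
          refine ENNReal.ofReal_le_ofReal ?_
          have h2 : 0.625 * P * η * (μ * ε) ≤ ρ * (0.893 * ε) := by
            have : 0 ≤ P * η * μ * ε := by positivity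
            rw [hρ]
            nlinarith
          rw [pow_succ]
          nlinarith

end Contraction

/-! ### Step size and number of rounds. -/

section Arithmetic

/-- The bounds serve, in order, the contraction, the condition `ρ ≤ 1`, and the rate. For the rate,
whichever term attains the minimum, its reciprocal is dominated by the bracket times `1 + L + 16
L²`. -/
lemma stepSize_bounds {A M p P μ L η : ℝ} (hA : 0 < A) (hM : 0 < M) (hp : 0 < p) (hP : 0 < P)
    (hμ : 0 < μ) (hL : 0 < L) (hμL : μ ≤ L)
    (hη : η = min (A * p / (M * μ * P)) (1 / (L * (1 + 16 * M * L / (μ * A * p))))) :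
    L * η ≤ A / M * p / 16 ∧ η * (M * μ * P) ≤ A * p ∧
      1 ≤ η * ((1 + M / (μ * A * p) + M * μ * P / (A * p)) * (1 + L + 16 * L ^ 2)) := by
  refine ⟨?_, ?_, ?_⟩
  · have h1 : η ≤ 1 / (L * (1 + 16 * M * L / (μ * A * p))) := hη.le.trans (min_le_right _ _)
    have h2 : 1 / (L * (1 + 16 * M * L / (μ * A * p))) ≤ 1 / (L * (16 * M / (A * p))) := by
      refine one_div_le_one_div_of_le (by positivity) ?_
      refine mul_le_mul_of_nonneg_left ?_ hL.le
      have h3 : 16 * M / (A * p) ≤ 16 * M * L / (μ * A * p) := by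
        rw [div_le_div_iff₀ (by positivity) (by positivity)]
        have h4 := mul_le_mul_of_nonneg_left hμL (by positivity : 0 ≤ 16 * M * A * p)
        linarith
      linarith
    calc L * η ≤ L * (1 / (L * (16 * M / (A * p)))) := by gcongr; exact h1.trans h2
      _ = _ := by field_simp
  · have h1 : η ≤ A * p / (M * μ * P) := hη.le.trans (min_le_left _ _)
    rwa [le_div_iff₀ (by positivity)] at h1
  · set s := M / (μ * A * p) with hs
    have hs0 : 0 < s := by positivity
    have hc : 1 ≤ 1 + L + 16 * L ^ 2 := by
      have := sq_nonneg L
      linarith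
    rcases min_choice (A * p / (M * μ * P)) (1 / (L * (1 + 16 * M * L / (μ * A * p)))) with
      hmc | hmc
    · rw [hη, hmc]
      calc (1 : ℝ) = A * p / (M * μ * P) * (M * μ * P / (A * p) * 1) := by field_simp
        _ ≤ _ := by gcongr; linarith
    · rw [hη, hmc]
      have e : L + 16 * L ^ 2 * s = L * (1 + 16 * M * L / (μ * A * p)) := by
        rw [hs]; field_simp
      calc (1 : ℝ) = 1 / (L * (1 + 16 * M * L / (μ * A * p))) * (L + 16 * L ^ 2 * s) := by
            rw [e]; field_simp
        _ ≤ 1 / (L * (1 + 16 * M * L / (μ * A * p))) * ((1 + s) * (1 + L + 16 * L ^ 2)) := by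
            gcongr
            have := mul_pos hs0 hL
            have := sq_nonneg L
            nlinarith
        _ ≤ _ := by
            have : 0 ≤ M * μ * P / (A * p) := by positivity
            exact mul_le_mul_of_nonneg_left (mul_le_mul_of_nonneg_right (by linarith)
              (by positivity)) (by positivity)

lemma geometric_decay_le {ρ X Δ ε : ℝ} {T : ℕ} (hρ : ρ ≤ 1) (hX : 0 ≤ X) (hΔ : 0 < Δ)
    (hXΔ : X ≤ Δ) (hε : 0 < ε) (hT : Real.log (10 * Δ) + Real.log (1 / ε) ≤ ρ * T) :
    (1 - ρ) ^ T * X ≤ ε / 10 := by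
  have h1 : (1 - ρ) ^ T ≤ Real.exp (-(ρ * T)) := by
    calc (1 - ρ) ^ T ≤ Real.exp (-ρ) ^ T :=
          pow_le_pow_left₀ (by linarith) (Real.one_sub_le_exp_neg ρ) T
      _ = _ := by rw [← Real.exp_nat_mul]; congr 1; ring
  have h2 : Real.exp (-(ρ * T)) ≤ ε / (10 * Δ) := by
    calc Real.exp (-(ρ * T)) ≤ Real.exp (-(Real.log (10 * Δ) + Real.log (1 / ε))) :=
          Real.exp_le_exp.2 (neg_le_neg hT)
      _ = _ := by
          rw [Real.exp_neg, Real.exp_add, Real.exp_log (by positivity),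
            Real.exp_log (by positivity)]
          field_simp
  calc (1 - ρ) ^ T * X ≤ ε / (10 * Δ) * Δ := by
        gcongr
        exact h1.trans h2
    _ = _ := by field_simp

end Arithmetic

end FedAMD

/-! ### The main theorem. -/

theorem theorem4 :
    -- the constant in `O(·)` depends only on `L` and (a bound on) `F(x₀) - F_*`
    ∀ (L Δ : ℝ), 0 < L → ∃ C : ℝ, 0 < C ∧
      ∀ {Z : Type*} [MeasurableSpace Z] (d M A K b b' : ℕ) (n : ℕ∞)
        (f : Fin M → FedAMD.Vec d → Z → ℝ) (D : Fin M → FedAMD.LocalData Z)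
        (σ Lσ μ Fmin ε ηl ηs : ℝ) (p : unitInterval) (x₀ : FedAMD.Vec d),
        1 ≤ A → A ≤ M →
        (∀ i, (D i).size = n) →
        FedAMD.RegularLoss f D →
        FedAMD.LSmooth f D L →
        0 ≤ σ → FedAMD.BoundedNoise f D σ →
        0 ≤ Lσ → FedAMD.AverageSmooth f D Lσ →
        IsGLB (Set.range (FedAMD.globalLoss f D)) Fmin →
        0 < μ → FedAMD.PLCondition (FedAMD.globalLoss f D) Fmin μ →
        FedAMD.globalLoss f D x₀ - Fmin ≤ Δ →
        0 < ε → ε ≤ 1 / 2 →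
        0 < (p : ℝ) → (p : ℝ) < 1 →
        max 1 (2 * Lσ ^ 2 / (b' * L ^ 2)) ≤ (K : ℝ) →
        (b : ℕ∞) = min ((⌈σ ^ 2 / (M * μ * ε)⌉₊ : ℕ) : ℕ∞) n →
        1 ≤ b' → b' < b →
        ηl = 1 / (2 * √6 * K * L) →
        ηs = min (2 * √6 * L * A * p / (M * μ * (1 - (p : ℝ) ^ A)))
          (2 * √6 / (1 + 16 * M * L / (μ * A * p))) →
        ∀ T : ℕ,
          C * (1 / (μ * (1 - (p : ℝ) ^ A))
              * (1 + M / (μ * A * p) + M * μ * (1 - (p : ℝ) ^ A) / (A * p))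
              * Real.log (1 / ε)) ≤ (T : ℝ) →
          MeasureTheory.Integrable
              (fun ω => FedAMD.globalLoss f D (FedAMD.model f ηl ηs x₀ ω T))
              (FedAMD.runLaw D A b K b' p) ∧
            ∫ ω, (FedAMD.globalLoss f D (FedAMD.model f ηl ηs x₀ ω T) - Fmin)
              ∂(FedAMD.runLaw D A b K b' p) ≤ ε := by
  intro L Δ hL
  have hlog2 : 0 < Real.log 2 := Real.log_pos one_lt_two
  have hΔ1 : (1 : ℝ) ≤ max Δ 1 := le_max_right _ _
  have hlogΔ : 0 ≤ Real.log (10 * max Δ 1) := Real.log_nonneg (by linarith)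
  -- The last two factors bound `1 / ρ`. The first absorbs `log (10 Δ)` into `log (1 / ε)`, which is
  -- at least `log 2`; `max Δ 1` keeps the logarithm nonnegative for any `Δ`.
  refine ⟨(1 + Real.log (10 * max Δ 1) / Real.log 2) * (1 + L + 16 * L ^ 2) / 0.7,
    by positivity, ?_⟩
  intro Z _ d M A K b b' n f D σ Lσ μ Fmin ε ηl ηs p x₀ hA1 hA hsize hreg hS hσ hnoise hLσ havg
    hglb hμ hPL hΔ hε hε2 hp0 hp1 hKL hb hb1 hbb hηl hηs T hT
  have hM : 1 ≤ M := hA1.trans hA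
  have hM0 : (0 : ℝ) < M := by exact_mod_cast hM
  have hA0 : (0 : ℝ) < A := by exact_mod_cast hA1
  have hbn : (b : ℕ∞) ≤ n := hb.le.trans (min_le_right _ _)
  have hb'n : (b' : ℕ∞) ≤ n := (Nat.cast_le.2 hbb.le).trans hbn
  have hn1 : 1 ≤ n := le_trans (by exact_mod_cast hb1) hb'n
  have hbD : ∀ i, (b : ℕ∞) ≤ (D i).size := fun i => (hsize i).symm ▸ hbn
  have hbD' : ∀ i, (b' : ℕ∞) ≤ (D i).size := fun i => (hsize i).symm ▸ hb'n
  have h : ∀ i, FedAMD.RegularClient (f i) (D i) L σ Lσ := fun i =>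
    ⟨(hsize i).symm ▸ hn1, hreg.1 i, hreg.2.1 i, hreg.2.2 i, (hS i).1, (hS i).2, hnoise i, havg i⟩
  have hmin : ∀ x, Fmin ≤ FedAMD.globalLoss f D x := fun x => hglb.1 ⟨x, rfl⟩
  have hrun := FedAMD.isProbabilityMeasure_runLaw (K := K) (p := p) hA hbD hbD'
  -- A constant objective satisfies PL for every `μ`, so it is treated apart; otherwise PL and its
  -- reverse give `μ ≤ L`.
  by_cases hconst : ∀ x, FedAMD.globalLoss f D x ≤ Fmin
  · have e : ∀ x, FedAMD.globalLoss f D x = Fmin := fun x => le_antisymm (hconst x) (hmin x)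
    simp_rw [e]
    exact ⟨integrable_const _, by simpa using hε.le⟩
  have hμL : μ ≤ L := by
    push Not at hconst
    obtain ⟨x, hx⟩ := hconst
    have h1 := hPL x
    have h2 := FedAMD.norm_gradient_sq_le hS.differentiable_globalLoss hL
      (hS.gradient_globalLoss_lipschitz hM) hmin x
    have h3 : 0 < FedAMD.globalLoss f D x - Fmin := sub_pos.2 hx
    by_contra hlt
    push Not at hlt
    nlinarith [mul_lt_mul_of_pos_right hlt h3]
  have hK1 : (1 : ℝ) ≤ K := (le_max_left _ _).trans hKL
  have hK : 1 ≤ K := by exact_mod_cast hK1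
  have hK0 : (0 : ℝ) < K := by linarith
  have hb0 : (0 : ℝ) < b' := by exact_mod_cast hb1
  have hbpos : (0 : ℝ) < b := by exact_mod_cast (by omega : 0 < b)
  have h6 : (0 : ℝ) < √6 := by positivity
  have h66 : √6 ^ 2 = 6 := Real.sq_sqrt (by norm_num)
  have hpA1 : (p : ℝ) ^ A < 1 := pow_lt_one₀ hp0.le hp1 (by omega)
  have hP0 : 0 < 1 - (p : ℝ) ^ A := by linarith
  set P := 1 - (p : ℝ) ^ A with hP
  have hLK : Lσ ^ 2 / b' ≤ K * L ^ 2 / 2 := by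
    have h1 := (le_max_right _ _).trans hKL
    rw [div_le_iff₀ (by positivity)] at h1
    rw [div_le_iff₀ hb0]
    linarith
  have hν : ∀ i v, ∫⁻ B, ‖FedAMD.batchGrad (f i) B v
      - gradient (FedAMD.localLoss (f i) (D i)) v‖ₑ ^ 2 ∂(D i).batchLaw b
      ≤ ENNReal.ofReal (M * μ * ε) := by
    intro i v
    -- Either the batch is large enough for `σ² / b ≤ M μ ε`, or it is the whole dataset and has no
    -- noise.
    rcases min_choice ((⌈σ ^ 2 / (M * μ * ε)⌉₊ : ℕ) : ℕ∞) n with hmc | hmc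
    · rw [hmc] at hb
      have hbc : b = ⌈σ ^ 2 / (M * μ * ε)⌉₊ := by exact_mod_cast hb
      have h1 : σ ^ 2 / (M * μ * ε) ≤ b := by rw [hbc]; exact Nat.le_ceil _
      refine (hnoise i b (by omega) (hbD i) v).trans (ENNReal.ofReal_le_ofReal ?_)
      rw [div_le_iff₀ (by positivity)] at h1 ⊢
      linarith
    · rw [hmc] at hb
      rw [(h i).lintegral_batchGrad_full (hb.trans (hsize i).symm) v]
      exact zero_le
  have hηl0 : 0 < ηl := by rw [hηl]; positivity
  have hηs0 : 0 < ηs := by rw [hηs]; positivity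
  have ha : ηl * (K * L) = 1 / (2 * √6) := by rw [hηl]; field_simp
  have haa : (1 / (2 * √6)) ^ 2 = 1 / 24 := by rw [div_pow, mul_pow, h66]; norm_num
  set η := ηs * (ηl * K) with hη
  have hη0 : 0 < η := by positivity
  have hηK : ηl * K = 1 / (2 * √6 * L) := by rw [hηl]; field_simp
  -- The factors `K` and `2√6` in the two step sizes cancel.
  have hηmin : η = min ((A : ℝ) * p / (M * μ * P))
      (1 / (L * (1 + 16 * M * L / (μ * A * p)))) := by
    rw [hη, hηK, hηs, min_mul_of_nonneg _ _ (by positivity)]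
    congr 1 <;> field_simp
  obtain ⟨hLη, hηA, hrate⟩ := FedAMD.stepSize_bounds hA0 hM0 hp0 hP0 hμ hL hμL hηmin
  have hlyap := FedAMD.lintegral_lyapunov_run_le h hS hA1 hA hL hLσ (by omega) hbD hb1 hbD' hK
    (by positivity) haa ha hηl0.le hLK hη hη0 hp0 hp1 hLη hμ hμL hPL rfl hmin hε.le hν x₀ T
  rw [← hP] at hlyap
  set X₀ := FedAMD.globalLoss f D x₀ - Fmin with hX₀
  have hX0 : 0 ≤ X₀ := sub_nonneg.2 (hmin _)
  set ρ := 0.7 * P * η * μ with hρ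
  have hρ1 : ρ ≤ 1 := by
    have h3 : (A : ℝ) * p ≤ M * 1 := by
      have : (A : ℝ) ≤ M := by exact_mod_cast hA
      gcongr
    have h4 : M * (η * μ * P) ≤ M * 1 := by linarith
    have := le_of_mul_le_mul_left h4 hM0
    rw [hρ]
    linarith
  have hlogε : Real.log 2 ≤ Real.log (1 / ε) := by
    refine Real.log_le_log (by norm_num) ?_
    rw [le_div_iff₀ hε]; linarith
  have hρT : Real.log (10 * max Δ 1) + Real.log (1 / ε) ≤ ρ * T := by
    set l := Real.log (1 / ε) with hl
    have hl0 : 0 < l := hlog2.trans_le hlogε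
    have h1 : Real.log (10 * max Δ 1) ≤ Real.log (10 * max Δ 1) / Real.log 2 * l := by
      calc _ = Real.log (10 * max Δ 1) / Real.log 2 * Real.log 2 := by field_simp
        _ ≤ _ := by gcongr
    set c₁ := 1 + Real.log (10 * max Δ 1) / Real.log 2 with hc₁
    have hc₁0 : 0 < c₁ := by positivity
    calc Real.log (10 * max Δ 1) + l ≤ c₁ * l * 1 := by rw [hc₁]; linarith
      _ ≤ c₁ * l * (η * ((1 + M / (μ * A * p) + M * μ * P / (A * p))
            * (1 + L + 16 * L ^ 2))) := by gcongr
      _ = ρ * (c₁ * (1 + L + 16 * L ^ 2) / 0.7 * (1 / (μ * P)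
            * (1 + M / (μ * A * p) + M * μ * P / (A * p)) * l)) := by
          rw [hρ]; field_simp
      _ ≤ ρ * T := by gcongr
  have hdecay : (1 - ρ) ^ T * X₀ ≤ ε / 10 :=
    FedAMD.geometric_decay_le hρ1 hX0 (by positivity) (hΔ.trans (le_max_left _ _)) hε hρT
  -- Dropping the staleness leaves `ε / 10 + 0.893 ε ≤ ε`.
  have hgap : ∫⁻ ω, ENNReal.ofReal (FedAMD.globalLoss f D (FedAMD.model f ηl ηs x₀ ω T) - Fmin)
      ∂FedAMD.runLaw D A b K b' p ≤ ENNReal.ofReal ε := by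
    refine (lintegral_mono fun ω => ENNReal.ofReal_le_ofReal ?_).trans
      (hlyap.trans (ENNReal.ofReal_le_ofReal (by linarith)))
    rw [FedAMD.model, ← FedAMD.augRun_fst, FedAMD.lyapunov]
    have := FedAMD.staleness_nonneg (FedAMD.augRun f ηl ηs x₀ ω T)
    have hq : 0 < (A : ℝ) / M * p := by positivity
    exact le_add_of_nonneg_right (by positivity)
  have hmeas : Measurable fun ω : FedAMD.RunChoice Z M b K b' =>
      FedAMD.globalLoss f D (FedAMD.model f ηl ηs x₀ ω T) - Fmin := by
    simp only [FedAMD.model, ← FedAMD.augRun_fst]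
    exact (hS.measurable_globalLoss.comp
      (FedAMD.measurable_augRun hreg.1 hreg.2.1 ηl ηs x₀ T).fst.fst).sub_const _
  have hnn : 0 ≤ᵐ[FedAMD.runLaw D A b K b' p] fun ω =>
      FedAMD.globalLoss f D (FedAMD.model f ηl ηs x₀ ω T) - Fmin :=
    .of_forall fun ω => sub_nonneg.2 (hmin _)
  -- The gap is nonnegative and measurable, so its finite lower integral already yields
  -- integrability.
  have hint := (lintegral_ofReal_ne_top_iff_integrable hmeas.aestronglyMeasurable hnn).1
    (hgap.trans_lt ENNReal.ofReal_lt_top).ne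
  refine ⟨(hint.add (integrable_const Fmin)).congr (.of_forall fun ω => by simp), ?_⟩
  rwa [← ofReal_integral_eq_lintegral_ofReal hint hnn, ENNReal.ofReal_le_ofReal_iff hε.le] at hgap
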